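/- Let $\mu>-1$. For $t,x,y>0$ let $$W_t^\mu(x,y)=\frac{(xy)^{1/2}}{2t}\,I_\mu\Big(\frac{xy}{2t}\Big)e^{-\frac{x^2+y^2}{4t}},\qquad I_\mu(z)=\sum_{k=0}^\infty\frac{(z/2)^{2k+\mu}}{k!\,\Gamma(k+\mu+1)},$$ and let $\Delta_\mu=\partial_x^2+(\tfrac14-\mu^2)x^{-2}$ on $(0,\infty)$. Let $f\in L^\infty((0,\infty)^2)$ and $g\in L^\infty(0,\infty)$ be complex valued with compact support (in $(0,\infty)^2$ and in $(0,\infty)$, respectively), and define $$u(t,x)=\int_0^t\int_0^\infty W_\tau^\mu(x,y)f(t-\tau,y)\,dy\,d\tau+\int_0^\infty W_t^\mu(x,y)g(y)\,dy,\qquad t,x>0.$$ Then both integrals converge absolutely for all $t,x>0$. If moreover $f\in C^2((0,\infty)^2)$, then $u$ is a classical solution of the Cauchy problem $\partial_tu=\Delta_\mu u+f$ on $(0,\infty)^2$, $u(0,\cdot)=g$: the functions $u,\partial_tu,\partial_xu,\partial_x^2u$ exist and are continuous on $(0,\infty)^2$, the equation holds at every point, and $\lim_{t\to0^+}u(t,x)=g(x)$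 for almost every $x>0$, and for every $x>0$ if $g$ is continuous on $(0,\infty)$. Furthermore, for all $t,x>0$, $$\partial_tu(t,x)=\lim_{\epsilon\to0^+}\int_\epsilon^t\int_0^\infty\partial_\tau W_\tau^\mu(x,y)f(t-\tau,y)\,dy\,d\tau+f(t,x)+\int_0^\infty\partial_tW_t^\mu(x,y)g(y)\,dy,$$ $$\partial_x^2u(t,x)=\lim_{\epsilon\to0^+}\int_\epsilon^t\int_0^\infty\partial_x^2W_\tau^\mu(x,y)f(t-\tau,y)\,dy\,d\tau+\int_0^\infty\partial_x^2W_t^\mu(x,y)g(y)\,dy,$$ where the limits exist, the integrals over $(\epsilon,t)\times(0,\infty)$ and the integrals involving $g$ converge absolutely, the inner integrals over $y$ are integrable functions of $\tau\in(0,t)$, and the limits are unchanged if $\int_\epsilon^t$ is replaced by $\int_0^{t-\epsilon}$ (as iterated integrals). -/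

import Mathlib

open Set Filter Topology MeasureTheory

/-- The open quadrant `(0,∞) × (0,∞)`. -/
def quadrant : Set (ℝ × ℝ) := Ioi 0 ×ˢ Ioi 0

/-- The modified Bessel function of the first kind and order `ν`, on `z > 0` (for `ν > -1`):
`I_ν(z) = ∑_{k ≥ 0} (z/2)^{2k+ν} / (k! Γ(k+ν+1))`. -/
noncomputable def besselI (ν z : ℝ) : ℝ :=
  ∑' k : ℕ, (z / 2) ^ (2 * (k : ℝ) + ν) / ((k.factorial : ℝ) * Real.Gamma ((k : ℝ) + ν + 1))

/-- The heat kernel of the Bessel operator,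
`W_t^μ(x,y) = (xy)^{1/2}/(2t) · I_μ(xy/(2t)) · e^{-(x²+y²)/(4t)}` for `t, x, y > 0`. -/
noncomputable def besselHeatKernel (μ t x y : ℝ) : ℝ :=
  Real.sqrt (x * y) / (2 * t) * besselI μ (x * y / (2 * t)) *
    Real.exp (-(x ^ 2 + y ^ 2) / (4 * t))

/-- The partial derivative of `W_τ^μ(x,y)` with respect to the time variable `τ`. -/
noncomputable def besselHeatKernelDt (μ τ x y : ℝ) : ℝ :=
  deriv (fun s => besselHeatKernel μ s x y) τ

/-- The second partial derivative of `W_τ^μ(x,y)` with respect to `x`. -/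
noncomputable def besselHeatKernelDxx (μ τ x y : ℝ) : ℝ :=
  iteratedDeriv 2 (fun z => besselHeatKernel μ τ z y) x

/-- The Bessel operator `Δ_μ φ(x) = φ''(x) + (1/4 - μ²) x⁻² φ(x)`. -/
noncomputable def besselOp (μ : ℝ) (φ : ℝ → ℂ) (x : ℝ) : ℂ :=
  iteratedDeriv 2 φ x + ((1 / 4 - μ ^ 2) / x ^ 2) • φ x

/-- `h`, as an almost everywhere defined function on `Ω`, has compact support in `Ω`. -/
def HasCompactSupportIn {E : Type*} [TopologicalSpace E] [MeasureSpace E]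
    (h : E → ℂ) (Ω : Set E) : Prop :=
  ∃ K : Set E, K ⊆ Ω ∧ IsCompact K ∧ ∀ᵐ z ∂(volume.restrict Ω), z ∉ K → h z = 0

/-- `u(t,x) = ∫₀ᵗ ∫₀^∞ W_τ^μ(x,y) f(t-τ,y) dy dτ + ∫₀^∞ W_t^μ(x,y) g(y) dy`. -/
noncomputable def besselDuhamel (μ : ℝ) (f : ℝ × ℝ → ℂ) (g : ℝ → ℂ) (t x : ℝ) : ℂ :=
  (∫ τ in (0 : ℝ)..t, ∫ y in Ioi (0 : ℝ), besselHeatKernel μ τ x y • f (t - τ, y)) +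
    ∫ y in Ioi (0 : ℝ), besselHeatKernel μ t x y • g y

/-- `u` is a classical solution on `(0,∞)²` of `∂_t u = Δ_μ u + f`, `u(0,·) = g`. The function `u`
and its derivatives `∂_t u`, `∂_x u`, `∂_x² u` exist and are continuous on the open quadrant, and
the equation holds at every point. The initial value is the limit as `t → 0⁺`; since `g` is in
general only a class in `L^∞`, it is attained at almost every `x`, and at every `x` when `g` is
continuous. -/
structure IsClassicalBesselSolution (μ : ℝ) (f : ℝ × ℝ → ℂ) (g : ℝ → ℂ) (u : ℝ → ℝ → ℂ) :
    Prop where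
  differentiableAt_time : ∀ t > 0, ∀ x > 0, DifferentiableAt ℝ (fun s => u s x) t
  differentiableAt_space : ∀ t > 0, ∀ x > 0, DifferentiableAt ℝ (u t) x
  differentiableAt_deriv_space : ∀ t > 0, ∀ x > 0, DifferentiableAt ℝ (deriv (u t)) x
  continuousOn : ContinuousOn (fun p : ℝ × ℝ => u p.1 p.2) quadrant
  continuousOn_time : ContinuousOn (fun p : ℝ × ℝ => deriv (fun s => u s p.2) p.1) quadrant
  continuousOn_space : ContinuousOn (fun p : ℝ × ℝ => deriv (u p.1) p.2) quadrant
  continuousOn_space_two :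
    ContinuousOn (fun p : ℝ × ℝ => iteratedDeriv 2 (u p.1) p.2) quadrant
  equation : ∀ t > 0, ∀ x > 0, deriv (fun s => u s x) t = besselOp μ (u t) x + f (t, x)
  initial_ae : ∀ᵐ x ∂(volume.restrict (Ioi (0 : ℝ))),
    Tendsto (fun t => u t x) (𝓝[>] 0) (𝓝 (g x))
  initial_of_continuousOn : ContinuousOn g (Ioi 0) →
    ∀ x > 0, Tendsto (fun t => u t x) (𝓝[>] 0) (𝓝 (g x))

/-- For a kernel `k(τ,x,y)` (a derivative of the heat kernel), the truncated integrals
`∫_ε^t ∫₀^∞ k(τ,x,y) f(t-τ,y) dy dτ` converge absolutely, the inner integral is integrable in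
`τ ∈ (0,t)`, and both `∫_ε^t ∫₀^∞ k(τ,x,y) f(t-τ,y) dy dτ` and
`∫_0^{t-ε} ∫₀^∞ k(τ,x,y) f(t-τ,y) dy dτ` tend to `L` as `ε → 0⁺`. -/
def HasTruncatedLimit (k : ℝ → ℝ → ℝ → ℝ) (f : ℝ × ℝ → ℂ) (t x : ℝ) (L : ℂ) : Prop :=
  (∀ τ ∈ Ioo 0 t, IntegrableOn (fun y => k τ x y • f (t - τ, y)) (Ioi 0)) ∧
  (∀ ε ∈ Ioo 0 t,
    IntegrableOn (fun p : ℝ × ℝ => k p.1 x p.2 • f (t - p.1, p.2)) (Ioo ε t ×ˢ Ioi 0)) ∧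
  IntegrableOn (fun τ => ∫ y in Ioi (0 : ℝ), k τ x y • f (t - τ, y)) (Ioo 0 t) ∧
  Tendsto (fun ε : ℝ => ∫ τ in ε..t, ∫ y in Ioi (0 : ℝ), k τ x y • f (t - τ, y))
    (𝓝[>] 0) (𝓝 L) ∧
  Tendsto (fun ε : ℝ => ∫ τ in (0 : ℝ)..(t - ε), ∫ y in Ioi (0 : ℝ), k τ x y • f (t - τ, y))
    (𝓝[>] 0) (𝓝 L)

/-! Put `ψ(z) = √z I_μ(z)`. Then `W_t(x,y) = (2t)^{-1/2} ψ(xy/2t) e^{-(x²+y²)/4t}`, and Bessel's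
equation in the form `ψ'' = (1 + (μ² - 1/4)/z²) ψ` says exactly that `∂_t W = Δ_μ W` in `x`, hence
also in `y` by symmetry. Two quantitative facts about `W` carry everything else.

Away from the origin `ψ(z) = O(e^z)`, so `W` is bounded by a Gaussian when `x` and `y` stay away
from `0` (`exists_besselHeatKernel_le`). Near the origin and at infinity, control comes from the
invariant function `y^{μ+1/2}`, which `Δ_μ` annihilates: `∫ W_t(x,y) y^{μ+1/2} dy = x^{μ+1/2}`
(`integral_besselHeatKernel_mul_rpow`). Together they make `W` an approximate identity at every
Lebesgue point (`tendsto_integral_besselHeatKernel_smul`), which gives the initial value.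

A `C²` source is extended by zero to `F` on the whole plane, so that the Duhamel integral may be
taken over a fixed interval `(0,S]` with `S ≥ t`. Direct absolute bounds on `∂_τ W` fail to be
integrable at `τ = 0`. Moving the Bessel operator onto `F` by Green's formula leaves `W` against a
bounded function, which is `O(τ^{-1/2})`; the heat equation passes this bound to `∂_x² W`, and
interpolation to `∂_x W`. Thus differentiation in `x` under the integral is legitimate, and the
truncated limits are ordinary integrals in `τ` of the inner integrals.

In time, the derivative of the Duhamel term first falls on `F`. Integrating `d/dτ ∫ W_τ F(t-τ) dy`
over `(0,t)` exchanges it for `∂_τ W`; the end `τ = 0` contributes `F(t,x)`, while `τ = t`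
contributes nothing (`duhamelInt_time_eq`). Combined with the heat equation for the kernel, this is
the differential equation. The term with `g` is smoothed by the kernel and is differentiated over a
compact interval. -/

/-! ### The entire function behind the modified Bessel function -/

/-- The coefficients `1 / (k! Γ(k+ν+1))` of the modified Bessel function of order `ν`. -/
noncomputable def besselCoeff (ν : ℝ) (k : ℕ) : ℝ :=
  1 / ((k.factorial : ℝ) * Real.Gamma ((k : ℝ) + ν + 1))

/-- The entire function `∑ s^k / (k! Γ(k+ν+1))`. -/
noncomputable def besselEntire (ν s : ℝ) : ℝ := ∑' k : ℕ, s ^ k * besselCoeff ν k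

lemma besselCoeff_pos {ν : ℝ} (hν : -1 < ν) (k : ℕ) : 0 < besselCoeff ν k := by
  have : 0 < Real.Gamma ((k : ℝ) + ν + 1) :=
    Real.Gamma_pos_of_pos (by have : (0 : ℝ) ≤ k := k.cast_nonneg; linarith)
  unfold besselCoeff
  positivity

/-- The Gamma function is not monotone on the whole positive axis, but unit steps starting from `ν +
2 > 1` multiply it by factors at least one. -/
lemma Gamma_le_Gamma_nat_add {ν : ℝ} (hν : -1 < ν) (k : ℕ) :
    Real.Gamma (ν + 2) ≤ Real.Gamma (((k + 1 : ℕ) : ℝ) + ν + 1) := by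
  induction k with
  | zero => apply le_of_eq; congr 1; push_cast; ring
  | succ k ih =>
    refine ih.trans ?_
    have hk : (0 : ℝ) ≤ k := k.cast_nonneg
    have h : ((k + 1 + 1 : ℕ) : ℝ) + ν + 1 = (((k + 1 : ℕ) : ℝ) + ν + 1) + 1 := by push_cast; ring
    have hpos : 0 < ((k + 1 : ℕ) : ℝ) + ν + 1 := by push_cast; linarith
    rw [h, Real.Gamma_add_one hpos.ne']
    have := Real.Gamma_pos_of_pos hpos
    refine le_mul_of_one_le_left this.le ?_
    push_cast; linarith

/-- The term `k = 0` needs its own constant, because the factor `ν + 1` relating the first two Gamma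
values may be less than one. The sum covers both cases. -/
lemma besselCoeff_le {ν : ℝ} (hν : -1 < ν) (k : ℕ) :
    besselCoeff ν k ≤
      (1 / Real.Gamma (ν + 1) + 1 / Real.Gamma (ν + 2)) / (k.factorial : ℝ) := by
  have h1 : 0 < Real.Gamma (ν + 1) := Real.Gamma_pos_of_pos (by linarith)
  have h2 : 0 < Real.Gamma (ν + 2) := Real.Gamma_pos_of_pos (by linarith)
  have hf : (0 : ℝ) < k.factorial := by positivity
  have hk : 1 / Real.Gamma ((k : ℝ) + ν + 1) ≤
      1 / Real.Gamma (ν + 1) + 1 / Real.Gamma (ν + 2) := by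
    cases k with
    | zero => simp; positivity
    | succ k =>
      have := one_div_le_one_div_of_le h2 (Gamma_le_Gamma_nat_add hν k)
      have h3 : 0 < 1 / Real.Gamma (ν + 1) := by positivity
      linarith
  unfold besselCoeff
  rw [mul_comm, ← div_div]
  exact div_le_div_of_nonneg_right hk hf.le

lemma summable_besselEntire {ν : ℝ} (hν : -1 < ν) (s : ℝ) :
    Summable fun k : ℕ => s ^ k * besselCoeff ν k := by
  refine Summable.of_norm_bounded
    ((Real.summable_pow_div_factorial |s|).mul_left
      (1 / Real.Gamma (ν + 1) + 1 / Real.Gamma (ν + 2))) fun k => ?_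
  rw [norm_mul, norm_pow, Real.norm_eq_abs, Real.norm_of_nonneg (besselCoeff_pos hν k).le]
  calc |s| ^ k * besselCoeff ν k
      ≤ |s| ^ k * ((1 / Real.Gamma (ν + 1) + 1 / Real.Gamma (ν + 2)) / (k.factorial : ℝ)) := by
        gcongr; exact besselCoeff_le hν k
    _ = _ := by ring

lemma succ_mul_besselCoeff_succ (ν : ℝ) (k : ℕ) :
    ((k : ℝ) + 1) * besselCoeff ν (k + 1) = besselCoeff (ν + 1) k := by
  unfold besselCoeff
  have h : ((k + 1 : ℕ) : ℝ) + ν + 1 = (k : ℝ) + (ν + 1) + 1 := by push_cast; ring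
  rw [h, Nat.factorial_succ]
  push_cast
  have : (k : ℝ) + 1 ≠ 0 := by positivity
  have hf : (k.factorial : ℝ) ≠ 0 := by positivity
  rw [mul_one_div, mul_assoc, ← div_div, div_self this]

lemma besselCoeff_eq_mul {ν : ℝ} (hν : -1 < ν) (k : ℕ) :
    besselCoeff ν k = ((k : ℝ) + ν + 1) * besselCoeff (ν + 1) k := by
  have hp : (0 : ℝ) < (k : ℝ) + ν + 1 := by have : (0 : ℝ) ≤ k := k.cast_nonneg; linarith
  unfold besselCoeff
  have h : (k : ℝ) + (ν + 1) + 1 = (k + ν + 1) + 1 := by ring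
  have hg := Real.Gamma_pos_of_pos hp
  rw [h, Real.Gamma_add_one hp.ne']
  have hf : (k.factorial : ℝ) ≠ 0 := by positivity
  field_simp

lemma besselEntire_pos {ν : ℝ} (hν : -1 < ν) {s : ℝ} (hs : 0 ≤ s) : 0 < besselEntire ν s := by
  refine (summable_besselEntire hν s).tsum_pos (fun k => ?_) 0 ?_
  · exact mul_nonneg (pow_nonneg hs k) (besselCoeff_pos hν k).le
  · simpa using besselCoeff_pos hν 0

lemma hasDerivAt_besselEntire {ν : ℝ} (hν : -1 < ν) (s : ℝ) :
    HasDerivAt (besselEntire ν) (besselEntire (ν + 1) s) s := by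
  -- The series of derivatives is dominated on the ball of radius `R` by its own value at `R`; the
  -- factor `k` makes the truncated exponent at `k = 0` harmless.
  set R : ℝ := |s| + 1
  have hR : 0 ≤ R := by positivity
  have hshift : ∀ r : ℝ, ∀ k : ℕ,
      ((k + 1 : ℕ) : ℝ) * r ^ (k + 1 - 1) * besselCoeff ν (k + 1) =
        r ^ k * besselCoeff (ν + 1) k := by
    intro r k
    rw [← succ_mul_besselCoeff_succ]
    rw [Nat.add_sub_cancel]
    push_cast
    ring
  have hsum : ∀ r : ℝ, Summable fun k : ℕ => (k : ℝ) * r ^ (k - 1) * besselCoeff ν k := by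
    intro r
    rw [← summable_nat_add_iff 1]
    exact (summable_besselEntire (by linarith : -1 < ν + 1) r).congr fun k => (hshift r k).symm
  have key := hasDerivAt_tsum_of_isPreconnected (hsum R) Metric.isOpen_ball
    (convex_ball (0 : ℝ) R).isPreconnected
    (g := fun (k : ℕ) (r : ℝ) => r ^ k * besselCoeff ν k)
    (g' := fun (k : ℕ) (r : ℝ) => (k : ℝ) * r ^ (k - 1) * besselCoeff ν k)
    (fun k r _ => (hasDerivAt_pow k r).mul_const _)
    (fun k r hr => ?_) (y₀ := s) (y := s) (by simp [R]) (summable_besselEntire hν s) (by simp [R])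
  · refine key.congr_deriv ?_
    rw [(hsum s).tsum_eq_zero_add]
    simp only [hshift]
    simp [besselEntire]
  · rw [norm_mul, norm_mul, norm_pow, Real.norm_of_nonneg (besselCoeff_pos hν k).le,
      Real.norm_of_nonneg (Nat.cast_nonneg k)]
    have : ‖r‖ ≤ R := by simpa using (mem_ball_zero_iff.1 hr).le
    have := (besselCoeff_pos hν k).le
    gcongr

/-- Since differentiation raises the order by one, this is the equation `s b'' + (ν+1) b' = b` for
the entire function `b`, that is, Bessel's equation in the variable `s = z²/4`. -/
lemma besselEntire_recurrence {ν : ℝ} (hν : -1 < ν) (s : ℝ) :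
    s * besselEntire (ν + 1 + 1) s + (ν + 1) * besselEntire (ν + 1) s = besselEntire ν s := by
  have h1 := summable_besselEntire (by linarith : -1 < ν + 1) s
  have h2 := summable_besselEntire (by linarith : -1 < ν + 1 + 1) s
  have hk : ∀ k : ℕ, s ^ k * besselCoeff ν k =
      (k : ℝ) * (s ^ k * besselCoeff (ν + 1) k) + (ν + 1) * (s ^ k * besselCoeff (ν + 1) k) := by
    intro k
    rw [besselCoeff_eq_mul hν k]; ring
  have hs : ∀ k : ℕ, ((k + 1 : ℕ) : ℝ) * (s ^ (k + 1) * besselCoeff (ν + 1) (k + 1)) =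
      s * (s ^ k * besselCoeff (ν + 1 + 1) k) := by
    intro k
    rw [← succ_mul_besselCoeff_succ (ν + 1)]; push_cast; ring
  have hS : Summable fun k : ℕ => (k : ℝ) * (s ^ k * besselCoeff (ν + 1) k) := by
    rw [← summable_nat_add_iff 1]
    exact (h2.mul_left s).congr fun k => (hs k).symm
  unfold besselEntire
  simp_rw [hk]
  rw [hS.tsum_add (h1.mul_left _), tsum_mul_left, hS.tsum_eq_zero_add]
  simp_rw [hs, tsum_mul_left]
  simp

/-! ### The function `z ↦ √z I_μ(z)` -/

/-- `√z I_μ(z)` for `z > 0`. -/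
noncomputable def sqrtBessel (μ z : ℝ) : ℝ :=
  2 ^ (-μ) * (z ^ (μ + 1 / 2) * besselEntire μ (z ^ 2 / 4))

/-- The derivative of `√z I_μ(z)`. -/
noncomputable def sqrtBesselDeriv (μ z : ℝ) : ℝ :=
  2 ^ (-μ) * ((μ + 1 / 2) * z ^ (μ - 1 / 2) * besselEntire μ (z ^ 2 / 4) +
    z ^ (μ + 1 / 2) * (besselEntire (μ + 1) (z ^ 2 / 4) * (z / 2)))

lemma sqrt_mul_besselI (μ : ℝ) {z : ℝ} (hz : 0 < z) :
    Real.sqrt z * besselI μ z = sqrtBessel μ z := by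
  unfold besselI sqrtBessel besselEntire
  have h : ∀ k : ℕ, (z / 2) ^ (2 * (k : ℝ) + μ) /
      ((k.factorial : ℝ) * Real.Gamma ((k : ℝ) + μ + 1)) =
      (2 ^ (-μ) * z ^ μ) * ((z ^ 2 / 4) ^ k * besselCoeff μ k) := by
    intro k
    have h4 : (z ^ 2 / 4) = (z / 2) ^ 2 := by ring
    have h2k : (z / 2) ^ (2 * (k : ℝ)) = (z / 2) ^ (2 * k) := by
      rw [← Real.rpow_natCast]; push_cast; rfl
    rw [Real.rpow_add (by positivity), besselCoeff, h4, ← pow_mul, h2k,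
      Real.div_rpow hz.le (by norm_num) μ, Real.rpow_neg (by norm_num)]
    ring
  simp_rw [h]
  rw [tsum_mul_left, Real.sqrt_eq_rpow, add_comm, Real.rpow_add hz]
  ring

lemma sqrtBessel_pos {μ : ℝ} (hμ : -1 < μ) {z : ℝ} (hz : 0 < z) : 0 < sqrtBessel μ z := by
  have := besselEntire_pos hμ (by positivity : 0 ≤ z ^ 2 / 4)
  unfold sqrtBessel
  positivity

lemma hasDerivAt_besselEntire_sq {ν : ℝ} (hν : -1 < ν) (z : ℝ) :
    HasDerivAt (fun z => besselEntire ν (z ^ 2 / 4)) (besselEntire (ν + 1) (z ^ 2 / 4) * (z / 2))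
      z := by
  have h : HasDerivAt (fun z : ℝ => z ^ 2 / 4) (z / 2) z := by
    refine ((hasDerivAt_pow 2 z).div_const 4).congr_deriv ?_
    norm_num
    ring
  exact (hasDerivAt_besselEntire hν _).comp z h

lemma hasDerivAt_sqrtBessel {μ : ℝ} (hμ : -1 < μ) {z : ℝ} (hz : 0 < z) :
    HasDerivAt (sqrtBessel μ) (sqrtBesselDeriv μ z) z := by
  have h1 : HasDerivAt (fun z : ℝ => z ^ (μ + 1 / 2)) ((μ + 1 / 2) * z ^ (μ - 1 / 2)) z := by
    have := Real.hasDerivAt_rpow_const (p := μ + 1 / 2) (Or.inl hz.ne')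
    rwa [show μ + 1 / 2 - 1 = μ - 1 / 2 by ring] at this
  exact (h1.mul (hasDerivAt_besselEntire_sq hμ z)).const_mul _

/-- The factor `√z` removes the first-order term from Bessel's equation; what remains is the
recurrence at `s = z²/4`, once all powers of `z` are expressed through `z^{μ-3/2}`. -/
lemma hasDerivAt_sqrtBesselDeriv {μ : ℝ} (hμ : -1 < μ) {z : ℝ} (hz : 0 < z) :
    HasDerivAt (sqrtBesselDeriv μ) ((1 + (μ ^ 2 - 1 / 4) / z ^ 2) * sqrtBessel μ z) z := by
  have h1 : HasDerivAt (fun z : ℝ => z ^ (μ + 1 / 2)) ((μ + 1 / 2) * z ^ (μ - 1 / 2)) z := by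
    have := Real.hasDerivAt_rpow_const (p := μ + 1 / 2) (Or.inl hz.ne')
    rwa [show μ + 1 / 2 - 1 = μ - 1 / 2 by ring] at this
  have h2 : HasDerivAt (fun z : ℝ => z ^ (μ - 1 / 2)) ((μ - 1 / 2) * z ^ (μ - 1 / 2 - 1)) z :=
    Real.hasDerivAt_rpow_const (p := μ - 1 / 2) (Or.inl hz.ne')
  have h3 : HasDerivAt (fun z : ℝ => z / 2) (1 / 2) z := (hasDerivAt_id z).div_const 2
  have hB := hasDerivAt_besselEntire_sq hμ z
  have hB' := hasDerivAt_besselEntire_sq (by linarith : -1 < μ + 1) z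
  have key := (((h2.const_mul (μ + 1 / 2)).mul hB).add (h1.mul (hB'.mul h3))).const_mul
    ((2 : ℝ) ^ (-μ))
  refine key.congr_deriv ?_
  have hrec := besselEntire_recurrence hμ (z ^ 2 / 4)
  have e1 : z ^ (μ + 1 / 2) = z ^ (μ - 1 / 2 - 1) * z ^ 2 := by
    rw [← Real.rpow_natCast z 2, ← Real.rpow_add hz]; congr 1; push_cast; ring
  have e2 : z ^ (μ - 1 / 2) = z ^ (μ - 1 / 2 - 1) * z := by
    rw [← Real.rpow_add_one hz.ne']; congr 1; ring
  simp only [sqrtBessel, Pi.mul_apply]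
  rw [e1, e2]
  set A := z ^ (μ - 1 / 2 - 1)
  set B0 := besselEntire μ (z ^ 2 / 4)
  set B1 := besselEntire (μ + 1) (z ^ 2 / 4)
  set B2 := besselEntire (μ + 1 + 1) (z ^ 2 / 4)
  field_simp
  linear_combination (16 * A * z ^ 2) * hrec

/-- `√z I_μ(z) = O(e^z)` away from the origin: for `p = e^{-z}(ψ' + ψ)` and `q = e^{-z}(ψ' - ψ)`
the function `(p² + q²) e^{|c|/z}` is antitone. -/
lemma exists_sqrtBessel_le {μ : ℝ} (hμ : -1 < μ) {z₀ : ℝ} (hz₀ : 0 < z₀) :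
    ∃ C, 0 < C ∧ ∀ z, z₀ ≤ z → sqrtBessel μ z ≤ C * Real.exp z := by
  set c := μ ^ 2 - 1 / 4
  set p : ℝ → ℝ := fun z => Real.exp (-z) * (sqrtBesselDeriv μ z + sqrtBessel μ z) with hp
  set q : ℝ → ℝ := fun z => Real.exp (-z) * (sqrtBesselDeriv μ z - sqrtBessel μ z) with hq
  set N : ℝ → ℝ := fun z => (p z ^ 2 + q z ^ 2) * Real.exp (|c| / z) with hN
  have hexp : ∀ z : ℝ, HasDerivAt (fun z => Real.exp (-z)) (-Real.exp (-z)) z := by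
    intro z
    simpa using (hasDerivAt_neg z).exp
  have hdp : ∀ z, 0 < z → HasDerivAt p (c / (2 * z ^ 2) * (p z - q z)) z := by
    intro z hz
    refine ((hexp z).mul
      ((hasDerivAt_sqrtBesselDeriv hμ hz).add (hasDerivAt_sqrtBessel hμ hz))).congr_deriv ?_
    simp only [hp, hq, c, Pi.add_apply]
    field_simp
    ring
  have hdq : ∀ z, 0 < z → HasDerivAt q (-2 * q z + c / (2 * z ^ 2) * (p z - q z)) z := by
    intro z hz
    refine ((hexp z).mul
      ((hasDerivAt_sqrtBesselDeriv hμ hz).sub (hasDerivAt_sqrtBessel hμ hz))).congr_deriv ?_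
    simp only [hp, hq, c, Pi.sub_apply]
    field_simp
    ring
  have hdN : ∀ z, 0 < z → HasDerivAt N
      ((2 * p z * (c / (2 * z ^ 2) * (p z - q z)) +
        2 * q z * (-2 * q z + c / (2 * z ^ 2) * (p z - q z))) * Real.exp (|c| / z) +
        (p z ^ 2 + q z ^ 2) * (Real.exp (|c| / z) * (-|c| / z ^ 2))) z := by
    intro z hz
    have he : HasDerivAt (fun z : ℝ => Real.exp (|c| / z))
        (Real.exp (|c| / z) * (-|c| / z ^ 2)) z := by
      have h0 : HasDerivAt (fun z : ℝ => |c| / z) (-|c| / z ^ 2) z := by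
        have := (hasDerivAt_inv hz.ne').const_mul |c|
        simp only [← div_eq_mul_inv] at this
        refine this.congr_deriv ?_
        ring
      exact h0.exp
    have := (((hdp z hz).pow 2).add ((hdq z hz).pow 2)).mul he
    refine this.congr_deriv ?_
    simp only [Pi.add_apply, Pi.pow_apply]
    norm_num
  have hanti : AntitoneOn N (Ici z₀) := by
    refine antitoneOn_of_deriv_nonpos (convex_Ici z₀)
      (fun z hz => (hdN z (hz₀.trans_le hz)).continuousAt.continuousWithinAt) ?_ ?_
    · intro z hz
      rw [interior_Ici] at hz
      exact (hdN z (hz₀.trans hz)).differentiableAt.differentiableWithinAt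
    · intro z hz
      rw [interior_Ici] at hz
      have hz' : 0 < z := hz₀.trans hz
      rw [(hdN z hz').deriv]
      have hE := Real.exp_pos (|c| / z)
      -- The mixed products `p q` cancel and leave `(c/z²)(p² - q²) - 4q²`; the derivative of the
      -- weight contributes `-(|c|/z²)(p² + q²)`, which absorbs the first term.
      have h2 : (2 * p z * (c / (2 * z ^ 2) * (p z - q z)) +
        2 * q z * (-2 * q z + c / (2 * z ^ 2) * (p z - q z))) * Real.exp (|c| / z) +
        (p z ^ 2 + q z ^ 2) * (Real.exp (|c| / z) * (-|c| / z ^ 2)) =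
        Real.exp (|c| / z) * (-4 * q z ^ 2 - (1 / z ^ 2) *
          ((|c| - c) * p z ^ 2 + (|c| + c) * q z ^ 2)) := by
        field_simp
        ring
      rw [h2]
      have h3 : 0 ≤ |c| - c := sub_nonneg.2 (le_abs_self c)
      have h4 : 0 ≤ |c| + c := by have := neg_abs_le c; linarith
      have h5 : 0 ≤ (1 / z ^ 2) * ((|c| - c) * p z ^ 2 + (|c| + c) * q z ^ 2) := by positivity
      refine mul_nonpos_of_nonneg_of_nonpos hE.le ?_
      nlinarith [sq_nonneg (q z)]
  refine ⟨Real.sqrt (N z₀) + 1, by positivity, fun z hz => ?_⟩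
  have hz' : 0 < z := hz₀.trans_le hz
  have h1 : N z ≤ N z₀ := hanti self_mem_Ici hz hz
  have h2 : p z ^ 2 + q z ^ 2 ≤ N z₀ := by
    refine le_trans ?_ h1
    exact le_mul_of_one_le_right (by positivity) (Real.one_le_exp (by positivity))
  -- Here `e^{-z}ψ = (p - q)/2`, and the weight in `N` is at least one.
  have h3 : (Real.exp (-z) * sqrtBessel μ z) ^ 2 ≤ N z₀ := by
    have : Real.exp (-z) * sqrtBessel μ z = (p z - q z) / 2 := by simp only [hp, hq]; ring
    rw [this]
    nlinarith [sq_nonneg (p z + q z), sq_nonneg (p z), sq_nonneg (q z)]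
  have h4 : Real.exp (-z) * sqrtBessel μ z ≤ Real.sqrt (N z₀) := Real.le_sqrt_of_sq_le h3
  have h5 : sqrtBessel μ z = (Real.exp (-z) * sqrtBessel μ z) * Real.exp z := by
    rw [mul_right_comm, ← Real.exp_add]; simp
  rw [h5]
  have := Real.exp_pos z
  gcongr
  linarith

/-! ### The heat kernel and its derivatives -/

/-- The first partial derivative of `W_t^μ(x,y)` with respect to `x`. -/
noncomputable def besselHeatKernelDx (μ t x y : ℝ) : ℝ :=
  (Real.sqrt (2 * t))⁻¹ * (y / (2 * t) * sqrtBesselDeriv μ (x * y / (2 * t)) -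
    x / (2 * t) * sqrtBessel μ (x * y / (2 * t))) * Real.exp (-(x ^ 2 + y ^ 2) / (4 * t))

/-- An explicit expression for the time derivative of `W_t^μ(x,y)`. -/
noncomputable def besselHeatKernelTime (μ t x y : ℝ) : ℝ :=
  (Real.sqrt (2 * t))⁻¹ * (((x ^ 2 + y ^ 2) / (4 * t ^ 2) - 1 / (2 * t)) *
    sqrtBessel μ (x * y / (2 * t)) - x * y / (2 * t ^ 2) * sqrtBesselDeriv μ (x * y / (2 * t))) *
      Real.exp (-(x ^ 2 + y ^ 2) / (4 * t))

/-- The factor `√(xy)` is split as `√(2t) √(xy/2t)`, so that `t`, `x`, `y` enter the Bessel part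
only through `z = xy/2t`. -/
lemma besselHeatKernel_eq (μ : ℝ) {t x y : ℝ} (ht : 0 < t) (hx : 0 < x) (hy : 0 < y) :
    besselHeatKernel μ t x y = (Real.sqrt (2 * t))⁻¹ * sqrtBessel μ (x * y / (2 * t)) *
      Real.exp (-(x ^ 2 + y ^ 2) / (4 * t)) := by
  rw [← sqrt_mul_besselI μ (by positivity), besselHeatKernel, Real.sqrt_div (by positivity)]
  have h : Real.sqrt (2 * t) * Real.sqrt (2 * t) = 2 * t := Real.mul_self_sqrt (by positivity)
  have h0 : 0 < Real.sqrt (2 * t) := Real.sqrt_pos.2 (by positivity)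
  congr 1
  rw [← mul_assoc]
  congr 1
  nth_rw 1 [← h]
  field_simp

lemma besselHeatKernel_comm (μ t x y : ℝ) :
    besselHeatKernel μ t x y = besselHeatKernel μ t y x := by
  unfold besselHeatKernel
  rw [mul_comm x y, add_comm (x ^ 2)]

lemma besselHeatKernelTime_comm (μ t x y : ℝ) :
    besselHeatKernelTime μ t x y = besselHeatKernelTime μ t y x := by
  unfold besselHeatKernelTime
  rw [mul_comm x y, add_comm (x ^ 2)]

lemma besselHeatKernel_pos {μ : ℝ} (hμ : -1 < μ) {t x y : ℝ} (ht : 0 < t) (hx : 0 < x)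
    (hy : 0 < y) : 0 < besselHeatKernel μ t x y := by
  rw [besselHeatKernel_eq μ ht hx hy]
  have := sqrtBessel_pos hμ (by positivity : 0 < x * y / (2 * t))
  positivity

/-! ### Joint continuity of the kernel and of its derivatives. -/

section Continuity

variable {α : Type*} [TopologicalSpace α] {T X Y : α → ℝ} {p : α}

lemma ContinuousAt.sqrtBessel_comp {μ : ℝ} (hμ : -1 < μ) {Z : α → ℝ} (hZ : ContinuousAt Z p)
    (h : 0 < Z p) : ContinuousAt (fun q => sqrtBessel μ (Z q)) p :=
  ContinuousAt.comp (g := sqrtBessel μ) (hasDerivAt_sqrtBessel hμ h).continuousAt hZ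

lemma ContinuousAt.sqrtBesselDeriv_comp {μ : ℝ} (hμ : -1 < μ) {Z : α → ℝ}
    (hZ : ContinuousAt Z p) (h : 0 < Z p) :
    ContinuousAt (fun q => sqrtBesselDeriv μ (Z q)) p :=
  ContinuousAt.comp (g := sqrtBesselDeriv μ) (hasDerivAt_sqrtBesselDeriv hμ h).continuousAt hZ

lemma ContinuousAt.besselHeatKernel_comp {μ : ℝ} (hμ : -1 < μ) (hT : ContinuousAt T p)
    (hX : ContinuousAt X p) (hY : ContinuousAt Y p) (t0 : 0 < T p) (x0 : 0 < X p)
    (y0 : 0 < Y p) : ContinuousAt (fun q => besselHeatKernel μ (T q) (X q) (Y q)) p := by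
  have hev : (fun q => besselHeatKernel μ (T q) (X q) (Y q)) =ᶠ[𝓝 p] fun q =>
      (Real.sqrt (2 * T q))⁻¹ * sqrtBessel μ (X q * Y q / (2 * T q)) *
      Real.exp (-(X q ^ 2 + Y q ^ 2) / (4 * T q)) := by
    filter_upwards [hT.eventually_const_lt t0, hX.eventually_const_lt x0,
      hY.eventually_const_lt y0] with q h1 h2 h3 using besselHeatKernel_eq μ h1 h2 h3
  refine ContinuousAt.congr ?_ hev.symm
  have hz : ContinuousAt (fun q => X q * Y q / (2 * T q)) p := by
    fun_prop (disch := positivity)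
  have h1 := hz.sqrtBessel_comp hμ (by positivity)
  have : Real.sqrt (2 * T p) ≠ 0 := (Real.sqrt_pos.2 (by positivity)).ne'
  fun_prop (disch := first | assumption | positivity)

lemma ContinuousAt.besselHeatKernelDx_comp {μ : ℝ} (hμ : -1 < μ) (hT : ContinuousAt T p)
    (hX : ContinuousAt X p) (hY : ContinuousAt Y p) (t0 : 0 < T p) (x0 : 0 < X p)
    (y0 : 0 < Y p) : ContinuousAt (fun q => besselHeatKernelDx μ (T q) (X q) (Y q)) p := by
  have hz : ContinuousAt (fun q => X q * Y q / (2 * T q)) p := by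
    fun_prop (disch := positivity)
  have h1 := hz.sqrtBessel_comp hμ (by positivity)
  have h2 := hz.sqrtBesselDeriv_comp hμ (by positivity)
  have : Real.sqrt (2 * T p) ≠ 0 := (Real.sqrt_pos.2 (by positivity)).ne'
  unfold besselHeatKernelDx
  fun_prop (disch := first | assumption | positivity)

lemma ContinuousAt.besselHeatKernelTime_comp {μ : ℝ} (hμ : -1 < μ) (hT : ContinuousAt T p)
    (hX : ContinuousAt X p) (hY : ContinuousAt Y p) (t0 : 0 < T p) (x0 : 0 < X p)
    (y0 : 0 < Y p) : ContinuousAt (fun q => besselHeatKernelTime μ (T q) (X q) (Y q)) p := by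
  have hz : ContinuousAt (fun q => X q * Y q / (2 * T q)) p := by
    fun_prop (disch := positivity)
  have h1 := hz.sqrtBessel_comp hμ (by positivity)
  have h2 := hz.sqrtBesselDeriv_comp hμ (by positivity)
  have : Real.sqrt (2 * T p) ≠ 0 := (Real.sqrt_pos.2 (by positivity)).ne'
  unfold besselHeatKernelTime
  fun_prop (disch := first | assumption | positivity)

end Continuity

/-! ### The heat equation for the kernel. -/

section Derivatives

variable {μ t x y : ℝ}

lemma hasDerivAt_exp_gaussian_space (ht : 0 < t) (x y : ℝ) :
    HasDerivAt (fun x => Real.exp (-(x ^ 2 + y ^ 2) / (4 * t)))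
      (Real.exp (-(x ^ 2 + y ^ 2) / (4 * t)) * (-(x / (2 * t)))) x := by
  have h : HasDerivAt (fun x : ℝ => -(x ^ 2 + y ^ 2) / (4 * t)) (-(x / (2 * t))) x := by
    refine ((((hasDerivAt_pow 2 x).add_const (y ^ 2)).neg).div_const (4 * t)).congr_deriv ?_
    norm_num
    field_simp
    ring
  exact h.exp

lemma hasDerivAt_mul_div_space (x : ℝ) :
    HasDerivAt (fun x => x * y / (2 * t)) (y / (2 * t)) x := by
  simpa using ((hasDerivAt_id x).mul_const y).div_const (2 * t)

lemma hasDerivAt_besselHeatKernel_space (hμ : -1 < μ) (ht : 0 < t) (hx : 0 < x) (hy : 0 < y) :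
    HasDerivAt (fun x => besselHeatKernel μ t x y) (besselHeatKernelDx μ t x y) x := by
  have hev : (fun x => besselHeatKernel μ t x y) =ᶠ[𝓝 x] fun x =>
      (Real.sqrt (2 * t))⁻¹ * sqrtBessel μ (x * y / (2 * t)) *
      Real.exp (-(x ^ 2 + y ^ 2) / (4 * t)) := by
    filter_upwards [lt_mem_nhds hx] with q h using besselHeatKernel_eq μ ht h hy
  refine HasDerivAt.congr_of_eventuallyEq ?_ hev
  have h1 : HasDerivAt (fun x => sqrtBessel μ (x * y / (2 * t)))
      (sqrtBesselDeriv μ (x * y / (2 * t)) * (y / (2 * t))) x :=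
    (hasDerivAt_sqrtBessel hμ (by positivity)).comp x (hasDerivAt_mul_div_space x)
  refine ((h1.const_mul _).mul (hasDerivAt_exp_gaussian_space ht x y)).congr_deriv ?_
  unfold besselHeatKernelDx
  ring

/-- This is the heat equation `∂_x² W = ∂_t W - (1/4 - μ²) x^{-2} W`. The singular term of `ψ''`
yields the potential, because `(y/2t)² / z² = x^{-2}`. -/
lemma hasDerivAt_besselHeatKernelDx (hμ : -1 < μ) (ht : 0 < t) (hx : 0 < x) (hy : 0 < y) :
    HasDerivAt (fun x => besselHeatKernelDx μ t x y)
      (besselHeatKernelTime μ t x y - (1 / 4 - μ ^ 2) / x ^ 2 * besselHeatKernel μ t x y) x := by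
  have h1 : HasDerivAt (fun x => sqrtBessel μ (x * y / (2 * t)))
      (sqrtBesselDeriv μ (x * y / (2 * t)) * (y / (2 * t))) x :=
    (hasDerivAt_sqrtBessel hμ (by positivity)).comp x (hasDerivAt_mul_div_space x)
  have h2 : HasDerivAt (fun x => sqrtBesselDeriv μ (x * y / (2 * t)))
      ((1 + (μ ^ 2 - 1 / 4) / (x * y / (2 * t)) ^ 2) * sqrtBessel μ (x * y / (2 * t)) *
        (y / (2 * t))) x :=
    (hasDerivAt_sqrtBesselDeriv hμ (by positivity)).comp x (hasDerivAt_mul_div_space x)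
  have h3 : HasDerivAt (fun x : ℝ => x / (2 * t)) (1 / (2 * t)) x :=
    (hasDerivAt_id x).div_const _
  refine ((((h2.const_mul (y / (2 * t))).sub (h3.mul h1)).const_mul
    (Real.sqrt (2 * t))⁻¹).mul (hasDerivAt_exp_gaussian_space ht x y)).congr_deriv ?_
  rw [besselHeatKernel_eq μ ht hx hy]
  simp only [besselHeatKernelTime, Pi.sub_apply, Pi.mul_apply]
  have h0 : Real.sqrt (2 * t) ≠ 0 := (Real.sqrt_pos.2 (by positivity)).ne'
  field_simp
  ring

lemma hasDerivAt_besselHeatKernel_time (hμ : -1 < μ) (ht : 0 < t) (hx : 0 < x) (hy : 0 < y) :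
    HasDerivAt (fun t => besselHeatKernel μ t x y) (besselHeatKernelTime μ t x y) t := by
  have hev : (fun t => besselHeatKernel μ t x y) =ᶠ[𝓝 t] fun t =>
      (Real.sqrt (2 * t))⁻¹ * sqrtBessel μ (x * y / (2 * t)) *
      Real.exp (-(x ^ 2 + y ^ 2) / (4 * t)) := by
    filter_upwards [lt_mem_nhds ht] with q h using besselHeatKernel_eq μ h hx hy
  refine HasDerivAt.congr_of_eventuallyEq ?_ hev
  have hinv : ∀ A : ℝ, HasDerivAt (fun t : ℝ => A / t) (-A / t ^ 2) t := by
    intro A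
    have := (hasDerivAt_inv ht.ne').const_mul A
    simp only [← div_eq_mul_inv] at this
    refine this.congr_deriv ?_
    ring
  have hz : HasDerivAt (fun t => x * y / (2 * t)) (-(x * y / (2 * t ^ 2))) t := by
    have := hinv (x * y / 2)
    simp only [div_div] at this
    refine this.congr_deriv ?_
    ring
  have hg : HasDerivAt (fun t => -(x ^ 2 + y ^ 2) / (4 * t)) ((x ^ 2 + y ^ 2) / (4 * t ^ 2)) t := by
    have := hinv (-(x ^ 2 + y ^ 2) / 4)
    simp only [div_div] at this
    refine this.congr_deriv ?_
    ring
  have h1 : HasDerivAt (fun t => sqrtBessel μ (x * y / (2 * t)))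
      (sqrtBesselDeriv μ (x * y / (2 * t)) * (-(x * y / (2 * t ^ 2)))) t :=
    (hasDerivAt_sqrtBessel hμ (by positivity)).comp t hz
  have h2t : HasDerivAt (fun t : ℝ => 2 * t) 2 t := by
    simpa using (hasDerivAt_id t).const_mul 2
  have hs0 : 0 < Real.sqrt (2 * t) := Real.sqrt_pos.2 (by positivity)
  have hs : HasDerivAt (fun t : ℝ => (Real.sqrt (2 * t))⁻¹)
      (-(1 / (2 * t)) * (Real.sqrt (2 * t))⁻¹) t := by
    refine (HasDerivAt.inv (h2t.sqrt (by positivity)) hs0.ne').congr_deriv ?_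
    have h : Real.sqrt (2 * t) ^ 2 = 2 * t := Real.sq_sqrt (by positivity)
    rw [h]
    field_simp
  refine ((hs.mul h1).mul hg.exp).congr_deriv ?_
  simp only [besselHeatKernelTime, Pi.mul_apply]
  ring

lemma besselHeatKernelDt_eq (hμ : -1 < μ) (ht : 0 < t) (hx : 0 < x) (hy : 0 < y) :
    besselHeatKernelDt μ t x y = besselHeatKernelTime μ t x y :=
  (hasDerivAt_besselHeatKernel_time hμ ht hx hy).deriv

lemma besselHeatKernelDxx_eq (hμ : -1 < μ) (ht : 0 < t) (hx : 0 < x) (hy : 0 < y) :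
    besselHeatKernelDxx μ t x y =
      besselHeatKernelTime μ t x y - (1 / 4 - μ ^ 2) / x ^ 2 * besselHeatKernel μ t x y := by
  unfold besselHeatKernelDxx
  rw [iteratedDeriv_succ, iteratedDeriv_one]
  have : deriv (fun z => besselHeatKernel μ t z y) =ᶠ[𝓝 x] fun z => besselHeatKernelDx μ t z y := by
    filter_upwards [lt_mem_nhds hx] with z hz
    exact (hasDerivAt_besselHeatKernel_space hμ ht hz hy).deriv
  rw [this.deriv_eq]
  exact (hasDerivAt_besselHeatKernelDx hμ ht hx hy).deriv

end Derivatives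

/-! ### Gaussian bound and the invariant power -/

/-- The restrictions on `x`, `y`, `t` keep `z = xy/2t` above `α²/2T`, where `ψ(z) ≤ C e^z`;
completing the square gives the Gaussian. -/
lemma exists_besselHeatKernel_le {μ : ℝ} (hμ : -1 < μ) {α T : ℝ} (hα : 0 < α) (hT : 0 < T) :
    ∃ C, 0 < C ∧ ∀ t, 0 < t → t ≤ T → ∀ x, α ≤ x → ∀ y, α ≤ y →
      besselHeatKernel μ t x y ≤ C * ((Real.sqrt t)⁻¹ * Real.exp (-(x - y) ^ 2 / (4 * t))) := by
  obtain ⟨C, hC, h⟩ := exists_sqrtBessel_le hμ (by positivity : 0 < α * α / (2 * T))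
  refine ⟨C, hC, fun t ht htT x hx y hy => ?_⟩
  have hx0 : 0 < x := hα.trans_le hx
  have hy0 : 0 < y := hα.trans_le hy
  rw [besselHeatKernel_eq μ ht hx0 hy0]
  have hz : α * α / (2 * T) ≤ x * y / (2 * t) := by gcongr
  have h1 := h _ hz
  have h2 : (Real.sqrt (2 * t))⁻¹ ≤ (Real.sqrt t)⁻¹ := by
    have := Real.sqrt_pos.2 ht
    gcongr
    linarith
  have hpos := sqrtBessel_pos hμ (by positivity : 0 < x * y / (2 * t))
  calc (Real.sqrt (2 * t))⁻¹ * sqrtBessel μ (x * y / (2 * t)) *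
        Real.exp (-(x ^ 2 + y ^ 2) / (4 * t))
      ≤ (Real.sqrt t)⁻¹ * (C * Real.exp (x * y / (2 * t))) *
        Real.exp (-(x ^ 2 + y ^ 2) / (4 * t)) := by gcongr
    _ = C * ((Real.sqrt t)⁻¹ * (Real.exp (x * y / (2 * t)) *
        Real.exp (-(x ^ 2 + y ^ 2) / (4 * t)))) := by ring
    _ = _ := by
      rw [← Real.exp_add]
      congr 4
      field_simp
      ring

/-- The power `x^{μ+1/2}` is annihilated by `Δ_μ`, and this identity plays the part of conservation
of mass. It is proved by integrating the Bessel series term by term. -/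
lemma integral_besselHeatKernel_mul_rpow {μ : ℝ} (hμ : -1 < μ) {t x : ℝ} (ht : 0 < t)
    (hx : 0 < x) :
    ∫ y in Ioi (0 : ℝ), besselHeatKernel μ t x y * y ^ (μ + 1 / 2) = x ^ (μ + 1 / 2) := by
  set D : ℝ := (Real.sqrt (2 * t))⁻¹ * 2 ^ (-μ) * (x / (2 * t)) ^ (μ + 1 / 2) *
    Real.exp (-(x ^ 2) / (4 * t)) with hD
  set F : ℕ → ℝ → ℝ := fun k y => D * besselCoeff μ k * (x ^ 2 / (16 * t ^ 2)) ^ k *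
    (y ^ (2 * (k : ℝ) + 2 * μ + 1) * Real.exp (-(1 / (4 * t)) * y ^ (2 : ℝ))) with hF
  have hDpos : 0 < D := by positivity
  have hker : ∀ y ∈ Ioi (0 : ℝ), ∑' k, F k y = besselHeatKernel μ t x y * y ^ (μ + 1 / 2) := by
    intro y hy
    have hy : 0 < y := hy
    have hk : ∀ k, F k y = (D * y ^ (2 * (μ + 1 / 2)) * Real.exp (-(1 / (4 * t)) * y ^ 2)) *
        (((x * y / (2 * t)) ^ 2 / 4) ^ k * besselCoeff μ k) := by
      intro k
      have e1 : (x * y / (2 * t)) ^ 2 / 4 = x ^ 2 / (16 * t ^ 2) * y ^ 2 := by ring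
      have e2 : y ^ (2 * (k : ℝ) + 2 * μ + 1) = y ^ (2 * (μ + 1 / 2)) * (y ^ 2) ^ k := by
        rw [← pow_mul, ← Real.rpow_natCast, ← Real.rpow_add hy]; congr 1; push_cast; ring
      simp only [hF]
      rw [e1, e2, mul_pow, Real.rpow_two]
      ring
    simp_rw [hk]
    rw [tsum_mul_left, besselHeatKernel_eq μ ht hx hy, sqrtBessel, besselEntire, hD]
    have e3 : x * y / (2 * t) = (x / (2 * t)) * y := by ring
    have e4 : (x * y / (2 * t)) ^ (μ + 1 / 2) = (x / (2 * t)) ^ (μ + 1 / 2) * y ^ (μ + 1 / 2) := by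
      rw [e3, Real.mul_rpow (by positivity) hy.le]
    have e5 : Real.exp (-(x ^ 2 + y ^ 2) / (4 * t)) = Real.exp (-(x ^ 2) / (4 * t)) *
        Real.exp (-(1 / (4 * t)) * y ^ 2) := by
      rw [← Real.exp_add]; congr 1; ring
    have e6 : y ^ (2 * (μ + 1 / 2)) = y ^ (μ + 1 / 2) * y ^ (μ + 1 / 2) := by
      rw [← Real.rpow_add hy]; congr 1; ring
    rw [e4, e5, e6]
    ring
  -- The Gaussian moment of order `2k + 2μ + 1` produces `Γ(k+μ+1)`, which cancels the same factor
  -- in the coefficient; the exponential series of `x²/4t` remains.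
  have hval : ∀ k, ∫ y in Ioi (0 : ℝ), F k y =
      D * (4 * t) ^ (μ + 1) / 2 * ((x ^ 2 / (4 * t)) ^ k / (k.factorial : ℝ)) := by
    intro k
    have hk : (0 : ℝ) ≤ k := k.cast_nonneg
    have hg : 0 < Real.Gamma ((k : ℝ) + μ + 1) := Real.Gamma_pos_of_pos (by linarith)
    simp only [hF]
    rw [integral_const_mul, integral_rpow_mul_exp_neg_mul_rpow (by norm_num) (by linarith)
      (by positivity)]
    have e1 : (2 * (k : ℝ) + 2 * μ + 1 + 1) / 2 = k + μ + 1 := by ring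
    have e2 : -(2 * (k : ℝ) + 2 * μ + 1 + 1) / 2 = -(k + μ + 1) := by ring
    have e3 : (1 / (4 * t)) ^ (-((k : ℝ) + μ + 1)) = (4 * t) ^ k * (4 * t) ^ (μ + 1) := by
      rw [one_div, Real.inv_rpow (by positivity), Real.rpow_neg (by positivity), inv_inv,
        add_assoc, Real.rpow_add (by positivity), Real.rpow_natCast]
    have e4 : (x ^ 2 / (4 * t)) ^ k = (x ^ 2 / (16 * t ^ 2)) ^ k * (4 * t) ^ k := by
      rw [← mul_pow]; congr 1; field_simp; norm_num
    rw [e1, e2, e3, e4, besselCoeff]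
    field_simp
  have hint : ∀ k, IntegrableOn (F k) (Ioi 0) := by
    intro k
    -- A Bochner integral with nonzero value certifies integrability, since it is zero by convention
    -- otherwise.
    refine Integrable.of_integral_ne_zero ?_
    rw [hval k]
    positivity
  have hnorm : ∀ k, ∫ y in Ioi (0 : ℝ), ‖F k y‖ = ∫ y in Ioi (0 : ℝ), F k y := by
    intro k
    refine setIntegral_congr_fun measurableSet_Ioi fun y hy => ?_
    have hy : 0 < y := hy
    have := (besselCoeff_pos hμ k).le
    exact Real.norm_of_nonneg (by simp only [hF]; positivity)
  have hexp := (NormedSpace.expSeries_div_hasSum_exp (x ^ 2 / (4 * t))).mul_left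
    (D * (4 * t) ^ (μ + 1) / 2)
  rw [← Real.exp_eq_exp_ℝ] at hexp
  have hsum := hasSum_integral_of_summable_integral_norm hint
    (by simp_rw [hnorm, hval]; exact hexp.summable)
  simp_rw [hval] at hsum
  rw [← setIntegral_congr_fun measurableSet_Ioi hker, hsum.unique hexp, hD]
  have e1 : Real.exp (-(x ^ 2) / (4 * t)) * Real.exp (x ^ 2 / (4 * t)) = 1 := by
    rw [← Real.exp_add, neg_div, neg_add_cancel, Real.exp_zero]
  have e2 : (x / (2 * t)) ^ (μ + 1 / 2) = x ^ (μ + 1 / 2) * ((2 * t) ^ (μ + 1 / 2))⁻¹ := by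
    rw [Real.div_rpow hx.le (by positivity), div_eq_mul_inv]
  have e3 : (4 * t) ^ (μ + 1) = 2 ^ (μ + 1) * (2 * t) ^ (μ + 1) := by
    rw [← Real.mul_rpow (by norm_num) (by positivity)]; ring_nf
  have e4 : (2 * t) ^ (μ + 1) = (2 * t) ^ (μ + 1 / 2) * Real.sqrt (2 * t) := by
    rw [Real.sqrt_eq_rpow, ← Real.rpow_add (by positivity)]; congr 1; ring
  have e5 : (2 : ℝ) ^ (-μ) * 2 ^ (μ + 1) = 2 := by
    rw [← Real.rpow_add (by norm_num)]; simp
  have hs : Real.sqrt (2 * t) ≠ 0 := (Real.sqrt_pos.2 (by positivity)).ne'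
  have hr : (2 * t) ^ (μ + 1 / 2) ≠ 0 := (Real.rpow_pos_of_pos (by positivity) _).ne'
  rw [e2, e3, e4]
  calc _ = x ^ (μ + 1 / 2) * ((2 : ℝ) ^ (-μ) * 2 ^ (μ + 1) / 2) *
        (Real.exp (-(x ^ 2) / (4 * t)) * Real.exp (x ^ 2 / (4 * t))) *
        ((Real.sqrt (2 * t))⁻¹ * Real.sqrt (2 * t)) *
        (((2 * t) ^ (μ + 1 / 2))⁻¹ * (2 * t) ^ (μ + 1 / 2)) := by ring
    _ = _ := by rw [e1, e5, inv_mul_cancel₀ hs, inv_mul_cancel₀ hr]; ring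

lemma integrableOn_besselHeatKernel_mul_rpow {μ : ℝ} (hμ : -1 < μ) {t x : ℝ} (ht : 0 < t)
    (hx : 0 < x) :
    IntegrableOn (fun y => besselHeatKernel μ t x y * y ^ (μ + 1 / 2)) (Ioi 0) := by
  refine Integrable.of_integral_ne_zero ?_
  rw [integral_besselHeatKernel_mul_rpow hμ ht hx]
  positivity

/-- Doubling both `t` and `x` leaves `z = xy/2t` unchanged, so the two kernels differ only in their
elementary factors. For `y > 2x` the Gaussian comparison gains `e^{-x²/4t}`, and invariance
evaluates the integral of the larger kernel. -/
lemma setIntegral_besselHeatKernel_mul_rpow_Ioi_le {μ : ℝ} (hμ : -1 < μ) {t x : ℝ} (ht : 0 < t)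
    (hx : 0 < x) :
    ∫ y in Ioi (2 * x), besselHeatKernel μ t x y * y ^ (μ + 1 / 2) ≤
      Real.sqrt 2 * (2 * x) ^ (μ + 1 / 2) * Real.exp (-(x ^ 2 / (4 * t))) := by
  have hsub : Ioi (2 * x) ⊆ Ioi (0 : ℝ) := Ioi_subset_Ioi (by positivity)
  have hK := integrableOn_besselHeatKernel_mul_rpow hμ (by positivity : 0 < 2 * t)
    (by positivity : 0 < 2 * x)
  have hpt : ∀ y ∈ Ioi (2 * x), besselHeatKernel μ t x y * y ^ (μ + 1 / 2) ≤
      Real.sqrt 2 * Real.exp (-(x ^ 2 / (4 * t))) *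
        (besselHeatKernel μ (2 * t) (2 * x) y * y ^ (μ + 1 / 2)) := by
    intro y hy
    have hy2 : 2 * x < y := hy
    have hy0 : 0 < y := hsub hy
    rw [besselHeatKernel_eq μ ht hx hy0, besselHeatKernel_eq μ (by positivity) (by positivity) hy0]
    have e1 : 2 * x * y / (2 * (2 * t)) = x * y / (2 * t) := by field_simp
    have e2 : Real.sqrt (2 * (2 * t)) = Real.sqrt 2 * Real.sqrt (2 * t) :=
      Real.sqrt_mul (by norm_num) _
    have hs : Real.sqrt 2 ≠ 0 := (Real.sqrt_pos.2 (by norm_num)).ne'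
    rw [e1, e2, mul_inv]
    have hψ := sqrtBessel_pos hμ (by positivity : 0 < x * y / (2 * t))
    have hexp : Real.exp (-(x ^ 2 + y ^ 2) / (4 * t)) ≤ Real.exp (-(x ^ 2 / (4 * t))) *
        Real.exp (-((2 * x) ^ 2 + y ^ 2) / (4 * (2 * t))) := by
      rw [← Real.exp_add, Real.exp_le_exp]
      have : -(x ^ 2 / (4 * t)) + -((2 * x) ^ 2 + y ^ 2) / (4 * (2 * t)) -
          -(x ^ 2 + y ^ 2) / (4 * t) = (y ^ 2 - (2 * x) ^ 2) / (8 * t) := by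
        field_simp; ring
      have h2 : 0 ≤ (y ^ 2 - (2 * x) ^ 2) / (8 * t) := by
        have : (2 * x) ^ 2 ≤ y ^ 2 := by gcongr
        have := sub_nonneg.2 this
        positivity
      linarith
    calc (Real.sqrt (2 * t))⁻¹ * sqrtBessel μ (x * y / (2 * t)) *
          Real.exp (-(x ^ 2 + y ^ 2) / (4 * t)) * y ^ (μ + 1 / 2)
        ≤ (Real.sqrt (2 * t))⁻¹ * sqrtBessel μ (x * y / (2 * t)) *
          (Real.exp (-(x ^ 2 / (4 * t))) * Real.exp (-((2 * x) ^ 2 + y ^ 2) / (4 * (2 * t)))) *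
          y ^ (μ + 1 / 2) := by gcongr
      _ = _ := by field_simp
  calc ∫ y in Ioi (2 * x), besselHeatKernel μ t x y * y ^ (μ + 1 / 2)
      ≤ ∫ y in Ioi (2 * x), Real.sqrt 2 * Real.exp (-(x ^ 2 / (4 * t))) *
        (besselHeatKernel μ (2 * t) (2 * x) y * y ^ (μ + 1 / 2)) :=
        setIntegral_mono_on ((integrableOn_besselHeatKernel_mul_rpow hμ ht hx).mono_set hsub)
          ((hK.mono_set hsub).const_mul _) measurableSet_Ioi hpt
    _ ≤ ∫ y in Ioi 0, Real.sqrt 2 * Real.exp (-(x ^ 2 / (4 * t))) *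
        (besselHeatKernel μ (2 * t) (2 * x) y * y ^ (μ + 1 / 2)) := by
        refine setIntegral_mono_set (hK.const_mul _) ?_ hsub.eventuallyLE
        filter_upwards [ae_restrict_mem measurableSet_Ioi] with y hy
        have := besselHeatKernel_pos hμ (by positivity : 0 < 2 * t) (by positivity : 0 < 2 * x) hy
        have hy : 0 < y := hy
        simp only [Pi.zero_apply]
        positivity
    _ = _ := by
        rw [integral_const_mul, integral_besselHeatKernel_mul_rpow hμ (by positivity)
          (by positivity)]
        ring

/-- The same device with both `t` and `x` halved, which favours `y < x/2`. -/
lemma setIntegral_besselHeatKernel_mul_rpow_Ioo_le {μ : ℝ} (hμ : -1 < μ) {t x : ℝ} (ht : 0 < t)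
    (hx : 0 < x) :
    ∫ y in Ioo 0 (x / 2), besselHeatKernel μ t x y * y ^ (μ + 1 / 2) ≤
      (x / 2) ^ (μ + 1 / 2) * Real.exp (-(x ^ 2 / (16 * t))) := by
  have hsub : Ioo 0 (x / 2) ⊆ Ioi (0 : ℝ) := Ioo_subset_Ioi_self
  have hK := integrableOn_besselHeatKernel_mul_rpow hμ (by positivity : 0 < t / 2)
    (by positivity : 0 < x / 2)
  have hpt : ∀ y ∈ Ioo 0 (x / 2), besselHeatKernel μ t x y * y ^ (μ + 1 / 2) ≤
      Real.exp (-(x ^ 2 / (16 * t))) *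
        (besselHeatKernel μ (t / 2) (x / 2) y * y ^ (μ + 1 / 2)) := by
    intro y hy
    have hy0 : 0 < y := hy.1
    have hy2 : y < x / 2 := hy.2
    rw [besselHeatKernel_eq μ ht hx hy0, besselHeatKernel_eq μ (by positivity) (by positivity) hy0]
    have e1 : x / 2 * y / (2 * (t / 2)) = x * y / (2 * t) := by field_simp
    have e2 : (Real.sqrt (2 * t))⁻¹ ≤ (Real.sqrt (2 * (t / 2)))⁻¹ := by
      have : 0 < Real.sqrt (2 * (t / 2)) := Real.sqrt_pos.2 (by positivity)
      gcongr
      linarith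
    rw [e1]
    have hψ := sqrtBessel_pos hμ (by positivity : 0 < x * y / (2 * t))
    have hexp : Real.exp (-(x ^ 2 + y ^ 2) / (4 * t)) ≤ Real.exp (-(x ^ 2 / (16 * t))) *
        Real.exp (-((x / 2) ^ 2 + y ^ 2) / (4 * (t / 2))) := by
      rw [← Real.exp_add, Real.exp_le_exp]
      have : -(x ^ 2 / (16 * t)) + -((x / 2) ^ 2 + y ^ 2) / (4 * (t / 2)) -
          -(x ^ 2 + y ^ 2) / (4 * t) = ((x / 2) ^ 2 - y ^ 2) / (4 * t) := by
        field_simp; ring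
      have h2 : 0 ≤ ((x / 2) ^ 2 - y ^ 2) / (4 * t) := by
        have : y ^ 2 ≤ (x / 2) ^ 2 := by gcongr
        have := sub_nonneg.2 this
        positivity
      linarith
    calc (Real.sqrt (2 * t))⁻¹ * sqrtBessel μ (x * y / (2 * t)) *
          Real.exp (-(x ^ 2 + y ^ 2) / (4 * t)) * y ^ (μ + 1 / 2)
        ≤ (Real.sqrt (2 * (t / 2)))⁻¹ * sqrtBessel μ (x * y / (2 * t)) *
          (Real.exp (-(x ^ 2 / (16 * t))) * Real.exp (-((x / 2) ^ 2 + y ^ 2) / (4 * (t / 2)))) *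
          y ^ (μ + 1 / 2) := by gcongr
      _ = _ := by ring
  calc ∫ y in Ioo 0 (x / 2), besselHeatKernel μ t x y * y ^ (μ + 1 / 2)
      ≤ ∫ y in Ioo 0 (x / 2), Real.exp (-(x ^ 2 / (16 * t))) *
        (besselHeatKernel μ (t / 2) (x / 2) y * y ^ (μ + 1 / 2)) :=
        setIntegral_mono_on ((integrableOn_besselHeatKernel_mul_rpow hμ ht hx).mono_set hsub)
          ((hK.mono_set hsub).const_mul _) measurableSet_Ioo hpt
    _ ≤ ∫ y in Ioi 0, Real.exp (-(x ^ 2 / (16 * t))) *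
        (besselHeatKernel μ (t / 2) (x / 2) y * y ^ (μ + 1 / 2)) := by
        refine setIntegral_mono_set (hK.const_mul _) ?_ hsub.eventuallyLE
        filter_upwards [ae_restrict_mem measurableSet_Ioi] with y hy
        have := besselHeatKernel_pos hμ (by positivity : 0 < t / 2) (by positivity : 0 < x / 2) hy
        have hy : 0 < y := hy
        simp only [Pi.zero_apply]
        positivity
    _ = _ := by
        rw [integral_const_mul, integral_besselHeatKernel_mul_rpow hμ (by positivity)
          (by positivity)]
        ring

/-! ### Gaussian averages at Lebesgue points -/

lemma integral_gaussian_translate {t : ℝ} (ht : 0 < t) (x : ℝ) :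
    ∫ y, Real.exp (-(x - y) ^ 2 / (8 * t)) = Real.sqrt (8 * Real.pi) * Real.sqrt t := by
  have h := integral_sub_left_eq_self (fun s : ℝ => Real.exp (-(1 / (8 * t)) * s ^ 2)) volume x
  rw [integral_gaussian] at h
  rw [← Real.sqrt_mul (by positivity)]
  convert h using 2
  · ext y; congr 1; ring
  · field_simp

lemma integrable_gaussian_translate {t : ℝ} (ht : 0 < t) (x : ℝ) :
    Integrable fun y => Real.exp (-(x - y) ^ 2 / (8 * t)) := by
  refine Integrable.of_integral_ne_zero ?_
  rw [integral_gaussian_translate ht]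
  positivity

/-- The line is cut at distance `R√t` from `x`. Inside, the integral is at most `R` times an average
tending to zero; outside, half of the Gaussian exponent supplies `e^{-R²/8}` and the other half
keeps the integral bounded uniformly in `t`. -/
lemma tendsto_integral_gaussian_mul {q : ℝ → ℝ} {M x : ℝ} (hq : Integrable q)
    (hq0 : ∀ᵐ y, 0 ≤ q y) (hqM : ∀ᵐ y, q y ≤ M)
    (hL : Tendsto (fun r => r⁻¹ * ∫ y in Metric.closedBall x r, q y) (𝓝[>] 0) (𝓝 0)) :
    Tendsto (fun t => ∫ y, (Real.sqrt t)⁻¹ * Real.exp (-(x - y) ^ 2 / (4 * t)) * q y)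
      (𝓝[>] 0) (𝓝 0) := by
  have hM : 0 ≤ M := by
    obtain ⟨y, h1, h2⟩ := (hq0.and hqM).exists
    exact h1.trans h2
  have hbound : ∀ R : ℝ, 0 < R → ∀ t : ℝ, 0 < t →
      ∫ y, (Real.sqrt t)⁻¹ * Real.exp (-(x - y) ^ 2 / (4 * t)) * q y ≤
        R * ((R * Real.sqrt t)⁻¹ * ∫ y in Metric.closedBall x (R * Real.sqrt t), q y) +
          M * Real.sqrt (8 * Real.pi) * Real.exp (-R ^ 2 / 8) := by
    intro R hR t ht
    have hst := Real.sqrt_pos.2 ht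
    have hsq : Real.sqrt t ^ 2 = t := Real.sq_sqrt ht.le
    have hI1 : Integrable fun y =>
        (Real.sqrt t)⁻¹ * (Metric.closedBall x (R * Real.sqrt t)).indicator q y :=
      (hq.indicator Metric.isClosed_closedBall.measurableSet).const_mul _
    have hI2 : Integrable fun y => M * (Real.sqrt t)⁻¹ * Real.exp (-R ^ 2 / 8) *
        Real.exp (-(x - y) ^ 2 / (8 * t)) := (integrable_gaussian_translate ht x).const_mul _
    calc ∫ y, (Real.sqrt t)⁻¹ * Real.exp (-(x - y) ^ 2 / (4 * t)) * q y
        ≤ ∫ y, ((Real.sqrt t)⁻¹ * (Metric.closedBall x (R * Real.sqrt t)).indicator q y +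
          M * (Real.sqrt t)⁻¹ * Real.exp (-R ^ 2 / 8) * Real.exp (-(x - y) ^ 2 / (8 * t))) := by
          refine integral_mono_of_nonneg ?_ (hI1.add hI2) ?_
          · filter_upwards [hq0] with y hy
            simp only [Pi.zero_apply]
            positivity
          · filter_upwards [hq0, hqM] with y h0 h1
            by_cases hy : y ∈ Metric.closedBall x (R * Real.sqrt t)
            · rw [indicator_of_mem hy]
              have he : Real.exp (-(x - y) ^ 2 / (4 * t)) ≤ 1 := by
                rw [Real.exp_le_one_iff, neg_div]
                have : 0 ≤ (x - y) ^ 2 / (4 * t) := by positivity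
                linarith
              have h2 : 0 ≤ M * (Real.sqrt t)⁻¹ * Real.exp (-R ^ 2 / 8) *
                Real.exp (-(x - y) ^ 2 / (8 * t)) := by positivity
              have h3 : (Real.sqrt t)⁻¹ * Real.exp (-(x - y) ^ 2 / (4 * t)) * q y ≤
                (Real.sqrt t)⁻¹ * 1 * q y := by gcongr
              linarith
            · rw [indicator_of_notMem hy, mul_zero, zero_add]
              rw [Metric.mem_closedBall, not_le, dist_comm, Real.dist_eq] at hy
              have hd : R ^ 2 * t ≤ (x - y) ^ 2 := by
                rw [← sq_abs (x - y), ← hsq, ← mul_pow]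
                gcongr
              have he : Real.exp (-(x - y) ^ 2 / (4 * t)) ≤
                  Real.exp (-R ^ 2 / 8) * Real.exp (-(x - y) ^ 2 / (8 * t)) := by
                rw [← Real.exp_add, Real.exp_le_exp]
                have e : -R ^ 2 / 8 + -(x - y) ^ 2 / (8 * t) - -(x - y) ^ 2 / (4 * t) =
                    ((x - y) ^ 2 - R ^ 2 * t) / (8 * t) := by field_simp; ring
                have : 0 ≤ ((x - y) ^ 2 - R ^ 2 * t) / (8 * t) := by
                  have := sub_nonneg.2 hd
                  positivity
                linarith
              calc (Real.sqrt t)⁻¹ * Real.exp (-(x - y) ^ 2 / (4 * t)) * q y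
                  ≤ (Real.sqrt t)⁻¹ *
                    (Real.exp (-R ^ 2 / 8) * Real.exp (-(x - y) ^ 2 / (8 * t))) * M := by gcongr
                _ = _ := by ring
      _ = _ := by
          rw [integral_add hI1 hI2, integral_const_mul, integral_const_mul,
            integral_indicator Metric.isClosed_closedBall.measurableSet,
            integral_gaussian_translate ht]
          field_simp
  have hnn : ∀ t : ℝ, 0 ≤ ∫ y, (Real.sqrt t)⁻¹ * Real.exp (-(x - y) ^ 2 / (4 * t)) * q y := by
    intro t
    refine integral_nonneg_of_ae ?_
    filter_upwards [hq0] with y hy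
    simp only [Pi.zero_apply]
    positivity
  have hR : Tendsto (fun R : ℝ => M * Real.sqrt (8 * Real.pi) * Real.exp (-R ^ 2 / 8))
      atTop (𝓝 0) := by
    have h1 : Tendsto (fun R : ℝ => -R ^ 2 / 8) atTop atBot := by
      have := (tendsto_pow_atTop (α := ℝ) (n := 2) two_ne_zero).atTop_div_const
        (by norm_num : (0 : ℝ) < 8)
      refine (tendsto_neg_atTop_atBot.comp this).congr fun R => ?_
      simp [neg_div]
    simpa using (Real.tendsto_exp_atBot.comp h1).const_mul (M * Real.sqrt (8 * Real.pi))
  rw [Metric.tendsto_nhds]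
  intro ε hε
  -- The radius `R` is fixed first, from the tail alone; only then does `t` tend to zero.
  obtain ⟨R, hRε, hR0⟩ := ((hR.eventually_lt_const (half_pos hε)).and (eventually_gt_atTop 0)).exists
  have hscale : Tendsto (fun t : ℝ => R * Real.sqrt t) (𝓝[>] 0) (𝓝[>] 0) := by
    refine tendsto_nhdsWithin_iff.2 ⟨?_, ?_⟩
    · have : Tendsto (fun t : ℝ => R * Real.sqrt t) (𝓝 0) (𝓝 (R * Real.sqrt 0)) :=
        (Real.continuous_sqrt.const_mul R).tendsto 0
      rw [Real.sqrt_zero, mul_zero] at this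
      exact this.mono_left nhdsWithin_le_nhds
    · filter_upwards [self_mem_nhdsWithin] with t ht
      have := Real.sqrt_pos.2 ht
      exact mul_pos hR0 this
  have hlim := (hL.comp hscale).const_mul R
  rw [mul_zero] at hlim
  filter_upwards [hlim.eventually_lt_const (half_pos hε), self_mem_nhdsWithin] with t h1 ht
  rw [Real.dist_eq, sub_zero, abs_of_nonneg (hnn t)]
  have := hbound R hR0 t ht
  simp only [Function.comp_apply] at h1
  linarith

lemma tendsto_average_norm_sub_of_continuousAt {E : Type*} [NormedAddCommGroup E] {h : ℝ → E}
    {x : ℝ} (hc : ContinuousAt h x) :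
    Tendsto (fun r => r⁻¹ * ∫ y in Metric.closedBall x r, ‖h y - h x‖) (𝓝[>] 0) (𝓝 0) := by
  rw [Metric.tendsto_nhds]
  intro ε hε
  obtain ⟨δ, hδ, h1⟩ := Metric.continuousAt_iff.1 hc (ε / 3) (by positivity)
  filter_upwards [Ioo_mem_nhdsGT hδ] with r hr
  have hr0 : 0 < r := hr.1
  have hb : ‖∫ y in Metric.closedBall x r, ‖h y - h x‖‖ ≤
      (ε / 3) * volume.real (Metric.closedBall x r) := by
    refine norm_setIntegral_le_of_norm_le_const measure_closedBall_lt_top fun y hy => ?_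
    rw [norm_norm, ← dist_eq_norm]
    exact (h1 ((Metric.mem_closedBall.1 hy).trans_lt hr.2)).le
  rw [Real.volume_real_closedBall hr0.le] at hb
  rw [dist_zero_right, norm_mul, norm_inv, Real.norm_of_nonneg hr0.le, inv_mul_lt_iff₀ hr0]
  nlinarith

/-- Lebesgue differentiation is applied to the extension of `g` by zero; balls of radius less than
`x` do not see the extension. The factor two accounts for the length `2r` of a ball. -/
lemma ae_tendsto_average_norm_sub_Ioi {g : ℝ → ℂ} (hg : MemLp g ⊤ (volume.restrict (Ioi 0))) :
    ∀ᵐ x ∂(volume.restrict (Ioi (0 : ℝ))),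
      Tendsto (fun r => r⁻¹ * ∫ y in Metric.closedBall x r, ‖g y - g x‖) (𝓝[>] 0) (𝓝 0) := by
  have hG : MemLp ((Ioi 0).indicator g) ⊤ volume := (memLp_indicator_iff_restrict measurableSet_Ioi).2 hg
  have hloc : LocallyIntegrable ((Ioi 0).indicator g) volume := hG.locallyIntegrable le_top
  have hae := IsUnifLocDoublingMeasure.ae_tendsto_average_norm_sub volume hloc 1
  rw [ae_restrict_iff' measurableSet_Ioi]
  filter_upwards [hae] with x hx hx0
  have hx0 : 0 < x := hx0
  have h1 := hx (fun _ : ℝ => x) (fun r => r) (l := 𝓝[>] 0) tendsto_id (by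
    filter_upwards [self_mem_nhdsWithin] with r hr
    have : (0 : ℝ) < r := hr
    simpa using this.le)
  have h2 := h1.const_mul 2
  rw [mul_zero] at h2
  refine h2.congr' ?_
  filter_upwards [Ioo_mem_nhdsGT hx0] with r hr
  have hr0 : 0 < r := hr.1
  rw [setAverage_eq, Real.volume_real_closedBall hr0.le, smul_eq_mul, mul_inv, ← mul_assoc,
    ← mul_assoc, mul_inv_cancel₀ two_ne_zero, one_mul]
  congr 1
  refine setIntegral_congr_fun Metric.isClosed_closedBall.measurableSet fun y hy => ?_
  have hy0 : y ∈ Ioi (0 : ℝ) := by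
    rw [Real.closedBall_eq_Icc] at hy
    have := hy.1
    have := hr.2
    simp only [mem_Ioi]; linarith
  rw [indicator_of_mem hy0, indicator_of_mem (show x ∈ Ioi (0 : ℝ) from hx0)]

/-! ### The heat kernel is an approximate identity -/

/-- Subtract from `g` the multiple of `y^{μ+1/2}` that agrees with it at `x`: the kernel reproduces
that multiple exactly. The remainder `q` vanishes at `x` in the Lebesgue sense. On `[x/2, 2x]` the
Gaussian bound applies to it, and off this interval the two tail estimates do, through `|q| ≤ M'
y^{μ+1/2}`. -/
lemma tendsto_integral_besselHeatKernel_smul {μ : ℝ} (hμ : -1 < μ) {g : ℝ → ℂ} {M x : ℝ}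
    (hg : AEStronglyMeasurable g (volume.restrict (Ioi 0)))
    (hgM : ∀ᵐ y ∂(volume.restrict (Ioi (0 : ℝ))), ‖g y‖ ≤ M * y ^ (μ + 1 / 2)) (hx : 0 < x)
    (hL : Tendsto (fun r => r⁻¹ * ∫ y in Metric.closedBall x r, ‖g y - g x‖) (𝓝[>] 0) (𝓝 0)) :
    Tendsto (fun t => ∫ y in Ioi (0 : ℝ), besselHeatKernel μ t x y • g y) (𝓝[>] 0)
      (𝓝 (g x)) := by
  set a := μ + 1 / 2 with ha
  set w : ℝ → ℝ := fun y => y ^ a / x ^ a with hw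
  set q : ℝ → ℂ := fun y => g y - w y • g x with hq
  set M' : ℝ := M + ‖g x‖ / x ^ a with hM'
  have hxa : 0 < x ^ a := by positivity
  have hwm : Measurable w := by fun_prop
  have hqm : AEStronglyMeasurable q (volume.restrict (Ioi 0)) :=
    hg.sub (hwm.aestronglyMeasurable.smul_const _)
  have hqM : ∀ᵐ y ∂(volume.restrict (Ioi (0 : ℝ))), ‖q y‖ ≤ M' * y ^ a := by
    filter_upwards [hgM, ae_restrict_mem measurableSet_Ioi] with y h1 hy
    have hy : 0 < y := hy
    have hya : 0 < y ^ a := by positivity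
    calc ‖q y‖ ≤ ‖g y‖ + ‖w y • g x‖ := norm_sub_le _ _
      _ ≤ M * y ^ a + y ^ a / x ^ a * ‖g x‖ := by
        rw [norm_smul, Real.norm_of_nonneg (by positivity : 0 ≤ w y)]
        gcongr
      _ = _ := by rw [hM']; ring
  have hKm : ∀ t, 0 < t → AEStronglyMeasurable (fun y => besselHeatKernel μ t x y)
      (volume.restrict (Ioi 0)) := fun t ht =>
    ContinuousOn.aestronglyMeasurable (fun y hy =>
      (continuousAt_const.besselHeatKernel_comp hμ continuousAt_const continuousAt_id ht hx
        hy).continuousWithinAt) measurableSet_Ioi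
  have hint : ∀ t, 0 < t → ∀ (h : ℝ → ℂ) (B : ℝ),
      AEStronglyMeasurable h (volume.restrict (Ioi 0)) →
      (∀ᵐ y ∂(volume.restrict (Ioi (0 : ℝ))), ‖h y‖ ≤ B * y ^ a) →
      IntegrableOn (fun y => besselHeatKernel μ t x y • h y) (Ioi 0) := by
    intro t ht h B hm hB
    refine Integrable.mono' ((integrableOn_besselHeatKernel_mul_rpow hμ ht hx).const_mul B)
      ((hKm t ht).smul hm) ?_
    filter_upwards [hB, ae_restrict_mem measurableSet_Ioi] with y h1 hy
    have hK := besselHeatKernel_pos hμ ht hx hy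
    rw [norm_smul, Real.norm_of_nonneg hK.le]
    calc besselHeatKernel μ t x y * ‖h y‖ ≤ besselHeatKernel μ t x y * (B * y ^ a) := by gcongr
      _ = _ := by ring
  have hsplit : ∀ t, 0 < t → ∫ y in Ioi (0 : ℝ), besselHeatKernel μ t x y • g y =
      (∫ y in Ioi (0 : ℝ), besselHeatKernel μ t x y • q y) + g x := by
    intro t ht
    have hw1 : ∫ y in Ioi (0 : ℝ), besselHeatKernel μ t x y • (w y • g x) = g x := by
      have : ∀ y, besselHeatKernel μ t x y • (w y • g x) =
          ((besselHeatKernel μ t x y * y ^ a) * (x ^ a)⁻¹) • g x := by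
        intro y; rw [smul_smul]; congr 1; simp only [hw]; ring
      simp_rw [this]
      rw [integral_smul_const, integral_mul_const, integral_besselHeatKernel_mul_rpow hμ ht hx,
        mul_inv_cancel₀ hxa.ne', one_smul]
    have hqi := hint t ht q M' hqm hqM
    have hwi : IntegrableOn (fun y => besselHeatKernel μ t x y • (w y • g x)) (Ioi 0) := by
      refine hint t ht _ (‖g x‖ / x ^ a) (hwm.aestronglyMeasurable.smul_const _) ?_
      filter_upwards [ae_restrict_mem measurableSet_Ioi] with y hy
      have hy : 0 < y := hy
      rw [norm_smul, Real.norm_of_nonneg (by positivity : 0 ≤ w y)]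
      apply le_of_eq; simp only [hw]; ring
    refine Eq.trans ?_ (congrArg (_ + ·) hw1)
    rw [← integral_add hqi hwi]
    refine integral_congr_ae (Eventually.of_forall fun y => ?_)
    simp only [hq, smul_sub, sub_add_cancel]
  suffices h0 : Tendsto (fun t => ∫ y in Ioi (0 : ℝ), besselHeatKernel μ t x y • q y) (𝓝[>] 0)
      (𝓝 0) by
    have h1 := h0.add_const (g x)
    rw [zero_add] at h1
    refine h1.congr' ?_
    filter_upwards [self_mem_nhdsWithin] with t ht using (hsplit t ht).symm
  obtain ⟨C, hC, hKC⟩ := exists_besselHeatKernel_le hμ (by positivity : 0 < x / 2) one_pos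
  set J := Icc (x / 2) (2 * x) with hJ
  have hJpos : J ⊆ Ioi (0 : ℝ) := fun y hy => lt_of_lt_of_le (by positivity) hy.1
  set Q : ℝ → ℝ := J.indicator fun y => ‖q y‖ with hQ
  obtain ⟨B, hB⟩ := (isCompact_Icc : IsCompact J).exists_bound_of_continuousOn
    (f := fun y : ℝ => M' * y ^ a) (by
      refine ContinuousOn.mul continuousOn_const (continuousOn_id.rpow_const fun y hy => ?_)
      exact Or.inl (ne_of_gt (hJpos hy)))
  have hB0 : 0 ≤ B := (norm_nonneg _).trans (hB x ⟨by linarith, by linarith⟩)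
  have hqJ : ∀ᵐ y ∂(volume.restrict J), ‖q y‖ ≤ B := by
    filter_upwards [ae_restrict_of_ae_restrict_of_subset hJpos hqM,
      ae_restrict_mem measurableSet_Icc] with y h1 h2
    exact h1.trans ((le_abs_self _).trans (hB y h2))
  have hqint : IntegrableOn (fun y => ‖q y‖) J := by
    refine Integrable.mono' (integrable_const B) (hqm.mono_set hJpos).norm ?_
    simpa using hqJ
  have hQint : Integrable Q := hqint.integrable_indicator measurableSet_Icc
  have hQL : Tendsto (fun r => r⁻¹ * ∫ y in Metric.closedBall x r, Q y) (𝓝[>] 0) (𝓝 0) := by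
    have hwc : ContinuousAt (fun y => w y • g x) x := by
      have : ContinuousAt w x := (Real.continuousAt_rpow_const x a (Or.inl hx.ne')).div_const _
      fun_prop
    have h2 := tendsto_average_norm_sub_of_continuousAt hwc
    have hwx : w x • g x = g x := by simp only [hw]; rw [div_self hxa.ne', one_smul]
    have h3 := hL.add h2
    rw [add_zero] at h3
    refine squeeze_zero' ?_ ?_ h3
    · filter_upwards [self_mem_nhdsWithin] with r hr
      have hr : (0 : ℝ) < r := hr
      refine mul_nonneg (by positivity) (integral_nonneg fun y => ?_)
      exact indicator_nonneg (fun y _ => norm_nonneg _) y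
    · filter_upwards [Ioo_mem_nhdsGT (half_pos hx)] with r hr
      have hr0 : 0 < r := hr.1
      have hsub : Metric.closedBall x r ⊆ J := by
        rw [Real.closedBall_eq_Icc]
        exact Icc_subset_Icc (by linarith [hr.2]) (by linarith [hr.2])
      have hmeas : MeasurableSet (Metric.closedBall x r) := Metric.isClosed_closedBall.measurableSet
      rw [← mul_add]
      refine mul_le_mul_of_nonneg_left ?_ (by positivity)
      have hg1 : IntegrableOn (fun y => w y • g x - w x • g x) J := by
        refine ContinuousOn.integrableOn_compact isCompact_Icc ?_
        have : ContinuousOn w J := (continuousOn_id.rpow_const fun y hy =>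
          Or.inl (ne_of_gt (hJpos hy))).div_const _
        fun_prop
      have hg2 : IntegrableOn (fun y => g y - g x) J := by
        have hqi : IntegrableOn q J :=
          (integrable_norm_iff (hqm.mono_set hJpos)).1 hqint
        refine (hqi.add hg1).congr (Eventually.of_forall fun y => ?_)
        simp only [hq, Pi.add_apply, hwx]
        ring
      rw [← integral_add (hg2.mono_set hsub).norm (hg1.mono_set hsub).norm]
      refine setIntegral_mono_on (hQint.integrableOn)
        ((hg2.mono_set hsub).norm.add (hg1.mono_set hsub).norm) hmeas fun y hy => ?_
      simp only [hQ]
      rw [indicator_of_mem (hsub hy)]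
      have : q y = (g y - g x) - (w y • g x - w x • g x) := by
        simp only [hq, hwx]; ring
      rw [this]
      exact norm_sub_le _ _
  have hnear := (tendsto_integral_gaussian_mul hQint
    (Eventually.of_forall fun y => indicator_nonneg (fun y _ => norm_nonneg _) y)
    (by
      have := (ae_restrict_iff' (measurableSet_Icc : MeasurableSet J)).1 hqJ
      filter_upwards [this] with y hy
      by_cases h : y ∈ J
      · simp only [hQ]; rw [indicator_of_mem h]; exact hy h
      · simp only [hQ]; rw [indicator_of_notMem h]; exact hB0) hQL).const_mul C
  rw [mul_zero] at hnear
  have hexp0 : ∀ κ : ℝ, 0 < κ → Tendsto (fun t : ℝ => Real.exp (-(x ^ 2 / (κ * t)))) (𝓝[>] 0)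
      (𝓝 0) := by
    intro κ hκ
    refine Real.tendsto_exp_atBot.comp (tendsto_neg_atTop_atBot.comp ?_)
    have := tendsto_inv_nhdsGT_zero.const_mul_atTop (by positivity : 0 < x ^ 2 / κ)
    refine this.congr fun t => ?_
    rw [← div_eq_mul_inv, div_div]
  have hfar1 := ((hexp0 16 (by norm_num)).const_mul ((x / 2) ^ a)).const_mul M'
  have hfar2 := ((hexp0 4 (by norm_num)).const_mul (Real.sqrt 2 * (2 * x) ^ a)).const_mul M'
  have hsum := (hfar1.add hnear).add hfar2
  simp only [mul_zero, add_zero] at hsum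
  refine squeeze_zero_norm' ?_ hsum
  filter_upwards [Ioo_mem_nhdsGT one_pos] with t ht
  have ht0 : 0 < t := ht.1
  set h : ℝ → ℝ := fun y => ‖besselHeatKernel μ t x y • q y‖ with hh
  have hi : IntegrableOn h (Ioi 0) := (hint t ht0 q M' hqm hqM).norm
  have hJsub : Ioi (0 : ℝ) = Ioo 0 (x / 2) ∪ J ∪ Ioi (2 * x) := by
    ext y
    simp only [mem_Ioi, mem_union, mem_Ioo, hJ, mem_Icc]
    constructor
    · intro hy
      rcases lt_or_ge y (x / 2) with h1 | h1
      · exact Or.inl (Or.inl ⟨hy, h1⟩)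
      · rcases le_or_gt y (2 * x) with h2 | h2
        · exact Or.inl (Or.inr ⟨h1, h2⟩)
        · exact Or.inr h2
    · rintro ((h1 | h1) | h1)
      · exact h1.1
      · linarith [h1.1]
      · linarith
  have hs1 : Ioo 0 (x / 2) ⊆ Ioi (0 : ℝ) := Ioo_subset_Ioi_self
  have hs3 : Ioi (2 * x) ⊆ Ioi (0 : ℝ) := Ioi_subset_Ioi (by positivity)
  have hd1 : Disjoint (Ioo 0 (x / 2)) J :=
    Set.disjoint_left.2 fun y h1 h2 => absurd h1.2 (not_lt.2 h2.1)
  have hd2 : Disjoint (Ioo 0 (x / 2) ∪ J) (Ioi (2 * x)) := by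
    refine Set.disjoint_left.2 fun y h1 h2 => ?_
    have h2 : 2 * x < y := h2
    rcases h1 with h1 | h1
    · linarith [h1.2]
    · linarith [h1.2]
  have hfar : ∀ S : Set ℝ, MeasurableSet S → S ⊆ Ioi 0 →
      ∫ y in S, h y ≤ M' * ∫ y in S, besselHeatKernel μ t x y * y ^ a := by
    intro S hS hSs
    rw [← integral_const_mul]
    refine setIntegral_mono_ae_restrict (hi.mono_set hSs)
      (((integrableOn_besselHeatKernel_mul_rpow hμ ht0 hx).mono_set hSs).const_mul M') ?_
    filter_upwards [ae_restrict_of_ae_restrict_of_subset hSs hqM, ae_restrict_mem hS] with y h1 h2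
    have hK := besselHeatKernel_pos hμ ht0 hx (hSs h2)
    simp only [hh]
    rw [norm_smul, Real.norm_of_nonneg hK.le]
    calc besselHeatKernel μ t x y * ‖q y‖ ≤ besselHeatKernel μ t x y * (M' * y ^ a) := by gcongr
      _ = _ := by ring
  -- No sign is assumed for `M`; nonnegativity of `M'` follows from the bound on `q` at one point of
  -- `J`, which has positive measure.
  have hM'0 : 0 ≤ M' := by
    have hne : ∃ y, ‖q y‖ ≤ M' * y ^ a ∧ y ∈ J := by
      have hJne : (ae (volume.restrict J)).NeBot := by
        rw [ae_neBot, Ne, Measure.restrict_eq_zero, hJ, Real.volume_Icc]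
        simp only [ENNReal.ofReal_eq_zero, not_le]; linarith
      exact ((ae_restrict_of_ae_restrict_of_subset hJpos hqM).and
        (ae_restrict_mem measurableSet_Icc)).exists
    obtain ⟨y, h1, h2⟩ := hne
    have hy : 0 < y := hJpos h2
    by_contra hneg
    have := mul_neg_of_neg_of_pos (not_le.1 hneg) (by positivity : 0 < y ^ a)
    linarith [norm_nonneg (q y)]
  calc ‖∫ y in Ioi (0 : ℝ), besselHeatKernel μ t x y • q y‖
      ≤ ∫ y in Ioi (0 : ℝ), h y := norm_integral_le_integral_norm _
    _ = (∫ y in Ioo 0 (x / 2), h y) + (∫ y in J, h y) + ∫ y in Ioi (2 * x), h y := by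
      rw [hJsub, setIntegral_union hd2 measurableSet_Ioi
        ((hi.mono_set hs1).union (hi.mono_set hJpos)) (hi.mono_set hs3),
        setIntegral_union hd1 measurableSet_Icc (hi.mono_set hs1) (hi.mono_set hJpos)]
    _ ≤ _ := by
      refine add_le_add (add_le_add ?_ ?_) ?_
      · refine (hfar _ measurableSet_Ioo hs1).trans ?_
        exact mul_le_mul_of_nonneg_left (setIntegral_besselHeatKernel_mul_rpow_Ioo_le hμ ht0 hx)
          hM'0
      · rw [← integral_const_mul, ← integral_indicator measurableSet_Icc]
        refine integral_mono_of_nonneg (Eventually.of_forall fun y =>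
          indicator_nonneg (fun y _ => norm_nonneg _) y) ?_ (Eventually.of_forall fun y => ?_)
        · refine Integrable.const_mul ?_ C
          refine Integrable.bdd_mul (c := (Real.sqrt t)⁻¹) hQint ?_ ?_
          · exact Continuous.aestronglyMeasurable (by fun_prop)
          · refine Eventually.of_forall fun y => ?_
            rw [Real.norm_of_nonneg (by positivity)]
            refine mul_le_of_le_one_right (by positivity) ?_
            rw [Real.exp_le_one_iff, neg_div]
            have : 0 ≤ (x - y) ^ 2 / (4 * t) := by positivity
            linarith
        · by_cases hy : y ∈ J
          · simp only [hQ, hh]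
            rw [indicator_of_mem hy, indicator_of_mem hy, norm_smul,
              Real.norm_of_nonneg (besselHeatKernel_pos hμ ht0 hx (hJpos hy)).le, ← mul_assoc]
            gcongr
            exact hKC t ht0 ht.2.le x (by linarith) y hy.1
          · simp only [hQ]
            rw [indicator_of_notMem hy, indicator_of_notMem hy]
            simp
      · refine (hfar _ measurableSet_Ioi hs3).trans ?_
        exact mul_le_mul_of_nonneg_left (setIntegral_besselHeatKernel_mul_rpow_Ioi_le hμ ht0 hx)
          hM'0

/-! ### Integrals depending on a parameter -/

/-- Compactness turns joint continuity along `{p₀} × K` into one bound on a neighbourhood of `p₀`,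
uniform in `y`. It supplies the dominating functions below. -/
lemma eventually_forall_norm_le_of_continuousAt {P : Type*} [TopologicalSpace P]
    {k : P → ℝ → ℂ} {p₀ : P} {K : Set ℝ} (hK : IsCompact K)
    (hk : ∀ y ∈ K, ContinuousAt (fun q : P × ℝ => k q.1 q.2) (p₀, y)) :
    ∃ M, ∀ᶠ p in 𝓝 p₀, ∀ y ∈ K, ‖k p y‖ ≤ M := by
  have hc : ContinuousOn (k p₀) K := fun y hy =>
    (ContinuousAt.comp (f := fun y => (p₀, y)) (g := fun q : P × ℝ => k q.1 q.2) (hk y hy)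
      (by fun_prop)).continuousWithinAt
  obtain ⟨M, hM⟩ := hK.exists_bound_of_continuousOn hc
  refine ⟨M + 1, hK.eventually_forall_of_forall_eventually fun y hy => ?_⟩
  have h : ‖k p₀ y‖ < M + 1 := (hM y hy).trans_lt (lt_add_one M)
  filter_upwards [(hk y hy).norm.eventually_lt_const h] with z hz using hz.le

lemma continuousAt_setIntegral_mul {P : Type*} [TopologicalSpace P] [FirstCountableTopology P]
    {k : P → ℝ → ℂ} {g : ℝ → ℂ} {p₀ : P} {K : Set ℝ} (hK : IsCompact K)
    (hg : IntegrableOn g K)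
    (hk : ∀ y ∈ K, ContinuousAt (fun q : P × ℝ => k q.1 q.2) (p₀, y))
    (hkev : ∀ᶠ p in 𝓝 p₀, ContinuousOn (k p) K) :
    ContinuousAt (fun p => ∫ y in K, k p y * g y) p₀ := by
  obtain ⟨M, hM⟩ := eventually_forall_norm_le_of_continuousAt hK hk
  refine continuousAt_of_dominated (bound := fun y => M * ‖g y‖) ?_ ?_ (hg.norm.const_mul M) ?_
  · filter_upwards [hkev] with p hp
    exact (hp.aestronglyMeasurable hK.measurableSet).mul hg.aestronglyMeasurable
  · filter_upwards [hM] with p hp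
    filter_upwards [ae_restrict_mem hK.measurableSet] with y hy
    rw [norm_mul]
    exact mul_le_mul_of_nonneg_right (hp y hy) (norm_nonneg _)
  · filter_upwards [ae_restrict_mem hK.measurableSet] with y hy
    exact (ContinuousAt.comp (f := fun p => (p, y)) (g := fun q : P × ℝ => k q.1 q.2) (hk y hy)
      (by fun_prop)).mul continuousAt_const

lemma hasDerivAt_setIntegral_mul {k k' : ℝ → ℝ → ℂ} {g : ℝ → ℂ} {x₀ : ℝ} {K : Set ℝ}
    (hK : IsCompact K) (hg : IntegrableOn g K)
    (hk : ∀ᶠ x in 𝓝 x₀, ContinuousOn (k x) K)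
    (hk' : ∀ y ∈ K, ContinuousAt (fun q : ℝ × ℝ => k' q.1 q.2) (x₀, y))
    (hd : ∀ᶠ x in 𝓝 x₀, ∀ y ∈ K, HasDerivAt (fun x => k x y) (k' x y) x) :
    HasDerivAt (fun x => ∫ y in K, k x y * g y) (∫ y in K, k' x₀ y * g y) x₀ := by
  obtain ⟨M, hM⟩ := eventually_forall_norm_le_of_continuousAt hK hk'
  have hc : ContinuousOn (k' x₀) K := fun y hy =>
    (ContinuousAt.comp (f := fun y => (x₀, y)) (g := fun q : ℝ × ℝ => k' q.1 q.2) (hk' y hy)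
      (by fun_prop)).continuousWithinAt
  refine (hasDerivAt_integral_of_dominated_loc_of_deriv_le
    (F' := fun x y => k' x y * g y) (bound := fun y => M * ‖g y‖) (hd.and hM) ?_ ?_ ?_ ?_
    (hg.norm.const_mul M) ?_).2
  · filter_upwards [hk] with p hp
    exact (hp.aestronglyMeasurable hK.measurableSet).mul hg.aestronglyMeasurable
  · obtain ⟨B, hB⟩ := hK.exists_bound_of_continuousOn hk.self_of_nhds
    refine Integrable.bdd_mul (c := B) hg
      (hk.self_of_nhds.aestronglyMeasurable hK.measurableSet) ?_
    filter_upwards [ae_restrict_mem hK.measurableSet] with y hy using hB y hy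
  · exact (hc.aestronglyMeasurable hK.measurableSet).mul hg.aestronglyMeasurable
  · filter_upwards [ae_restrict_mem hK.measurableSet] with y hy x hx
    rw [norm_mul]
    exact mul_le_mul_of_nonneg_right (hx.2 y hy) (norm_nonneg _)
  · filter_upwards [ae_restrict_mem hK.measurableSet] with y hy x hx
    exact (hx.1 y hy).mul_const _

/-- A Landau-type interpolation: the mean value inequality for `z ↦ h z - z h₁(x)` compares `h₁(x)`
with the difference quotient over the interval. It spares a separate estimate of `∂_x W`. -/
lemma norm_deriv_le_of_norm_le {h h₁ h₂ : ℝ → ℂ} {α β A B : ℝ} (hαβ : α < β)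
    (hd : ∀ x ∈ Icc α β, HasDerivAt h (h₁ x) x) (hd₁ : ∀ x ∈ Icc α β, HasDerivAt h₁ (h₂ x) x)
    (hA : ∀ x ∈ Icc α β, ‖h x‖ ≤ A) (hB : ∀ x ∈ Icc α β, ‖h₂ x‖ ≤ B) {x : ℝ}
    (hx : x ∈ Icc α β) : ‖h₁ x‖ ≤ 2 * A / (β - α) + B * (β - α) := by
  have hαm : α ∈ Icc α β := left_mem_Icc.2 hαβ.le
  have hβm : β ∈ Icc α β := right_mem_Icc.2 hαβ.le
  have hB0 : 0 ≤ B := (norm_nonneg _).trans (hB x hx)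
  have hpos : 0 < β - α := sub_pos.2 hαβ
  have h1 : ∀ z ∈ Icc α β, ‖h₁ z - h₁ x‖ ≤ B * (β - α) := by
    intro z hz
    refine ((convex_Icc α β).norm_image_sub_le_of_norm_hasDerivWithin_le
      (fun y hy => (hd₁ y hy).hasDerivWithinAt) hB hx hz).trans ?_
    refine mul_le_mul_of_nonneg_left ?_ hB0
    rw [Real.norm_eq_abs, abs_le]
    constructor <;> linarith [hx.1, hx.2, hz.1, hz.2]
  have h2 : ∀ z ∈ Icc α β, HasDerivWithinAt (fun z => h z - (z : ℂ) * h₁ x) (h₁ z - h₁ x)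
      (Icc α β) z := by
    intro z hz
    have := (Complex.ofRealCLM.hasDerivAt (x := z)).mul_const (h₁ x)
    simp only [Complex.ofRealCLM_apply, Complex.ofReal_one, one_mul] at this
    exact ((hd z hz).sub this).hasDerivWithinAt
  have h3 := (convex_Icc α β).norm_image_sub_le_of_norm_hasDerivWithin_le h2 h1 hαm hβm
  rw [Real.norm_of_nonneg hpos.le] at h3
  have h4 : ((β - α : ℝ) : ℂ) * h₁ x =
      h β - h α - ((h β - (β : ℂ) * h₁ x) - (h α - (α : ℂ) * h₁ x)) := by
    push_cast; ring
  have h5 : (β - α) * ‖h₁ x‖ ≤ 2 * A + B * (β - α) * (β - α) := by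
    calc (β - α) * ‖h₁ x‖ = ‖((β - α : ℝ) : ℂ) * h₁ x‖ := by
          rw [norm_mul, Complex.norm_real, Real.norm_of_nonneg hpos.le]
      _ ≤ ‖h β - h α‖ + ‖(h β - (β : ℂ) * h₁ x) - (h α - (α : ℂ) * h₁ x)‖ := by
          rw [h4]; exact norm_sub_le _ _
      _ ≤ (‖h β‖ + ‖h α‖) + B * (β - α) * (β - α) := add_le_add (norm_sub_le _ _) h3
      _ ≤ _ := by linarith [hA α hαm, hA β hβm]
  have h6 : 2 * A / (β - α) + B * (β - α) = (2 * A + B * (β - α) * (β - α)) / (β - α) := by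
    field_simp
  rw [h6, le_div_iff₀ hpos]
  linarith

/-! ### Kernels continuous on the positive octant -/

/-- The kernel `κ` is jointly continuous for positive arguments. -/
def ContinuousKernel (κ : ℝ → ℝ → ℝ → ℝ) : Prop :=
  ∀ t > 0, ∀ x > 0, ∀ y > 0, ContinuousAt (fun p : ℝ × ℝ × ℝ => κ p.1 p.2.1 p.2.2) (t, x, y)

section ContinuousKernel

variable {μ : ℝ}

lemma continuousKernel_besselHeatKernel (hμ : -1 < μ) :
    ContinuousKernel (besselHeatKernel μ) := fun _ ht _ hx _ hy =>
  ContinuousAt.besselHeatKernel_comp hμ (by fun_prop) (by fun_prop) (by fun_prop) ht hx hy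

lemma continuousKernel_besselHeatKernelDx (hμ : -1 < μ) :
    ContinuousKernel (besselHeatKernelDx μ) := fun _ ht _ hx _ hy =>
  ContinuousAt.besselHeatKernelDx_comp hμ (by fun_prop) (by fun_prop) (by fun_prop) ht hx hy

lemma eventually_pos_pos_pos {t x y : ℝ} (ht : 0 < t) (hx : 0 < x) (hy : 0 < y) :
    ∀ᶠ p : ℝ × ℝ × ℝ in 𝓝 (t, x, y), 0 < p.1 ∧ 0 < p.2.1 ∧ 0 < p.2.2 :=
  (lt_mem_nhds ht).prod_nhds ((lt_mem_nhds hx).prod_nhds (lt_mem_nhds hy))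

lemma continuousKernel_besselHeatKernelDt (hμ : -1 < μ) :
    ContinuousKernel (besselHeatKernelDt μ) := by
  intro t ht x hx y hy
  have h := ContinuousAt.besselHeatKernelTime_comp hμ (p := (t, x, y))
    (T := fun p : ℝ × ℝ × ℝ => p.1) (X := fun p => p.2.1) (Y := fun p => p.2.2)
    (by fun_prop) (by fun_prop) (by fun_prop) ht hx hy
  refine h.congr ?_
  filter_upwards [eventually_pos_pos_pos ht hx hy] with p hp
    using (besselHeatKernelDt_eq hμ hp.1 hp.2.1 hp.2.2).symm

lemma besselHeatKernelDxx_eq_sub (hμ : -1 < μ) {t x y : ℝ} (ht : 0 < t) (hx : 0 < x)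
    (hy : 0 < y) : besselHeatKernelDxx μ t x y =
      besselHeatKernelDt μ t x y - (1 / 4 - μ ^ 2) / x ^ 2 * besselHeatKernel μ t x y := by
  rw [besselHeatKernelDxx_eq hμ ht hx hy, besselHeatKernelDt_eq hμ ht hx hy]

lemma continuousKernel_besselHeatKernelDxx (hμ : -1 < μ) :
    ContinuousKernel (besselHeatKernelDxx μ) := by
  intro t ht x hx y hy
  have h1 := continuousKernel_besselHeatKernelDt hμ t ht x hx y hy
  have h2 := continuousKernel_besselHeatKernel hμ t ht x hx y hy
  have hx0 : x ≠ 0 := ne_of_gt hx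
  have h : ContinuousAt (fun p : ℝ × ℝ × ℝ => besselHeatKernelDt μ p.1 p.2.1 p.2.2 -
      (1 / 4 - μ ^ 2) / p.2.1 ^ 2 * besselHeatKernel μ p.1 p.2.1 p.2.2) (t, x, y) := by
    have h3 : ContinuousAt (fun p : ℝ × ℝ × ℝ => (1 / 4 - μ ^ 2) / p.2.1 ^ 2) (t, x, y) :=
      ContinuousAt.div continuousAt_const (by fun_prop) (pow_ne_zero 2 hx0)
    exact h1.sub (h3.mul h2)
  refine h.congr ?_
  filter_upwards [eventually_pos_pos_pos ht hx hy] with p hp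
    using (besselHeatKernelDxx_eq_sub hμ hp.1 hp.2.1 hp.2.2).symm

variable {κ : ℝ → ℝ → ℝ → ℝ} {c d : ℝ}

lemma ContinuousKernel.comp (hκ : ContinuousKernel κ) {α : Type*} [TopologicalSpace α]
    {T X Y : α → ℝ} {p : α} (hT : ContinuousAt T p) (hX : ContinuousAt X p)
    (hY : ContinuousAt Y p) (t0 : 0 < T p) (x0 : 0 < X p) (y0 : 0 < Y p) :
    ContinuousAt (fun q => κ (T q) (X q) (Y q)) p :=
  ContinuousAt.comp (f := fun q => (T q, X q, Y q))
    (g := fun p : ℝ × ℝ × ℝ => κ p.1 p.2.1 p.2.2) (hκ _ t0 _ x0 _ y0)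
    (hT.prodMk (hX.prodMk hY))

lemma ContinuousKernel.continuousOn (hκ : ContinuousKernel κ) (hc : 0 < c) {t x : ℝ}
    (ht : 0 < t) (hx : 0 < x) : ContinuousOn (fun y => κ t x y) (Icc c d) := fun _ hy =>
  (hκ.comp continuousAt_const continuousAt_const continuousAt_id ht hx
    (hc.trans_le hy.1)).continuousWithinAt

/-- The factor `Φ` is for a continuous source moving with the parameter and `g` for a merely
integrable datum, so that one statement serves both terms of `u`. -/
lemma ContinuousKernel.continuousAt_setIntegral (hκ : ContinuousKernel κ) (hc : 0 < c)
    {P : Type*} [TopologicalSpace P] [FirstCountableTopology P] {T X : P → ℝ} {p : P}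
    {Φ : P → ℝ → ℂ} {g : ℝ → ℂ} (hT : ContinuousAt T p) (hX : ContinuousAt X p) (t0 : 0 < T p)
    (x0 : 0 < X p) (hΦ : Continuous (fun q : P × ℝ => Φ q.1 q.2)) (hg : IntegrableOn g (Icc c d)) :
    ContinuousAt (fun q => ∫ y in Icc c d, κ (T q) (X q) y • (Φ q y * g y)) p := by
  have h := continuousAt_setIntegral_mul (k := fun q y => (κ (T q) (X q) y : ℂ) * Φ q y)
    (p₀ := p) (isCompact_Icc (a := c) (b := d)) hg (fun y hy => ?_) ?_
  · refine h.congr (Eventually.of_forall fun q => ?_)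
    refine integral_congr_ae (Eventually.of_forall fun y => ?_)
    simp only [Complex.real_smul, mul_assoc]
  · refine ContinuousAt.mul (Complex.continuous_ofReal.continuousAt.comp ?_) hΦ.continuousAt
    exact hκ.comp (T := fun q : P × ℝ => T q.1) (X := fun q : P × ℝ => X q.1)
      (ContinuousAt.comp (f := Prod.fst) hT continuousAt_fst)
      (ContinuousAt.comp (f := Prod.fst) hX continuousAt_fst) continuousAt_snd t0 x0
      (hc.trans_le hy.1)
  · filter_upwards [hT.eventually_const_lt t0, hX.eventually_const_lt x0] with q h1 h2
    refine ContinuousOn.mul (Complex.continuous_ofReal.comp_continuousOn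
      (hκ.continuousOn hc h1 h2)) (Continuous.continuousOn ?_)
    exact hΦ.comp (by fun_prop : Continuous fun y : ℝ => (q, y))

lemma ContinuousKernel.hasDerivAt_setIntegral_space {κ' : ℝ → ℝ → ℝ → ℝ}
    (hκ : ContinuousKernel κ) (hκ' : ContinuousKernel κ')
    (hd : ∀ t > 0, ∀ x > 0, ∀ y > 0, HasDerivAt (fun x => κ t x y) (κ' t x y) x) (hc : 0 < c)
    {g : ℝ → ℂ} (hg : IntegrableOn g (Icc c d)) {t x : ℝ} (ht : 0 < t) (hx : 0 < x) :
    HasDerivAt (fun x => ∫ y in Icc c d, κ t x y • g y) (∫ y in Icc c d, κ' t x y • g y) x := by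
  simp only [Complex.real_smul]
  refine hasDerivAt_setIntegral_mul (k := fun x y => (κ t x y : ℂ))
    (k' := fun x y => (κ' t x y : ℂ)) isCompact_Icc hg ?_ (fun y hy => ?_) ?_
  · filter_upwards [lt_mem_nhds hx] with z hz
    exact Complex.continuous_ofReal.comp_continuousOn (hκ.continuousOn hc ht hz)
  · exact Complex.continuous_ofReal.continuousAt.comp (hκ'.comp (T := fun _ => t)
      continuousAt_const continuousAt_fst continuousAt_snd ht hx (hc.trans_le hy.1))
  · filter_upwards [lt_mem_nhds hx] with z hz y hy
    exact (hd t ht z hz y (hc.trans_le hy.1)).ofReal_comp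

lemma ContinuousKernel.hasDerivAt_setIntegral_time {κ' : ℝ → ℝ → ℝ → ℝ}
    (hκ : ContinuousKernel κ) (hκ' : ContinuousKernel κ')
    (hd : ∀ t > 0, ∀ x > 0, ∀ y > 0, HasDerivAt (fun t => κ t x y) (κ' t x y) t) (hc : 0 < c)
    {g : ℝ → ℂ} (hg : IntegrableOn g (Icc c d)) {t x : ℝ} (ht : 0 < t) (hx : 0 < x) :
    HasDerivAt (fun t => ∫ y in Icc c d, κ t x y • g y) (∫ y in Icc c d, κ' t x y • g y) t := by
  simp only [Complex.real_smul]
  refine hasDerivAt_setIntegral_mul (k := fun t y => (κ t x y : ℂ))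
    (k' := fun t y => (κ' t x y : ℂ)) isCompact_Icc hg ?_ (fun y hy => ?_) ?_
  · filter_upwards [lt_mem_nhds ht] with z hz
    exact Complex.continuous_ofReal.comp_continuousOn (hκ.continuousOn hc hz hx)
  · exact Complex.continuous_ofReal.continuousAt.comp (hκ'.comp (X := fun _ => x)
      continuousAt_fst continuousAt_const continuousAt_snd ht hx (hc.trans_le hy.1))
  · filter_upwards [lt_mem_nhds ht] with z hz y hy
    exact (hd z hz x hx y (hc.trans_le hy.1)).ofReal_comp

end ContinuousKernel

/-! ### Green's formula and the inverse square root bound. -/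

section HeatKernel

variable {μ : ℝ}

lemma hasDerivAt_besselHeatKernel_Dt (hμ : -1 < μ) (t : ℝ) (ht : t > 0) (x : ℝ) (hx : x > 0)
    (y : ℝ) (hy : y > 0) :
    HasDerivAt (fun t => besselHeatKernel μ t x y) (besselHeatKernelDt μ t x y) t := by
  rw [besselHeatKernelDt_eq hμ ht hx hy]
  exact hasDerivAt_besselHeatKernel_time hμ ht hx hy

lemma hasDerivAt_besselHeatKernelDx_Dxx (hμ : -1 < μ) (t : ℝ) (ht : t > 0) (x : ℝ) (hx : x > 0)
    (y : ℝ) (hy : y > 0) :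
    HasDerivAt (fun x => besselHeatKernelDx μ t x y) (besselHeatKernelDxx μ t x y) x := by
  rw [besselHeatKernelDxx_eq hμ ht hx hy]
  exact hasDerivAt_besselHeatKernelDx hμ ht hx hy

lemma besselHeatKernelDt_comm (hμ : -1 < μ) {t x y : ℝ} (ht : 0 < t) (hx : 0 < x) (hy : 0 < y) :
    besselHeatKernelDt μ t x y = besselHeatKernelDt μ t y x := by
  rw [besselHeatKernelDt_eq hμ ht hx hy, besselHeatKernelDt_eq hμ ht hy hx,
    besselHeatKernelTime_comm]

/-- Moving the Bessel operator from the heat kernel to a test function. -/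
lemma setIntegral_besselHeatKernelDt_smul (hμ : -1 < μ) {c d : ℝ} (hc : 0 < c) (hcd : c ≤ d)
    {φ φ₁ φ₂ : ℝ → ℂ} (h1 : ∀ y, HasDerivAt φ (φ₁ y) y) (h2 : ∀ y, HasDerivAt φ₁ (φ₂ y) y)
    (hφ₂ : Continuous φ₂) (hφc : φ c = 0) (hφd : φ d = 0) (hφ₁c : φ₁ c = 0) (hφ₁d : φ₁ d = 0)
    {t x : ℝ} (ht : 0 < t) (hx : 0 < x) :
    ∫ y in Icc c d, besselHeatKernelDt μ t x y • φ y =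
      ∫ y in Icc c d, besselHeatKernel μ t x y •
        (φ₂ y + ((1 / 4 - μ ^ 2) / y ^ 2 : ℝ) • φ y) := by
  have hcφ : Continuous φ := continuous_iff_continuousAt.2 fun y => (h1 y).continuousAt
  have hcφ₁ : Continuous φ₁ := continuous_iff_continuousAt.2 fun y => (h2 y).continuousAt
  have hne : ∀ y ∈ Icc c d, y ^ 2 ≠ 0 := fun y hy => (pow_pos (hc.trans_le hy.1) 2).ne'
  have hb : ContinuousOn (fun y : ℝ => (1 / 4 - μ ^ 2) / y ^ 2) (Icc c d) :=
    ContinuousOn.div continuousOn_const (by fun_prop) hne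
  have hK := (continuousKernel_besselHeatKernel hμ).continuousOn (d := d) hc ht hx
  have hKt := (continuousKernel_besselHeatKernelDt hμ).continuousOn (d := d) hc ht hx
  set A : ℝ → ℂ := fun y => besselHeatKernelDt μ t x y • φ y with hA
  set B : ℝ → ℂ := fun y => besselHeatKernel μ t x y •
        (φ₂ y + ((1 / 4 - μ ^ 2) / y ^ 2 : ℝ) • φ y) with hB
  have hAc : ContinuousOn A (Icc c d) := by fun_prop
  have hBc : ContinuousOn B (Icc c d) := by fun_prop
  -- The Wronskian `∂_y W φ - W φ'` has derivative `A - B` by the heat equation in `y`; the symmetry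
  -- of `W` allows `y` to be placed in the first spatial slot. Its boundary values vanish with `φ`
  -- and `φ₁`.
  have hderiv : ∀ y ∈ uIcc c d, HasDerivAt (fun y => besselHeatKernelDx μ t y x • φ y -
      besselHeatKernel μ t y x • φ₁ y) (A y - B y) y := by
    intro y hy
    rw [uIcc_of_le hcd] at hy
    have hy0 : 0 < y := hc.trans_le hy.1
    have hd1 := hasDerivAt_besselHeatKernel_space hμ ht hy0 hx
    have hd2 := hasDerivAt_besselHeatKernelDx_Dxx hμ t ht y hy0 x hx
    refine ((hd2.smul (h1 y)).sub (hd1.smul (h2 y))).congr_deriv ?_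
    rw [besselHeatKernelDxx_eq_sub hμ ht hy0 hx]
    simp only [hA, hB]
    rw [besselHeatKernelDt_comm hμ ht hx hy0, besselHeatKernel_comm μ t x y]
    simp only [Complex.real_smul]
    push_cast
    ring
  have hint : IntervalIntegrable (fun y => A y - B y) volume c d := by
    refine ContinuousOn.intervalIntegrable ?_
    rw [uIcc_of_le hcd]
    exact hAc.sub hBc
  have h0 := intervalIntegral.integral_eq_sub_of_hasDerivAt hderiv hint
  rw [hφc, hφd, hφ₁c, hφ₁d] at h0
  simp only [smul_zero, sub_zero] at h0
  rw [intervalIntegral.integral_of_le hcd, ← integral_Icc_eq_integral_Ioc,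
    integral_sub (hAc.integrableOn_compact isCompact_Icc)
      (hBc.integrableOn_compact isCompact_Icc)] at h0
  exact sub_eq_zero.1 h0

/-- The Gaussian is simply bounded by one. The resulting factor `t^{-1/2}` is integrable at zero,
which is all that is needed in time. -/
lemma exists_norm_setIntegral_besselHeatKernel_le (hμ : -1 < μ) {c d α S : ℝ}
    (hc : 0 < c) (hcd : c ≤ d) (hα : 0 < α) (hS : 0 < S) :
    ∃ C, 0 < C ∧ ∀ t, 0 < t → t ≤ S → ∀ x, α ≤ x → ∀ (φ : ℝ → ℂ) (B : ℝ),
      (∀ y ∈ Icc c d, ‖φ y‖ ≤ B) →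
      ‖∫ y in Icc c d, besselHeatKernel μ t x y • φ y‖ ≤ C * B * (Real.sqrt t)⁻¹ := by
  obtain ⟨C, hC, h⟩ := exists_besselHeatKernel_le hμ (lt_min hα hc) hS
  -- Adding one keeps the constant positive when `c = d`.
  refine ⟨C * (d - c) + 1, by nlinarith [sub_nonneg.2 hcd], fun t ht htS x hx φ B hB => ?_⟩
  have hB0 : 0 ≤ B := (norm_nonneg _).trans (hB c (left_mem_Icc.2 hcd))
  have hb : ∀ y ∈ Icc c d, ‖besselHeatKernel μ t x y • φ y‖ ≤ C * (Real.sqrt t)⁻¹ * B := by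
    intro y hy
    have hK := besselHeatKernel_pos hμ ht (hα.trans_le hx) (hc.trans_le hy.1)
    rw [norm_smul, Real.norm_of_nonneg hK.le]
    have h1 := h t ht htS x ((min_le_left _ _).trans hx) y ((min_le_right _ _).trans hy.1)
    have h2 : Real.exp (-(x - y) ^ 2 / (4 * t)) ≤ 1 := by
      rw [Real.exp_le_one_iff, neg_div]
      have : 0 ≤ (x - y) ^ 2 / (4 * t) := by positivity
      linarith
    have h3 : besselHeatKernel μ t x y ≤ C * (Real.sqrt t)⁻¹ := by
      refine h1.trans (mul_le_mul_of_nonneg_left ?_ hC.le)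
      exact mul_le_of_le_one_right (by positivity) h2
    exact mul_le_mul h3 (hB y hy) (norm_nonneg _) (by positivity)
  refine (norm_setIntegral_le_of_norm_le_const (by simp) hb).trans ?_
  rw [Real.volume_real_Icc_of_le hcd]
  have : 0 ≤ B * (Real.sqrt t)⁻¹ := by positivity
  nlinarith

end HeatKernel

/-! ### Integrals in time with an inverse square root singularity -/

lemma integrableOn_inv_sqrt (S : ℝ) : IntegrableOn (fun τ : ℝ => (Real.sqrt τ)⁻¹) (Ioc 0 S) := by
  have h : IntervalIntegrable (fun τ : ℝ => τ ^ (-(1 / 2) : ℝ)) volume 0 S :=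
    intervalIntegral.intervalIntegrable_rpow' (by norm_num)
  refine h.1.congr_fun (fun τ hτ => ?_) measurableSet_Ioc
  simp only
  rw [Real.sqrt_eq_rpow, Real.rpow_neg hτ.1.le]

lemma integrableOn_of_norm_le_inv_sqrt {Ψ : ℝ → ℂ} {S C : ℝ} (hm : ContinuousOn Ψ (Ioc 0 S))
    (hb : ∀ τ ∈ Ioc 0 S, ‖Ψ τ‖ ≤ C * (Real.sqrt τ)⁻¹) : IntegrableOn Ψ (Ioc 0 S) := by
  refine Integrable.mono' ((integrableOn_inv_sqrt S).const_mul C)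
    (hm.aestronglyMeasurable measurableSet_Ioc) ?_
  filter_upwards [ae_restrict_mem measurableSet_Ioc] with τ hτ using hb τ hτ

lemma continuousAt_setIntegral_Ioc {P : Type*} [TopologicalSpace P] [FirstCountableTopology P]
    {Ψ : P → ℝ → ℂ} {p₀ : P} {S C : ℝ} (hm : ∀ᶠ p in 𝓝 p₀, ContinuousOn (Ψ p) (Ioc 0 S))
    (hb : ∀ᶠ p in 𝓝 p₀, ∀ τ ∈ Ioc 0 S, ‖Ψ p τ‖ ≤ C * (Real.sqrt τ)⁻¹)
    (hc : ∀ τ ∈ Ioc 0 S, ContinuousAt (fun p => Ψ p τ) p₀) :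
    ContinuousAt (fun p => ∫ τ in Ioc 0 S, Ψ p τ) p₀ := by
  refine continuousAt_of_dominated (bound := fun τ => C * (Real.sqrt τ)⁻¹) ?_ ?_
    ((integrableOn_inv_sqrt S).const_mul C) ?_
  · filter_upwards [hm] with p hp using hp.aestronglyMeasurable measurableSet_Ioc
  · filter_upwards [hb] with p hp
    filter_upwards [ae_restrict_mem measurableSet_Ioc] with τ hτ using hp τ hτ
  · filter_upwards [ae_restrict_mem measurableSet_Ioc] with τ hτ using hc τ hτ

lemma hasDerivAt_setIntegral_Ioc {Ψ Ψ' : ℝ → ℝ → ℂ} {x₀ S C C' : ℝ}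
    (hm : ∀ᶠ x in 𝓝 x₀, ContinuousOn (Ψ x) (Ioc 0 S)) (hm' : ContinuousOn (Ψ' x₀) (Ioc 0 S))
    (hb : ∀ τ ∈ Ioc 0 S, ‖Ψ x₀ τ‖ ≤ C * (Real.sqrt τ)⁻¹)
    (hd : ∀ᶠ x in 𝓝 x₀, ∀ τ ∈ Ioc 0 S, HasDerivAt (fun x => Ψ x τ) (Ψ' x τ) x)
    (hb' : ∀ᶠ x in 𝓝 x₀, ∀ τ ∈ Ioc 0 S, ‖Ψ' x τ‖ ≤ C' * (Real.sqrt τ)⁻¹) :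
    HasDerivAt (fun x => ∫ τ in Ioc 0 S, Ψ x τ) (∫ τ in Ioc 0 S, Ψ' x₀ τ) x₀ := by
  refine (hasDerivAt_integral_of_dominated_loc_of_deriv_le (F' := Ψ')
    (bound := fun τ => C' * (Real.sqrt τ)⁻¹) (hd.and hb') ?_
    (integrableOn_of_norm_le_inv_sqrt hm.self_of_nhds hb)
    (hm'.aestronglyMeasurable measurableSet_Ioc) ?_
    ((integrableOn_inv_sqrt S).const_mul C') ?_).2
  · filter_upwards [hm] with p hp using hp.aestronglyMeasurable measurableSet_Ioc
  · filter_upwards [ae_restrict_mem measurableSet_Ioc] with τ hτ x hx using hx.2 τ hτ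
  · filter_upwards [ae_restrict_mem measurableSet_Ioc] with τ hτ x hx using hx.1 τ hτ

/-! ### The Duhamel integral -/

/-- `∫_c^d κ(τ,x,y) φ(s,y) dy`. -/
noncomputable def spatialInt (κ : ℝ → ℝ → ℝ → ℝ) (c d : ℝ) (φ : ℝ × ℝ → ℂ) (τ s x : ℝ) : ℂ :=
  ∫ y in Icc c d, κ τ x y • φ (s, y)

/-- `∫_0^S ∫_c^d κ(τ,x,y) φ(t-τ,y) dy dτ`. -/
noncomputable def duhamelInt (κ : ℝ → ℝ → ℝ → ℝ) (c d : ℝ) (φ : ℝ × ℝ → ℂ) (S t x : ℝ) : ℂ :=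
  ∫ τ in Ioc 0 S, spatialInt κ c d φ τ (t - τ) x

/-- The spatial integrals are `O(τ^{-1/2})`, locally uniformly in `x`. -/
def TimeBounded (κ : ℝ → ℝ → ℝ → ℝ) (c d : ℝ) (φ : ℝ × ℝ → ℂ) (S : ℝ) : Prop :=
  ∀ α β, 0 < α → α < β → ∃ C, ∀ τ ∈ Ioc 0 S, ∀ s, ∀ x ∈ Icc α β,
    ‖spatialInt κ c d φ τ s x‖ ≤ C * (Real.sqrt τ)⁻¹

section

variable {κ κ' : ℝ → ℝ → ℝ → ℝ} {c d S : ℝ} {φ : ℝ × ℝ → ℂ}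

lemma ContinuousKernel.continuousAt_spatialInt (hκ : ContinuousKernel κ) (hc : 0 < c)
    (hφ : Continuous φ) {P : Type*} [TopologicalSpace P] [FirstCountableTopology P]
    {T s X : P → ℝ} {p : P} (hT : ContinuousAt T p) (hs : Continuous s) (hX : ContinuousAt X p)
    (t0 : 0 < T p) (x0 : 0 < X p) :
    ContinuousAt (fun q => spatialInt κ c d φ (T q) (s q) (X q)) p := by
  have h := hκ.continuousAt_setIntegral (d := d) hc (Φ := fun q y => φ (s q, y)) hT hX t0 x0
    (by fun_prop) (g := fun _ => 1) (by simp [IntegrableOn])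
  simpa only [mul_one, spatialInt] using h

lemma ContinuousKernel.continuousOn_spatialInt_time (hκ : ContinuousKernel κ) (hc : 0 < c)
    (hφ : Continuous φ) (t : ℝ) {x : ℝ} (hx : 0 < x) :
    ContinuousOn (fun τ => spatialInt κ c d φ τ (t - τ) x) (Ioc 0 S) := fun _ hτ =>
  (hκ.continuousAt_spatialInt hc hφ continuousAt_id (by fun_prop) continuousAt_const hτ.1
    hx).continuousWithinAt

lemma TimeBounded.exists_bound (h : TimeBounded κ c d φ S) {x : ℝ} (hx : 0 < x) :
    ∃ C, ∀ᶠ z in 𝓝 x, ∀ τ ∈ Ioc 0 S, ∀ s, ‖spatialInt κ c d φ τ s z‖ ≤ C * (Real.sqrt τ)⁻¹ := by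
  obtain ⟨C, hC⟩ := h (x / 2) (2 * x) (by positivity) (by linarith)
  refine ⟨C, ?_⟩
  filter_upwards [Icc_mem_nhds (by linarith : x / 2 < x) (by linarith : x < 2 * x)] with z hz
  exact fun τ hτ s => hC τ hτ s z hz

lemma TimeBounded.integrableOn (h : TimeBounded κ c d φ S) (hκ : ContinuousKernel κ)
    (hc : 0 < c) (hφ : Continuous φ) (t : ℝ) {x : ℝ} (hx : 0 < x) :
    IntegrableOn (fun τ => spatialInt κ c d φ τ (t - τ) x) (Ioc 0 S) := by
  obtain ⟨C, hC⟩ := h.exists_bound hx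
  exact integrableOn_of_norm_le_inv_sqrt (hκ.continuousOn_spatialInt_time hc hφ t hx)
    fun τ hτ => hC.self_of_nhds τ hτ _

lemma TimeBounded.continuousAt_duhamelInt (h : TimeBounded κ c d φ S) (hκ : ContinuousKernel κ)
    (hc : 0 < c) (hφ : Continuous φ) (t : ℝ) {x : ℝ} (hx : 0 < x) :
    ContinuousAt (fun p : ℝ × ℝ => duhamelInt κ c d φ S p.1 p.2) (t, x) := by
  obtain ⟨C, hC⟩ := h.exists_bound hx
  refine continuousAt_setIntegral_Ioc (C := C) ?_ ?_ fun τ hτ => ?_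
  · filter_upwards [continuousAt_snd.eventually_const_lt hx] with p hp
    exact hκ.continuousOn_spatialInt_time hc hφ p.1 hp
  · filter_upwards [continuousAt_snd.eventually hC] with p hp
    exact fun τ hτ => hp τ hτ _
  · exact hκ.continuousAt_spatialInt hc hφ continuousAt_const (by fun_prop) continuousAt_snd hτ.1
      hx

lemma TimeBounded.hasDerivAt_duhamelInt (h : TimeBounded κ c d φ S)
    (h' : TimeBounded κ' c d φ S) (hκ : ContinuousKernel κ) (hκ' : ContinuousKernel κ')
    (hd : ∀ t > 0, ∀ x > 0, ∀ y > 0, HasDerivAt (fun x => κ t x y) (κ' t x y) x) (hc : 0 < c)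
    (hφ : Continuous φ) (t : ℝ) {x : ℝ} (hx : 0 < x) :
    HasDerivAt (fun x => duhamelInt κ c d φ S t x) (duhamelInt κ' c d φ S t x) x := by
  obtain ⟨C, hC⟩ := h.exists_bound hx
  obtain ⟨C', hC'⟩ := h'.exists_bound hx
  refine hasDerivAt_setIntegral_Ioc (Ψ := fun x τ => spatialInt κ c d φ τ (t - τ) x)
    (Ψ' := fun x τ => spatialInt κ' c d φ τ (t - τ) x) (C := C) (C' := C') ?_
    (hκ'.continuousOn_spatialInt_time hc hφ t hx) (fun τ hτ => hC.self_of_nhds τ hτ _) ?_ ?_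
  · filter_upwards [lt_mem_nhds hx] with z hz
    exact hκ.continuousOn_spatialInt_time hc hφ t hz
  · filter_upwards [lt_mem_nhds hx] with z hz τ hτ
    exact hκ.hasDerivAt_setIntegral_space hκ' hd hc
      (Continuous.integrableOn_Icc (by fun_prop)) hτ.1 hz
  · filter_upwards [hC'] with z hz
    exact fun τ hτ => hz τ hτ _

/-- A source that vanishes for nonpositive times makes the part `τ > t` of the integral empty. Hence
`t` can be moved without moving the domain, and no boundary term appears. -/
lemma duhamelInt_eq_setIntegral (κ : ℝ → ℝ → ℝ → ℝ) (c d : ℝ)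
    (hφ : ∀ s ≤ 0, ∀ y, φ (s, y) = 0) {t : ℝ} (htS : t ≤ S) (x : ℝ) :
    duhamelInt κ c d φ S t x = ∫ τ in Ioc 0 t, spatialInt κ c d φ τ (t - τ) x := by
  refine setIntegral_eq_of_subset_of_forall_sdiff_eq_zero measurableSet_Ioc
    (Ioc_subset_Ioc_right htS) fun τ hτ => ?_
  have h : t - τ ≤ 0 := by
    by_contra hneg
    exact hτ.2 ⟨hτ.1.1, by linarith⟩
  simp [spatialInt, hφ _ h]

end

lemma timeBounded_besselHeatKernel {μ : ℝ} (hμ : -1 < μ) {c d S B : ℝ} (hc : 0 < c)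
    (hcd : c ≤ d) (hS : 0 < S) {φ : ℝ × ℝ → ℂ} (hB : ∀ p, ‖φ p‖ ≤ B) :
    TimeBounded (besselHeatKernel μ) c d φ S := by
  intro α β hα _
  obtain ⟨C, -, hC⟩ := exists_norm_setIntegral_besselHeatKernel_le hμ hc hcd hα hS
  exact ⟨C * B, fun τ hτ s x hx => hC τ hτ.1 hτ.2 x hx.1 _ B fun y _ => hB _⟩

/-- `F` is a `C²` source term with its derivatives `Fs = ∂_s F`, `F₁ = ∂_y F` and `F₂ = ∂_y² F`,
all bounded by `B`, which vanishes for `s ≤ 0` and for `y` outside of `(c, d)`. -/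
structure IsBesselSource (c d B : ℝ) (F Fs F₁ F₂ : ℝ × ℝ → ℂ) : Prop where
  pos : 0 < c
  le : c ≤ d
  continuous : Continuous F
  continuous_time : Continuous Fs
  continuous_space_two : Continuous F₂
  bound : ∀ p, ‖F p‖ ≤ B
  bound_time : ∀ p, ‖Fs p‖ ≤ B
  bound_space_two : ∀ p, ‖F₂ p‖ ≤ B
  hasDerivAt_time : ∀ s y, HasDerivAt (fun s => F (s, y)) (Fs (s, y)) s
  hasDerivAt_space : ∀ s y, HasDerivAt (fun y => F (s, y)) (F₁ (s, y)) y
  hasDerivAt_space_two : ∀ s y, HasDerivAt (fun y => F₁ (s, y)) (F₂ (s, y)) y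
  eq_zero : ∀ s, ∀ y ∉ Ioo c d, F (s, y) = 0
  eq_zero_space : ∀ s, ∀ y ∉ Ioo c d, F₁ (s, y) = 0
  eq_zero_of_nonpos : ∀ s ≤ 0, ∀ y, F (s, y) = 0
  eq_zero_time_of_nonpos : ∀ s ≤ 0, ∀ y, Fs (s, y) = 0

/-! ### Bounds and derivatives of the Duhamel integral. -/

namespace IsBesselSource

variable {μ c d B S : ℝ} {F Fs F₁ F₂ : ℝ × ℝ → ℂ} (h : IsBesselSource c d B F Fs F₁ F₂)

include h

lemma timeBounded (hμ : -1 < μ) (hS : 0 < S) : TimeBounded (besselHeatKernel μ) c d F S :=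
  timeBounded_besselHeatKernel hμ h.pos h.le hS h.bound

/-- The decisive estimate: Green's formula replaces `∂_τ W` against `F` by `W` against `Δ_μ F`,
which is bounded because `y ≥ c` controls the potential. -/
lemma timeBounded_Dt (hμ : -1 < μ) (hS : 0 < S) :
    TimeBounded (besselHeatKernelDt μ) c d F S := by
  intro α β hα _
  obtain ⟨C, -, hC⟩ := exists_norm_setIntegral_besselHeatKernel_le hμ h.pos h.le hα hS
  have hB0 : 0 ≤ B := (norm_nonneg _).trans (h.bound (0, 0))
  refine ⟨C * (B + |1 / 4 - μ ^ 2| / c ^ 2 * B), fun τ hτ s x hx => ?_⟩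
  have := setIntegral_besselHeatKernelDt_smul hμ h.pos h.le (h.hasDerivAt_space s)
    (h.hasDerivAt_space_two s) (h.continuous_space_two.comp (by fun_prop))
    (h.eq_zero s c (by simp)) (h.eq_zero s d (by simp))
    (h.eq_zero_space s c (by simp)) (h.eq_zero_space s d (by simp)) hτ.1 (hα.trans_le hx.1)
  rw [spatialInt, this]
  refine hC τ hτ.1 hτ.2 x hx.1 _ _ fun y hy => ?_
  refine (norm_add_le _ _).trans (add_le_add (h.bound_space_two _) ?_)
  rw [norm_smul, norm_div, norm_pow, Real.norm_eq_abs, Real.norm_eq_abs,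
    abs_of_pos (h.pos.trans_le hy.1)]
  have h1 := h.pos
  have h2 := hy.1
  have h3 := h.bound (s, y)
  gcongr

lemma spatialInt_Dxx (hμ : -1 < μ) (s : ℝ) {τ x : ℝ} (hτ : 0 < τ) (hx : 0 < x) :
    spatialInt (besselHeatKernelDxx μ) c d F τ s x = spatialInt (besselHeatKernelDt μ) c d F τ s x -
      ((1 / 4 - μ ^ 2) / x ^ 2) • spatialInt (besselHeatKernel μ) c d F τ s x := by
  have hFc : Continuous fun y => F (s, y) := h.continuous.comp (by fun_prop)
  have h1 : IntegrableOn (fun y => besselHeatKernelDt μ τ x y • F (s, y)) (Icc c d) :=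
    ContinuousOn.integrableOn_compact isCompact_Icc
      (((continuousKernel_besselHeatKernelDt hμ).continuousOn h.pos hτ hx).smul hFc.continuousOn)
  have h2 : IntegrableOn (fun y => besselHeatKernel μ τ x y • F (s, y)) (Icc c d) :=
    ContinuousOn.integrableOn_compact isCompact_Icc
      (((continuousKernel_besselHeatKernel hμ).continuousOn h.pos hτ hx).smul hFc.continuousOn)
  have h3 : IntegrableOn (fun y => ((1 / 4 - μ ^ 2) / x ^ 2) • besselHeatKernel μ τ x y • F (s, y))
      (Icc c d) :=
    Integrable.fun_smul ((1 / 4 - μ ^ 2) / x ^ 2) h2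
  unfold spatialInt
  rw [← integral_smul, ← integral_sub h1 h3]
  refine setIntegral_congr_fun measurableSet_Icc fun y hy => ?_
  rw [besselHeatKernelDxx_eq_sub hμ hτ hx (h.pos.trans_le hy.1), sub_smul, mul_smul]

lemma timeBounded_Dxx (hμ : -1 < μ) (hS : 0 < S) :
    TimeBounded (besselHeatKernelDxx μ) c d F S := by
  intro α β hα hαβ
  obtain ⟨C₀, h0⟩ := h.timeBounded hμ hS α β hα hαβ
  obtain ⟨C₁, h1⟩ := h.timeBounded_Dt hμ hS α β hα hαβ
  refine ⟨C₁ + |1 / 4 - μ ^ 2| / α ^ 2 * C₀, fun τ hτ s x hx => ?_⟩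
  have hx0 : 0 < x := hα.trans_le hx.1
  rw [h.spatialInt_Dxx hμ s hτ.1 hx0, add_mul, mul_assoc]
  refine (norm_sub_le _ _).trans (add_le_add (h1 τ hτ s x hx) ?_)
  rw [norm_smul, norm_div, norm_pow, Real.norm_eq_abs, Real.norm_eq_abs, abs_of_pos hx0]
  have h3 := h0 τ hτ s x hx
  have h4 := hx.1
  gcongr

lemma hasDerivAt_spatialInt (hμ : -1 < μ) (s : ℝ) {τ x : ℝ} (hτ : 0 < τ) (hx : 0 < x) :
    HasDerivAt (fun x => spatialInt (besselHeatKernel μ) c d F τ s x)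
      (spatialInt (besselHeatKernelDx μ) c d F τ s x) x :=
  (continuousKernel_besselHeatKernel hμ).hasDerivAt_setIntegral_space
    (continuousKernel_besselHeatKernelDx hμ)
    (fun _ ht _ hx _ hy => hasDerivAt_besselHeatKernel_space hμ ht hx hy) h.pos
    (Continuous.integrableOn_Icc (h.continuous.comp (by fun_prop))) hτ hx

lemma hasDerivAt_spatialInt_Dx (hμ : -1 < μ) (s : ℝ) {τ x : ℝ} (hτ : 0 < τ) (hx : 0 < x) :
    HasDerivAt (fun x => spatialInt (besselHeatKernelDx μ) c d F τ s x)
      (spatialInt (besselHeatKernelDxx μ) c d F τ s x) x :=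
  (continuousKernel_besselHeatKernelDx hμ).hasDerivAt_setIntegral_space
    (continuousKernel_besselHeatKernelDxx hμ) (hasDerivAt_besselHeatKernelDx_Dxx hμ) h.pos
    (Continuous.integrableOn_Icc (h.continuous.comp (by fun_prop))) hτ hx

/-- Interpolation in `x` between the bounds for `W` and `∂_x² W`; both are `O(τ^{-1/2})`, and the
interpolated bound is linear in them. -/
lemma timeBounded_Dx (hμ : -1 < μ) (hS : 0 < S) :
    TimeBounded (besselHeatKernelDx μ) c d F S := by
  intro α β hα hαβ
  obtain ⟨C₀, h0⟩ := h.timeBounded hμ hS α β hα hαβ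
  obtain ⟨C₂, h2⟩ := h.timeBounded_Dxx hμ hS α β hα hαβ
  refine ⟨2 * C₀ / (β - α) + C₂ * (β - α), fun τ hτ s x hx => ?_⟩
  refine (norm_deriv_le_of_norm_le hαβ
    (fun z hz => h.hasDerivAt_spatialInt hμ s hτ.1 (hα.trans_le hz.1))
    (fun z hz => h.hasDerivAt_spatialInt_Dx hμ s hτ.1 (hα.trans_le hz.1))
    (h0 τ hτ s) (h2 τ hτ s) hx).trans (le_of_eq ?_)
  ring

lemma duhamelInt_Dxx (hμ : -1 < μ) (hS : 0 < S) (t : ℝ) {x : ℝ} (hx : 0 < x) :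
    duhamelInt (besselHeatKernelDxx μ) c d F S t x =
      duhamelInt (besselHeatKernelDt μ) c d F S t x -
        ((1 / 4 - μ ^ 2) / x ^ 2) • duhamelInt (besselHeatKernel μ) c d F S t x := by
  have h1 := (h.timeBounded_Dt hμ hS).integrableOn (continuousKernel_besselHeatKernelDt hμ) h.pos
    h.continuous t hx
  have h2 := (h.timeBounded hμ hS).integrableOn (continuousKernel_besselHeatKernel hμ) h.pos
    h.continuous t hx
  have h3 : IntegrableOn (fun τ => ((1 / 4 - μ ^ 2) / x ^ 2) •
      spatialInt (besselHeatKernel μ) c d F τ (t - τ) x) (Ioc 0 S) :=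
    Integrable.fun_smul ((1 / 4 - μ ^ 2) / x ^ 2) h2
  unfold duhamelInt
  rw [← integral_smul, ← integral_sub h1 h3]
  refine setIntegral_congr_fun measurableSet_Ioc fun τ hτ => ?_
  exact h.spatialInt_Dxx hμ _ hτ.1 hx

lemma hasDerivAt_duhamelInt_time (hμ : -1 < μ) (hS : 0 < S) (t : ℝ) {x : ℝ} (hx : 0 < x) :
    HasDerivAt (fun t => duhamelInt (besselHeatKernel μ) c d F S t x)
      (duhamelInt (besselHeatKernel μ) c d Fs S t x) t := by
  have hK := continuousKernel_besselHeatKernel hμ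
  obtain ⟨C, hC⟩ := (h.timeBounded hμ hS).exists_bound hx
  obtain ⟨C', hC'⟩ := (timeBounded_besselHeatKernel hμ h.pos h.le hS h.bound_time).exists_bound hx
  refine hasDerivAt_setIntegral_Ioc
    (Ψ := fun t τ => spatialInt (besselHeatKernel μ) c d F τ (t - τ) x)
    (Ψ' := fun t τ => spatialInt (besselHeatKernel μ) c d Fs τ (t - τ) x) (C := C) (C' := C')
    (Eventually.of_forall fun t => hK.continuousOn_spatialInt_time h.pos h.continuous t hx)
    (hK.continuousOn_spatialInt_time h.pos h.continuous_time t hx)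
    (fun τ hτ => hC.self_of_nhds τ hτ _) ?_
    (Eventually.of_forall fun t τ hτ => hC'.self_of_nhds τ hτ _)
  refine Eventually.of_forall fun t τ hτ => ?_
  have hKc : ContinuousOn (fun y => (besselHeatKernel μ τ x y : ℂ)) (Icc c d) :=
    Complex.continuous_ofReal.comp_continuousOn (hK.continuousOn h.pos hτ.1 hx)
  have := hasDerivAt_setIntegral_mul (k := fun t y => F (t - τ, y))
    (k' := fun t y => Fs (t - τ, y)) (g := fun y => (besselHeatKernel μ τ x y : ℂ)) (x₀ := t)
    (isCompact_Icc (a := c) (b := d)) (hKc.integrableOn_compact isCompact_Icc)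
    (Eventually.of_forall fun t => (h.continuous.comp (by fun_prop)).continuousOn)
    (fun y _ => (h.continuous_time.comp (by fun_prop)).continuousAt)
    (Eventually.of_forall fun t y _ => (h.hasDerivAt_time (t - τ) y).comp_sub_const t τ)
  simpa only [spatialInt, Complex.real_smul, mul_comm] using this

/-- The variable `τ` enters through the kernel and, with the opposite sign, through the source; this
is the integrand for the fundamental theorem of calculus in `duhamelInt_time_eq`. -/
lemma hasDerivAt_spatialInt_time (hμ : -1 < μ) (t : ℝ) {τ x : ℝ} (hτ : 0 < τ) (hx : 0 < x) :
    HasDerivAt (fun τ => spatialInt (besselHeatKernel μ) c d F τ (t - τ) x)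
      (spatialInt (besselHeatKernelDt μ) c d F τ (t - τ) x -
        spatialInt (besselHeatKernel μ) c d Fs τ (t - τ) x) τ := by
  have hK := continuousKernel_besselHeatKernel hμ
  have hKt := continuousKernel_besselHeatKernelDt hμ
  have hFc : ∀ τ, Continuous fun y => F (t - τ, y) := fun τ => h.continuous.comp (by fun_prop)
  have hFsc : ∀ τ, Continuous fun y => Fs (t - τ, y) := fun τ =>
    h.continuous_time.comp (by fun_prop)
  have key := hasDerivAt_setIntegral_mul
    (k := fun τ y => (besselHeatKernel μ τ x y : ℂ) * F (t - τ, y))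
    (k' := fun τ y => (besselHeatKernelDt μ τ x y : ℂ) * F (t - τ, y) +
      (besselHeatKernel μ τ x y : ℂ) * (-Fs (t - τ, y))) (g := fun _ => 1) (x₀ := τ)
    (isCompact_Icc (a := c) (b := d)) (by simp [IntegrableOn]) ?_ ?_ ?_
  · simp only [mul_one] at key
    unfold spatialInt
    simp only [Complex.real_smul]
    refine key.congr_deriv ?_
    rw [← integral_sub]
    · refine integral_congr_ae (Eventually.of_forall fun y => ?_)
      simp only
      ring
    · exact ContinuousOn.integrableOn_compact isCompact_Icc ((Complex.continuous_ofReal.comp_continuousOn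
        (hKt.continuousOn h.pos hτ hx)).mul (hFc τ).continuousOn)
    · exact ContinuousOn.integrableOn_compact isCompact_Icc ((Complex.continuous_ofReal.comp_continuousOn
        (hK.continuousOn h.pos hτ hx)).mul (hFsc τ).continuousOn)
  · filter_upwards [lt_mem_nhds hτ] with σ hσ
    exact (Complex.continuous_ofReal.comp_continuousOn (hK.continuousOn h.pos hσ hx)).mul
      (hFc σ).continuousOn
  · intro y hy
    have hy0 := h.pos.trans_le hy.1
    have e1 : ContinuousAt (fun q : ℝ × ℝ => (besselHeatKernel μ q.1 x q.2 : ℂ)) (τ, y) :=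
      Complex.continuous_ofReal.continuousAt.comp
        (hK.comp (X := fun _ => x) continuousAt_fst continuousAt_const continuousAt_snd hτ hx hy0)
    have e2 : ContinuousAt (fun q : ℝ × ℝ => (besselHeatKernelDt μ q.1 x q.2 : ℂ)) (τ, y) :=
      Complex.continuous_ofReal.continuousAt.comp
        (hKt.comp (X := fun _ => x) continuousAt_fst continuousAt_const continuousAt_snd hτ hx hy0)
    have e3 : Continuous (fun q : ℝ × ℝ => F (t - q.1, q.2)) := h.continuous.comp (by fun_prop)
    have e4 : Continuous (fun q : ℝ × ℝ => Fs (t - q.1, q.2)) :=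
      h.continuous_time.comp (by fun_prop)
    exact (e2.mul e3.continuousAt).add (e1.mul e4.neg.continuousAt)
  · filter_upwards [lt_mem_nhds hτ] with σ hσ y hy
    have hF : HasDerivAt (fun σ => F (t - σ, y)) (-Fs (t - σ, y)) σ :=
      (h.hasDerivAt_time (t - σ) y).comp_const_sub t σ
    exact (hasDerivAt_besselHeatKernel_Dt hμ σ hσ x hx y (h.pos.trans_le hy.1)).ofReal_comp.mul hF

end IsBesselSource

/-- On a compact interval away from zero, bounded data satisfy the growth condition in terms of
`y^{μ+1/2}` required by the approximate identity. -/
lemma exists_le_mul_rpow {c : ℝ} (hc : 0 < c) (d a B : ℝ) :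
    ∃ M, 0 ≤ M ∧ ∀ y ∈ Icc c d, B ≤ M * y ^ a := by
  obtain ⟨M, hM⟩ := (isCompact_Icc (a := c) (b := d)).exists_bound_of_continuousOn
    (f := fun y : ℝ => B * y ^ (-a)) (continuousOn_const.mul (continuousOn_id.rpow_const
      fun y hy => Or.inl (hc.trans_le hy.1).ne'))
  refine ⟨max M 0, le_max_right _ _, fun y hy => ?_⟩
  have hy0 : 0 < y := hc.trans_le hy.1
  have h1 : B * y ^ (-a) ≤ max M 0 := ((le_abs_self _).trans (hM y hy)).trans (le_max_left _ _)
  have h2 : y ^ (-a) * y ^ a = 1 := by rw [← Real.rpow_add hy0]; simp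
  calc B = B * y ^ (-a) * y ^ a := by rw [mul_assoc, h2, mul_one]
    _ ≤ _ := by gcongr

namespace IsBesselSource

variable {μ c d B S : ℝ} {F Fs F₁ F₂ : ℝ × ℝ → ℂ} (h : IsBesselSource c d B F Fs F₁ F₂)

include h

lemma setIntegral_Ioi (κ : ℝ → ℝ → ℝ → ℝ) (τ s x : ℝ) :
    ∫ y in Ioi (0 : ℝ), κ τ x y • F (s, y) = spatialInt κ c d F τ s x := by
  refine setIntegral_eq_of_subset_of_forall_sdiff_eq_zero measurableSet_Ioi
    (fun y hy => h.pos.trans_le hy.1) fun y hy => ?_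
  rw [h.eq_zero s y fun h1 => hy.2 (Ioo_subset_Icc_self h1), smul_zero]

/-- With the source frozen at time `t` this is the approximate identity. The error of freezing is at
most `Bτ` pointwise, hence `O(√τ)` after the kernel bound `O(τ^{-1/2})`. -/
lemma tendsto_spatialInt (hμ : -1 < μ) (t : ℝ) {x : ℝ} (hx : 0 < x) :
    Tendsto (fun τ => spatialInt (besselHeatKernel μ) c d F τ (t - τ) x) (𝓝[>] 0)
      (𝓝 (F (t, x))) := by
  have hFc : ∀ s, Continuous fun y => F (s, y) := fun s => h.continuous.comp (by fun_prop)
  have hB0 : 0 ≤ B := (norm_nonneg _).trans (h.bound (0, 0))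
  have h1 : Tendsto (fun τ => spatialInt (besselHeatKernel μ) c d F τ t x) (𝓝[>] 0)
      (𝓝 (F (t, x))) := by
    obtain ⟨M, hM0, hM⟩ := exists_le_mul_rpow h.pos d (μ + 1 / 2) B
    simp_rw [← h.setIntegral_Ioi (besselHeatKernel μ)]
    refine tendsto_integral_besselHeatKernel_smul hμ (M := M) (hFc t).aestronglyMeasurable ?_ hx
      (tendsto_average_norm_sub_of_continuousAt (hFc t).continuousAt)
    filter_upwards [ae_restrict_mem measurableSet_Ioi] with y hy
    have hy : 0 < y := hy
    by_cases hy' : y ∈ Ioo c d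
    · exact (h.bound _).trans (hM y (Ioo_subset_Icc_self hy'))
    · rw [h.eq_zero t y hy', norm_zero]; positivity
  obtain ⟨C, hC, hCb⟩ := exists_norm_setIntegral_besselHeatKernel_le hμ h.pos h.le hx one_pos
  have h2 : Tendsto (fun τ => spatialInt (besselHeatKernel μ) c d F τ (t - τ) x -
      spatialInt (besselHeatKernel μ) c d F τ t x) (𝓝[>] 0) (𝓝 0) := by
    have hs : Tendsto (fun τ : ℝ => C * B * Real.sqrt τ) (𝓝[>] 0) (𝓝 0) := by
      have : Tendsto (fun τ : ℝ => C * B * Real.sqrt τ) (𝓝 0) (𝓝 (C * B * Real.sqrt 0)) :=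
        (Real.continuous_sqrt.const_mul _).tendsto 0
      rw [Real.sqrt_zero, mul_zero] at this
      exact this.mono_left nhdsWithin_le_nhds
    refine squeeze_zero_norm' ?_ hs
    filter_upwards [Ioo_mem_nhdsGT one_pos] with τ hτ
    have hK := (continuousKernel_besselHeatKernel hμ).continuousOn (d := d) h.pos hτ.1 hx
    have hdiff : spatialInt (besselHeatKernel μ) c d F τ (t - τ) x -
        spatialInt (besselHeatKernel μ) c d F τ t x =
        ∫ y in Icc c d, besselHeatKernel μ τ x y • (F (t - τ, y) - F (t, y)) := by
      unfold spatialInt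
      rw [← integral_sub]
      · simp only [smul_sub]
      · exact (hK.smul (hFc _).continuousOn).integrableOn_compact isCompact_Icc
      · exact (hK.smul (hFc _).continuousOn).integrableOn_compact isCompact_Icc
    rw [hdiff]
    refine (hCb τ hτ.1 hτ.2.le x le_rfl _ (B * τ) fun y _ => ?_).trans (le_of_eq ?_)
    · have := convex_univ.norm_image_sub_le_of_norm_hasDerivWithin_le
        (fun s (_ : s ∈ univ) => (h.hasDerivAt_time s y).hasDerivWithinAt)
        (fun s _ => h.bound_time (s, y)) (mem_univ t) (mem_univ (t - τ))
      simpa [abs_of_pos hτ.1] using this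
    · have hsq : Real.sqrt τ * Real.sqrt τ = τ := Real.mul_self_sqrt hτ.1.le
      have hs0 := (Real.sqrt_pos.2 hτ.1).ne'
      field_simp
      rw [sq, hsq]
  have h3 := h2.add h1
  rw [zero_add] at h3
  simpa only [sub_add_cancel] using h3

/-- The fundamental theorem of calculus for `τ ↦ ∫ W_τ F(t-τ) dy` on `(0,t)`: the limit at `0` is
`F(t,x)`, and at `τ = t` the source vanishes. -/
lemma duhamelInt_time_eq (hμ : -1 < μ) {t x : ℝ} (ht : 0 < t) (htS : t ≤ S) (hx : 0 < x) :
    duhamelInt (besselHeatKernel μ) c d Fs S t x =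
      duhamelInt (besselHeatKernelDt μ) c d F S t x + F (t, x) := by
  have hS := ht.trans_le htS
  rw [duhamelInt_eq_setIntegral _ c d h.eq_zero_time_of_nonpos htS,
    duhamelInt_eq_setIntegral _ c d h.eq_zero_of_nonpos htS]
  have hi1 := (h.timeBounded_Dt hμ ht).integrableOn (continuousKernel_besselHeatKernelDt hμ) h.pos
    h.continuous t hx
  have hi2 := (timeBounded_besselHeatKernel hμ h.pos h.le ht h.bound_time).integrableOn
    (continuousKernel_besselHeatKernel hμ) h.pos h.continuous_time t hx
  have hend : Tendsto (fun τ => spatialInt (besselHeatKernel μ) c d F τ (t - τ) x) (𝓝[<] t)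
      (𝓝 0) := by
    have := (h.hasDerivAt_spatialInt_time hμ t ht hx).continuousAt.tendsto
    have h0 : spatialInt (besselHeatKernel μ) c d F t (t - t) x = 0 := by
      simp [spatialInt, h.eq_zero_of_nonpos 0 le_rfl]
    rw [h0] at this
    exact this.mono_left nhdsWithin_le_nhds
  have key := intervalIntegral.integral_eq_sub_of_hasDerivAt_of_tendsto ht
    (fun τ hτ => h.hasDerivAt_spatialInt_time hμ t hτ.1 hx)
    ((intervalIntegrable_iff_integrableOn_Ioc_of_le ht.le).2 (hi1.sub hi2))
    (h.tendsto_spatialInt hμ t hx) hend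
  rw [intervalIntegral.integral_of_le ht.le, integral_sub hi1 hi2] at key
  linear_combination -key

end IsBesselSource

/-! ### Truncated integrals -/

lemma tendsto_intervalIntegral_truncate_left {w : ℝ → ℂ} {t : ℝ} (ht : 0 < t)
    (hw : IntervalIntegrable w volume 0 t) :
    Tendsto (fun ε => ∫ τ in ε..t, w τ) (𝓝[>] 0) (𝓝 (∫ τ in (0 : ℝ)..t, w τ)) := by
  have hc := intervalIntegral.continuousOn_primitive_interval' hw right_mem_uIcc
  have h0 := (hc 0 left_mem_uIcc).neg
  rw [uIcc_of_le ht.le] at h0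
  have h1 := h0.tendsto.mono_left (nhdsWithin_le_of_mem (Icc_mem_nhdsGT ht))
  have he : (-fun b => ∫ τ in t..b, w τ) = fun b => ∫ τ in b..t, w τ :=
    funext fun b => (intervalIntegral.integral_symm t b).symm
  rwa [he] at h1

lemma tendsto_intervalIntegral_truncate_right {w : ℝ → ℂ} {t : ℝ} (ht : 0 < t)
    (hw : IntervalIntegrable w volume 0 t) :
    Tendsto (fun ε => ∫ τ in (0 : ℝ)..(t - ε), w τ) (𝓝[>] 0) (𝓝 (∫ τ in (0 : ℝ)..t, w τ)) := by
  have hc := intervalIntegral.continuousOn_primitive_interval' hw left_mem_uIcc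
  have h0 := hc t right_mem_uIcc
  rw [uIcc_of_le ht.le] at h0
  refine h0.tendsto.comp (tendsto_nhdsWithin_iff.2 ⟨?_, ?_⟩)
  · have : Tendsto (fun ε : ℝ => t - ε) (𝓝 0) (𝓝 (t - 0)) :=
      (continuous_const.sub continuous_id).tendsto 0
    rw [sub_zero] at this
    exact this.mono_left nhdsWithin_le_nhds
  · filter_upwards [Ioo_mem_nhdsGT ht] with ε hε
    exact ⟨by linarith [hε.2], by linarith [hε.1]⟩

namespace IsBesselSource

variable {μ c d B S : ℝ} {F Fs F₁ F₂ : ℝ × ℝ → ℂ} (h : IsBesselSource c d B F Fs F₁ F₂)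

include h

lemma intervalIntegral_eq_duhamelInt {f : ℝ × ℝ → ℂ} (hf : ∀ p ∈ quadrant, f p = F p)
    (κ : ℝ → ℝ → ℝ → ℝ) {t : ℝ} (ht : 0 < t) (htS : t ≤ S) (x : ℝ) :
    ∫ τ in (0 : ℝ)..t, ∫ y in Ioi (0 : ℝ), κ τ x y • f (t - τ, y) =
      duhamelInt κ c d F S t x := by
  rw [duhamelInt_eq_setIntegral _ c d h.eq_zero_of_nonpos htS,
    intervalIntegral.integral_of_le ht.le, integral_Ioc_eq_integral_Ioo,
    integral_Ioc_eq_integral_Ioo]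
  refine setIntegral_congr_fun measurableSet_Ioo fun τ hτ => ?_
  rw [← h.setIntegral_Ioi]
  refine setIntegral_congr_fun measurableSet_Ioi fun y hy => ?_
  rw [hf (t - τ, y) ⟨sub_pos.2 hτ.2, hy⟩]

/-- The inner integrals are already integrable up to `τ = 0`, so both truncations converge to the
full integral by continuity of the primitive. Joint absolute convergence is asserted only for `τ >
ε`, where the kernel is continuous on a compact rectangle. -/
lemma hasTruncatedLimit {f : ℝ × ℝ → ℂ} (hf : ∀ p ∈ quadrant, f p = F p)
    {κ : ℝ → ℝ → ℝ → ℝ} (hκ : ContinuousKernel κ) (hT : TimeBounded κ c d F S) {t x : ℝ}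
    (ht : 0 < t) (htS : t ≤ S) (hx : 0 < x) :
    HasTruncatedLimit κ f t x (duhamelInt κ c d F S t x) := by
  have hsub : Icc c d ⊆ Ioi (0 : ℝ) := fun y hy => h.pos.trans_le hy.1
  have hinner : ∀ τ ∈ Ioo 0 t, ∫ y in Ioi (0 : ℝ), κ τ x y • f (t - τ, y) =
      spatialInt κ c d F τ (t - τ) x := by
    intro τ hτ
    rw [← h.setIntegral_Ioi]
    refine setIntegral_congr_fun measurableSet_Ioi fun y hy => ?_
    rw [hf (t - τ, y) ⟨sub_pos.2 hτ.2, hy⟩]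
  have hint : IntegrableOn (fun τ => ∫ y in Ioi (0 : ℝ), κ τ x y • f (t - τ, y)) (Ioo 0 t) := by
    refine IntegrableOn.congr_fun ?_ (fun τ hτ => (hinner τ hτ).symm) measurableSet_Ioo
    exact (hT.integrableOn hκ h.pos h.continuous t hx).mono_set
      (Ioo_subset_Ioc_self.trans (Ioc_subset_Ioc_right htS))
  have hii : IntervalIntegrable (fun τ => ∫ y in Ioi (0 : ℝ), κ τ x y • f (t - τ, y)) volume 0 t :=
    (intervalIntegrable_iff_integrableOn_Ioo_of_le ht.le).2 hint
  rw [← h.intervalIntegral_eq_duhamelInt hf κ ht htS x]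
  refine ⟨fun τ hτ => ?_, fun ε hε => ?_, hint, tendsto_intervalIntegral_truncate_left ht hii,
    tendsto_intervalIntegral_truncate_right ht hii⟩
  · have h1 : IntegrableOn (fun y => κ τ x y • F (t - τ, y)) (Icc c d) :=
      ((hκ.continuousOn h.pos hτ.1 hx).smul
        (h.continuous.comp (by fun_prop : Continuous fun y : ℝ => (t - τ, y))).continuousOn
        ).integrableOn_compact isCompact_Icc
    refine (h1.of_forall_sdiff_eq_zero measurableSet_Ioi fun y hy => ?_).congr_fun
      (fun y hy => ?_) measurableSet_Ioi
    · rw [h.eq_zero _ y fun h2 => hy.2 (Ioo_subset_Icc_self h2), smul_zero]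
    · simp only
      rw [hf (t - τ, y) ⟨sub_pos.2 hτ.2, hy⟩]
  · have h1 : IntegrableOn (fun p : ℝ × ℝ => κ p.1 x p.2 • F (t - p.1, p.2))
        (Icc ε t ×ˢ Icc c d) := by
      refine ContinuousOn.integrableOn_compact (isCompact_Icc.prod isCompact_Icc) ?_
      have e1 : ContinuousOn (fun p : ℝ × ℝ => κ p.1 x p.2) (Icc ε t ×ˢ Icc c d) := fun p hp =>
        (hκ.comp (X := fun _ => x) continuousAt_fst continuousAt_const continuousAt_snd
          (hε.1.trans_le hp.1.1) hx (h.pos.trans_le hp.2.1)).continuousWithinAt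
      have e2 : Continuous (fun p : ℝ × ℝ => F (t - p.1, p.2)) := h.continuous.comp (by fun_prop)
      exact e1.smul e2.continuousOn
    have h2 := h1.mono_set (prod_mono (Ioo_subset_Icc_self (a := ε) (b := t)) (subset_refl (Icc c d)))
    refine (h2.of_forall_sdiff_eq_zero (measurableSet_Ioo.prod measurableSet_Ioi)
      fun p hp => ?_).congr_fun (fun p hp => ?_) (measurableSet_Ioo.prod measurableSet_Ioi)
    · rw [h.eq_zero _ p.2 fun h2 => hp.2 ⟨hp.1.1, Ioo_subset_Icc_self h2⟩, smul_zero]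
    · simp only
      rw [hf (t - p.1, p.2) ⟨sub_pos.2 hp.1.2, hp.2⟩]

end IsBesselSource

/-! ### Compactly supported bounded data -/

lemma MeasureTheory.MemLp.exists_ae_norm_le {α E : Type*} [MeasurableSpace α]
    [NormedAddCommGroup E] {ν : Measure α} {f : α → E} (hf : MemLp f ⊤ ν) :
    ∃ M, 0 ≤ M ∧ ∀ᵐ x ∂ν, ‖f x‖ ≤ M := by
  have hlt : eLpNormEssSup f ν < ⊤ := by simpa using hf.2
  refine ⟨(eLpNormEssSup f ν).toReal, ENNReal.toReal_nonneg, ?_⟩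
  filter_upwards [ae_le_eLpNormEssSup (f := f) (μ := ν)] with x hx
  have := ENNReal.toReal_mono hlt.ne hx
  simpa using this

lemma exists_Icc_of_isCompact_Ioi {K : Set ℝ} (hK : IsCompact K) (hsub : K ⊆ Ioi 0) :
    ∃ c d, 0 < c ∧ c < d ∧ K ⊆ Ioo c d := by
  obtain ⟨c, hc, hcK⟩ := hK.exists_forall_le' continuousOn_id (a := 0) fun y hy => hsub hy
  obtain ⟨d, hd⟩ := hK.bddAbove
  -- Halving and adding one leave `K` inside the open interval; the maximum keeps the endpoints
  -- ordered even when `K` is empty.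
  refine ⟨c / 2, max d c + 1, by positivity, ?_, fun y hy => ⟨?_, ?_⟩⟩
  · have := le_max_right d c; linarith
  · have : c ≤ y := hcK y hy
    linarith
  · have h1 := hd hy
    have := le_max_left d c; linarith

lemma exists_Icc_of_isCompact_quadrant {K : Set (ℝ × ℝ)} (hK : IsCompact K)
    (hsub : K ⊆ quadrant) :
    ∃ c d s₀, 0 < c ∧ c < d ∧ 0 < s₀ ∧ K ⊆ Ioi s₀ ×ˢ Ioo c d := by
  obtain ⟨c, d, hc, hcd, h1⟩ := exists_Icc_of_isCompact_Ioi (hK.image continuous_snd)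
    (by rintro _ ⟨p, hp, rfl⟩; exact (hsub hp).2)
  obtain ⟨s₀, s₁, hs₀, -, h2⟩ := exists_Icc_of_isCompact_Ioi (hK.image continuous_fst)
    (by rintro _ ⟨p, hp, rfl⟩; exact (hsub hp).1)
  exact ⟨c, d, s₀, hc, hcd, hs₀, fun p hp =>
    ⟨(h2 (mem_image_of_mem _ hp)).1, h1 (mem_image_of_mem _ hp)⟩⟩

lemma HasCompactSupportIn.exists_ae_eq_zero {g : ℝ → ℂ} (hgc : HasCompactSupportIn g (Ioi 0)) :
    ∃ c d, 0 < c ∧ c < d ∧ ∀ᵐ y ∂(volume.restrict (Ioi (0 : ℝ))), y ∉ Icc c d → g y = 0 := by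
  obtain ⟨K, hK, hKc, hg⟩ := hgc
  obtain ⟨c, d, hc, hcd, hsub⟩ := exists_Icc_of_isCompact_Ioi hKc hK
  refine ⟨c, d, hc, hcd, ?_⟩
  filter_upwards [hg] with y hy h1
  exact hy fun h2 => h1 (Ioo_subset_Icc_self (hsub h2))

section InitialDatum

variable {κ : ℝ → ℝ → ℝ → ℝ} {g : ℝ → ℂ} {c d : ℝ}

lemma integrableOn_Icc_of_memLp_top (hg : MemLp g ⊤ (volume.restrict (Ioi 0))) (hc : 0 < c) :
    IntegrableOn g (Icc c d) := by
  obtain ⟨M, -, hM⟩ := hg.exists_ae_norm_le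
  have hsub : Icc c d ⊆ Ioi (0 : ℝ) := fun y hy => hc.trans_le hy.1
  refine Integrable.mono' (g := fun _ => M) (by simp)
    (hg.1.mono_set hsub) ?_
  exact ae_restrict_of_ae_restrict_of_subset hsub hM

lemma ContinuousKernel.integrableOn_smul (hκ : ContinuousKernel κ)
    (hg : MemLp g ⊤ (volume.restrict (Ioi 0))) (hc : 0 < c)
    (hg0 : ∀ᵐ y ∂(volume.restrict (Ioi (0 : ℝ))), y ∉ Icc c d → g y = 0) {t x : ℝ} (ht : 0 < t)
    (hx : 0 < x) : IntegrableOn (fun y => κ t x y • g y) (Ioi 0) := by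
  have h1 : IntegrableOn (fun y => κ t x y • g y) (Icc c d) :=
    (integrableOn_Icc_of_memLp_top hg hc).continuousOn_smul (hκ.continuousOn hc ht hx) isCompact_Icc
  refine h1.of_ae_sdiff_eq_zero measurableSet_Ioi.nullMeasurableSet ?_
  filter_upwards [(ae_restrict_iff' measurableSet_Ioi).1 hg0] with y hy hy'
  rw [hy hy'.1 hy'.2, smul_zero]

lemma setIntegral_Ioi_smul_eq (κ : ℝ → ℝ → ℝ → ℝ) (hc : 0 < c)
    (hg0 : ∀ᵐ y ∂(volume.restrict (Ioi (0 : ℝ))), y ∉ Icc c d → g y = 0) (t x : ℝ) :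
    ∫ y in Ioi (0 : ℝ), κ t x y • g y = ∫ y in Icc c d, κ t x y • g y := by
  refine setIntegral_eq_of_subset_of_ae_sdiff_eq_zero measurableSet_Ioi.nullMeasurableSet
    (fun y hy => hc.trans_le hy.1) ?_
  filter_upwards [(ae_restrict_iff' measurableSet_Ioi).1 hg0] with y hy hy'
  rw [hy hy'.1 hy'.2, smul_zero]

end InitialDatum

/-- For a merely bounded source the dominating function is the product of `C τ^{-1/2}` and `M` times
the indicator of `[c,d]`. The almost-everywhere bounds on `f` are transported by the
measure-preserving map `τ ↦ t - τ`. -/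
lemma integrableOn_besselHeatKernel_smul_source {μ : ℝ} (hμ : -1 < μ) {f : ℝ × ℝ → ℂ}
    (hf : MemLp f ⊤ (volume.restrict quadrant)) (hfc : HasCompactSupportIn f quadrant) {t x : ℝ}
    (ht : 0 < t) (hx : 0 < x) :
    IntegrableOn (fun p : ℝ × ℝ => besselHeatKernel μ p.1 x p.2 • f (t - p.1, p.2))
      (Ioo 0 t ×ˢ Ioi 0) := by
  obtain ⟨K, hKq, hKc, hf0⟩ := hfc
  obtain ⟨c, d, s₀, hc, hcd, hs₀, hK⟩ := exists_Icc_of_isCompact_quadrant hKc hKq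
  obtain ⟨M, hM0, hM⟩ := hf.exists_ae_norm_le
  obtain ⟨C, hC, hCK⟩ := exists_besselHeatKernel_le hμ (lt_min hx hc) ht
  have hquad : MeasurableSet quadrant := measurableSet_Ioi.prod measurableSet_Ioi
  have hmp : MeasurePreserving (fun p : ℝ × ℝ => (t - p.1, p.2)) volume volume :=
    (Measure.measurePreserving_sub_left volume t).prod (MeasurePreserving.id volume)
  have hmp' := hmp.restrict_preimage hquad
  have hsub : Ioo 0 t ×ˢ Ioi 0 ⊆ (fun p : ℝ × ℝ => (t - p.1, p.2)) ⁻¹' quadrant := fun p hp =>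
    ⟨sub_pos.2 hp.1.2, hp.2⟩
  have hmeas : MeasurableSet (Ioo 0 t ×ˢ Ioi (0 : ℝ)) := measurableSet_Ioo.prod measurableSet_Ioi
  have hfm : AEStronglyMeasurable (fun p : ℝ × ℝ => f (t - p.1, p.2))
      (volume.restrict (Ioo 0 t ×ˢ Ioi 0)) :=
    (hf.1.comp_measurePreserving hmp').mono_set hsub
  have hKm : AEStronglyMeasurable (fun p : ℝ × ℝ => besselHeatKernel μ p.1 x p.2)
      (volume.restrict (Ioo 0 t ×ˢ Ioi 0)) :=
    ContinuousOn.aestronglyMeasurable (fun p hp => ((continuousKernel_besselHeatKernel hμ).comp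
      (X := fun _ => x) continuousAt_fst continuousAt_const continuousAt_snd hp.1.1 hx
      hp.2).continuousWithinAt) hmeas
  have hbd : Integrable (fun p : ℝ × ℝ => (C * (Real.sqrt p.1)⁻¹) *
      (Icc c d).indicator (fun _ => M) p.2) (volume.restrict (Ioo 0 t ×ˢ Ioi 0)) := by
    rw [Measure.volume_eq_prod, ← Measure.prod_restrict]
    refine Integrable.mul_prod (f := fun τ : ℝ => C * (Real.sqrt τ)⁻¹) ?_ ?_
    · exact ((integrableOn_inv_sqrt t).mono_set Ioo_subset_Ioc_self).const_mul C
    · refine Integrable.restrict (IntegrableOn.integrable_indicator ?_ measurableSet_Icc)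
      simp [IntegrableOn]
  refine hbd.mono' (hKm.smul hfm) ?_
  have hae := ae_restrict_of_ae_restrict_of_subset hsub
    (hmp'.quasiMeasurePreserving.ae (hM.and hf0))
  filter_upwards [hae, ae_restrict_mem hmeas] with p hp hpm
  have hK0 := besselHeatKernel_pos hμ hpm.1.1 hx hpm.2
  rw [norm_smul, Real.norm_of_nonneg hK0.le]
  by_cases hy : p.2 ∈ Icc c d
  · rw [indicator_of_mem hy]
    have h1 := hCK p.1 hpm.1.1 hpm.1.2.le x (min_le_left _ _) p.2 ((min_le_right _ _).trans hy.1)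
    have h2 : Real.exp (-(x - p.2) ^ 2 / (4 * p.1)) ≤ 1 := by
      rw [Real.exp_le_one_iff, neg_div]
      have h0 : 0 < p.1 := hpm.1.1
      have : 0 ≤ (x - p.2) ^ 2 / (4 * p.1) := by positivity
      linarith
    have h3 : besselHeatKernel μ p.1 x p.2 ≤ C * (Real.sqrt p.1)⁻¹ := by
      refine h1.trans (mul_le_mul_of_nonneg_left ?_ hC.le)
      exact mul_le_of_le_one_right (by positivity) h2
    exact mul_le_mul h3 hp.1 (norm_nonneg _) (by positivity)
  · rw [indicator_of_notMem hy, mul_zero, hp.2 fun hmem => hy (Ioo_subset_Icc_self (hK hmem).2),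
      norm_zero, mul_zero]

lemma isOpen_quadrant : IsOpen quadrant := isOpen_Ioi.prod isOpen_Ioi

lemma exists_isBesselSource {f : ℝ × ℝ → ℂ} (hfc : HasCompactSupportIn f quadrant)
    (hf : ContDiffOn ℝ 2 f quadrant) :
    ∃ (c d B : ℝ) (F Fs F₁ F₂ : ℝ × ℝ → ℂ),
      IsBesselSource c d B F Fs F₁ F₂ ∧ ∀ p ∈ quadrant, f p = F p := by
  obtain ⟨K, hKq, hKc, hf0⟩ := hfc
  obtain ⟨c, d, s₀, hc, hcd, hs₀, hK⟩ := exists_Icc_of_isCompact_quadrant hKc hKq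
  -- The support condition holds only almost everywhere; continuity on the open set off `K` makes it
  -- hold everywhere there. The extension by zero is then `C²` on the plane.
  have hfz : EqOn f 0 (quadrant \ K) := by
    refine Measure.eqOn_open_of_ae_eq (μ := volume) ?_ (isOpen_quadrant.sdiff hKc.isClosed)
      (hf.continuousOn.mono sdiff_subset) continuousOn_const
    filter_upwards [ae_restrict_of_ae_restrict_of_subset sdiff_subset hf0,
      ae_restrict_mem (isOpen_quadrant.sdiff hKc.isClosed).measurableSet] with p hp hpm
    exact hp hpm.2
  set F : ℝ × ℝ → ℂ := quadrant.indicator f with hF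
  have hFf : ∀ p ∈ quadrant, f p = F p := fun p hp => (indicator_of_mem hp f).symm
  have hF0 : ∀ p ∉ K, F p = 0 := by
    intro p hp
    by_cases hq : p ∈ quadrant
    · rw [← hFf p hq]; exact hfz ⟨hq, hp⟩
    · exact indicator_of_notMem hq f
  have hFev : ∀ p ∉ K, F =ᶠ[𝓝 p] fun _ => 0 := fun p hp => by
    filter_upwards [hKc.isClosed.isOpen_compl.mem_nhds hp] with q hq using hF0 q hq
  have hFC : ContDiff ℝ 2 F := by
    rw [contDiff_iff_contDiffAt]
    intro p
    by_cases hq : p ∈ quadrant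
    · refine (hf.contDiffAt (isOpen_quadrant.mem_nhds hq)).congr_of_eventuallyEq ?_
      filter_upwards [isOpen_quadrant.mem_nhds hq] with q hq using (hFf q hq).symm
    · exact contDiffAt_const.congr_of_eventuallyEq (hFev p fun hp => hq (hKq hp))
  have hcs : HasCompactSupport F := HasCompactSupport.intro hKc hF0
  set Fs : ℝ × ℝ → ℂ := fun p => fderiv ℝ F p (1, 0) with hFs
  set F₁ : ℝ × ℝ → ℂ := fun p => fderiv ℝ F p (0, 1) with hF₁
  set F₂ : ℝ × ℝ → ℂ := fun p => fderiv ℝ F₁ p (0, 1) with hF₂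
  have hfd : ContDiff ℝ 1 (fderiv ℝ F) := hFC.fderiv_right (by norm_num)
  have hF₁C : ContDiff ℝ 1 F₁ := hfd.clm_apply contDiff_const
  have hFsc : Continuous Fs := (hfd.clm_apply contDiff_const).continuous
  have hF₂c : Continuous F₂ := (hF₁C.continuous_fderiv one_ne_zero).clm_apply continuous_const
  have hcs₁ : HasCompactSupport F₁ :=
    (hcs.fderiv ℝ).comp_left (g := fun L : ℝ × ℝ →L[ℝ] ℂ => L (0, 1)) rfl
  have hcss : HasCompactSupport Fs :=
    (hcs.fderiv ℝ).comp_left (g := fun L : ℝ × ℝ →L[ℝ] ℂ => L (1, 0)) rfl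
  have hcs₂ : HasCompactSupport F₂ :=
    (hcs₁.fderiv ℝ).comp_left (g := fun L : ℝ × ℝ →L[ℝ] ℂ => L (0, 1)) rfl
  obtain ⟨B₀, hB₀⟩ := hFC.continuous.bounded_above_of_compact_support hcs
  obtain ⟨B₁, hB₁⟩ := hFsc.bounded_above_of_compact_support hcss
  obtain ⟨B₂, hB₂⟩ := hF₂c.bounded_above_of_compact_support hcs₂
  have hd0 : ∀ p ∉ K, fderiv ℝ F p = 0 := fun p hp => by
    rw [(hFev p hp).fderiv_eq, fderiv_fun_const]; rfl
  have hdF : ∀ p, HasFDerivAt F (fderiv ℝ F p) p := fun p =>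
    (hFC.differentiable two_ne_zero p).hasFDerivAt
  have hdF₁ : ∀ p, HasFDerivAt F₁ (fderiv ℝ F₁ p) p := fun p =>
    (hF₁C.differentiable one_ne_zero p).hasFDerivAt
  have hy : ∀ s y : ℝ, HasDerivAt (fun y => (s, y)) ((0 : ℝ), (1 : ℝ)) y := fun s y =>
    (hasDerivAt_const y s).prodMk (hasDerivAt_id y)
  have hs : ∀ s y : ℝ, HasDerivAt (fun s => (s, y)) ((1 : ℝ), (0 : ℝ)) s := fun s y =>
    (hasDerivAt_id s).prodMk (hasDerivAt_const s y)
  have hyK : ∀ s, ∀ y ∉ Ioo c d, (s, y) ∉ K := fun s y h1 h2 => h1 (hK h2).2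
  have hsK : ∀ s ≤ 0, ∀ y, (s, y) ∉ K := fun s h1 y h2 =>
    (hs₀.trans ((hK h2).1 : s₀ < s)).not_ge h1
  refine ⟨c, d, max B₀ (max B₁ B₂), F, Fs, F₁, F₂, ⟨hc, hcd.le, hFC.continuous, hFsc, hF₂c,
    fun p => (hB₀ p).trans (le_max_left _ _),
    fun p => (hB₁ p).trans ((le_max_left _ _).trans (le_max_right _ _)),
    fun p => (hB₂ p).trans ((le_max_right _ _).trans (le_max_right _ _)),
    fun s y => HasFDerivAt.comp_hasDerivAt (l := F) s (hdF (s, y)) (hs s y),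
    fun s y => HasFDerivAt.comp_hasDerivAt (l := F) y (hdF (s, y)) (hy s y),
    fun s y => HasFDerivAt.comp_hasDerivAt (l := F₁) y (hdF₁ (s, y)) (hy s y),
    fun s y h => hF0 _ (hyK s y h), fun s y h => ?_, fun s h y => hF0 _ (hsK s h y),
    fun s h y => ?_⟩, hFf⟩
  · simp only [hF₁]; rw [hd0 _ (hyK s y h)]; rfl
  · simp only [hFs]; rw [hd0 _ (hsK s h y)]; rfl

lemma tendsto_integral_besselHeatKernel_smul_of_memLp_top {μ : ℝ} (hμ : -1 < μ) {g : ℝ → ℂ}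
    (hg : MemLp g ⊤ (volume.restrict (Ioi 0))) {c d : ℝ} (hc : 0 < c)
    (hg0 : ∀ᵐ y ∂(volume.restrict (Ioi (0 : ℝ))), y ∉ Icc c d → g y = 0) {x : ℝ} (hx : 0 < x)
    (hL : Tendsto (fun r => r⁻¹ * ∫ y in Metric.closedBall x r, ‖g y - g x‖) (𝓝[>] 0) (𝓝 0)) :
    Tendsto (fun t => ∫ y in Ioi (0 : ℝ), besselHeatKernel μ t x y • g y) (𝓝[>] 0)
      (𝓝 (g x)) := by
  obtain ⟨B, -, hB⟩ := hg.exists_ae_norm_le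
  obtain ⟨M, hM0, hM⟩ := exists_le_mul_rpow hc d (μ + 1 / 2) B
  refine tendsto_integral_besselHeatKernel_smul hμ (M := M) hg.1 ?_ hx hL
  filter_upwards [hB, hg0, ae_restrict_mem measurableSet_Ioi] with y h1 h2 hy
  have hy : 0 < y := hy
  by_cases hy' : y ∈ Icc c d
  · exact h1.trans (hM y hy')
  · rw [h2 hy', norm_zero]; positivity

/-! ### Derivatives, differential equation and initial value of the solution. -/

section Solution

variable {μ c d B c' d' : ℝ} {F Fs F₁ F₂ f : ℝ × ℝ → ℂ} {g : ℝ → ℂ}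

lemma IsBesselSource.besselDuhamel_eq (h : IsBesselSource c d B F Fs F₁ F₂)
    (hf : ∀ p ∈ quadrant, f p = F p) (hc' : 0 < c')
    (hg0 : ∀ᵐ y ∂(volume.restrict (Ioi (0 : ℝ))), y ∉ Icc c' d' → g y = 0) {S t : ℝ}
    (ht : 0 < t) (htS : t ≤ S) (x : ℝ) :
    besselDuhamel μ f g t x = duhamelInt (besselHeatKernel μ) c d F S t x +
      ∫ y in Icc c' d', besselHeatKernel μ t x y • g y := by
  rw [besselDuhamel, h.intervalIntegral_eq_duhamelInt hf _ ht htS, setIntegral_Ioi_smul_eq _ hc' hg0]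

/-- The strict inequality `t < S` is what makes the representation over `(0,S]` valid for all times
near `t`. -/
lemma IsBesselSource.hasDerivAt_besselDuhamel_time (h : IsBesselSource c d B F Fs F₁ F₂)
    (hμ : -1 < μ) (hf : ∀ p ∈ quadrant, f p = F p)
    (hg : MemLp g ⊤ (volume.restrict (Ioi 0))) (hc' : 0 < c')
    (hg0 : ∀ᵐ y ∂(volume.restrict (Ioi (0 : ℝ))), y ∉ Icc c' d' → g y = 0) {S t x : ℝ}
    (ht : 0 < t) (htS : t < S) (hx : 0 < x) :
    HasDerivAt (fun s => besselDuhamel μ f g s x) (duhamelInt (besselHeatKernel μ) c d Fs S t x +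
      ∫ y in Icc c' d', besselHeatKernelDt μ t x y • g y) t := by
  have h1 := (h.hasDerivAt_duhamelInt_time hμ (ht.trans htS) t hx).add
    ((continuousKernel_besselHeatKernel hμ).hasDerivAt_setIntegral_time
      (continuousKernel_besselHeatKernelDt hμ) (hasDerivAt_besselHeatKernel_Dt hμ) hc'
      (integrableOn_Icc_of_memLp_top hg hc' (d := d')) ht hx)
  refine h1.congr_of_eventuallyEq ?_
  filter_upwards [Ioo_mem_nhds ht htS] with s hs
  exact h.besselDuhamel_eq hf hc' hg0 hs.1 hs.2.le x

lemma IsBesselSource.hasDerivAt_besselDuhamel_space (h : IsBesselSource c d B F Fs F₁ F₂)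
    (hμ : -1 < μ) (hf : ∀ p ∈ quadrant, f p = F p)
    (hg : MemLp g ⊤ (volume.restrict (Ioi 0))) (hc' : 0 < c')
    (hg0 : ∀ᵐ y ∂(volume.restrict (Ioi (0 : ℝ))), y ∉ Icc c' d' → g y = 0) {S t x : ℝ}
    (ht : 0 < t) (htS : t ≤ S) (hx : 0 < x) :
    HasDerivAt (besselDuhamel μ f g t) (duhamelInt (besselHeatKernelDx μ) c d F S t x +
      ∫ y in Icc c' d', besselHeatKernelDx μ t x y • g y) x := by
  have hS := ht.trans_le htS
  have hd : ∀ t > 0, ∀ x > 0, ∀ y > 0,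
      HasDerivAt (fun x => besselHeatKernel μ t x y) (besselHeatKernelDx μ t x y) x :=
    fun _ ht _ hx _ hy => hasDerivAt_besselHeatKernel_space hμ ht hx hy
  have h1 := ((h.timeBounded hμ hS).hasDerivAt_duhamelInt (h.timeBounded_Dx hμ hS)
    (continuousKernel_besselHeatKernel hμ) (continuousKernel_besselHeatKernelDx hμ) hd h.pos
    h.continuous t hx).add
    ((continuousKernel_besselHeatKernel hμ).hasDerivAt_setIntegral_space
      (continuousKernel_besselHeatKernelDx hμ) hd hc'
      (integrableOn_Icc_of_memLp_top hg hc' (d := d')) ht hx)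
  exact h1.congr_of_eventuallyEq
    (Eventually.of_forall fun z => h.besselDuhamel_eq hf hc' hg0 ht htS z)

lemma IsBesselSource.hasDerivAt_deriv_besselDuhamel (h : IsBesselSource c d B F Fs F₁ F₂)
    (hμ : -1 < μ) (hf : ∀ p ∈ quadrant, f p = F p)
    (hg : MemLp g ⊤ (volume.restrict (Ioi 0))) (hc' : 0 < c')
    (hg0 : ∀ᵐ y ∂(volume.restrict (Ioi (0 : ℝ))), y ∉ Icc c' d' → g y = 0) {S t x : ℝ}
    (ht : 0 < t) (htS : t ≤ S) (hx : 0 < x) :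
    HasDerivAt (deriv (besselDuhamel μ f g t)) (duhamelInt (besselHeatKernelDxx μ) c d F S t x +
      ∫ y in Icc c' d', besselHeatKernelDxx μ t x y • g y) x := by
  have hS := ht.trans_le htS
  have h1 := ((h.timeBounded_Dx hμ hS).hasDerivAt_duhamelInt (h.timeBounded_Dxx hμ hS)
    (continuousKernel_besselHeatKernelDx hμ) (continuousKernel_besselHeatKernelDxx hμ)
    (hasDerivAt_besselHeatKernelDx_Dxx hμ) h.pos h.continuous t hx).add
    ((continuousKernel_besselHeatKernelDx hμ).hasDerivAt_setIntegral_space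
      (continuousKernel_besselHeatKernelDxx hμ) (hasDerivAt_besselHeatKernelDx_Dxx hμ) hc'
      (integrableOn_Icc_of_memLp_top hg hc' (d := d')) ht hx)
  refine h1.congr_of_eventuallyEq ?_
  filter_upwards [lt_mem_nhds hx] with z hz
  exact (h.hasDerivAt_besselDuhamel_space hμ hf hg hc' hg0 ht htS hz).deriv

lemma TimeBounded.continuousAt_duhamelInt_add {κ : ℝ → ℝ → ℝ → ℝ} {S : ℝ} {φ : ℝ × ℝ → ℂ}
    (hT : TimeBounded κ c d φ S) (hκ : ContinuousKernel κ) (hc : 0 < c) (hφ : Continuous φ)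
    {κ' : ℝ → ℝ → ℝ → ℝ} (hκ' : ContinuousKernel κ') (hc' : 0 < c')
    (hg : IntegrableOn g (Icc c' d')) {t x : ℝ} (ht : 0 < t) (hx : 0 < x) :
    ContinuousAt (fun p : ℝ × ℝ => duhamelInt κ c d φ S p.1 p.2 +
      ∫ y in Icc c' d', κ' p.1 p.2 y • g y) (t, x) := by
  refine (hT.continuousAt_duhamelInt hκ hc hφ t hx).add ?_
  have := hκ'.continuousAt_setIntegral hc' (T := Prod.fst) (X := Prod.snd) (p := (t, x))
    (Φ := fun _ _ => 1) continuousAt_fst continuousAt_snd ht hx continuous_const hg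
  simpa only [one_mul] using this

/-- The representation over `(0,S]` is available only for `t < S`; continuity being local, `S = t +
1` serves near each point. -/
lemma continuousOn_quadrant_of_eq {w : ℝ × ℝ → ℂ} {W : ℝ → ℝ × ℝ → ℂ}
    (hW : ∀ S, ∀ t > 0, ∀ x > 0, t < S → ContinuousAt (W S) (t, x))
    (hw : ∀ S, ∀ t > 0, ∀ x > 0, t < S → w (t, x) = W S (t, x)) : ContinuousOn w quadrant := by
  rintro ⟨t, x⟩ ⟨ht, hx⟩
  have ht : 0 < t := ht
  have hx : 0 < x := hx
  refine ((hW (t + 1) t ht x hx (lt_add_one t)).congr ?_).continuousWithinAt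
  filter_upwards [prod_mem_nhds (Ioo_mem_nhds ht (lt_add_one t)) (Ioi_mem_nhds hx)] with p hp
  exact (hw (t + 1) p.1 hp.1.1 p.2 hp.2 hp.1.2).symm

lemma setIntegral_besselHeatKernelDxx_smul (hμ : -1 < μ) (hc' : 0 < c')
    (hg : IntegrableOn g (Icc c' d')) {t x : ℝ} (ht : 0 < t) (hx : 0 < x) :
    ∫ y in Icc c' d', besselHeatKernelDxx μ t x y • g y =
      (∫ y in Icc c' d', besselHeatKernelDt μ t x y • g y) -
        ((1 / 4 - μ ^ 2) / x ^ 2) • ∫ y in Icc c' d', besselHeatKernel μ t x y • g y := by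
  have h1 := hg.continuousOn_smul ((continuousKernel_besselHeatKernelDt hμ).continuousOn
    (d := d') hc' ht hx) isCompact_Icc
  have h2 := hg.continuousOn_smul ((continuousKernel_besselHeatKernel hμ).continuousOn
    (d := d') hc' ht hx) isCompact_Icc
  have h3 := Integrable.fun_smul ((1 / 4 - μ ^ 2) / x ^ 2) h2
  rw [← integral_smul, ← integral_sub h1 h3]
  refine setIntegral_congr_fun measurableSet_Icc fun y hy => ?_
  rw [besselHeatKernelDxx_eq_sub hμ ht hx (hc'.trans_le hy.1), sub_smul, mul_smul]

lemma IsBesselSource.tendsto_besselDuhamel (h : IsBesselSource c d B F Fs F₁ F₂)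
    (hμ : -1 < μ) (hf : ∀ p ∈ quadrant, f p = F p) (hg : MemLp g ⊤ (volume.restrict (Ioi 0)))
    (hc' : 0 < c')
    (hg0 : ∀ᵐ y ∂(volume.restrict (Ioi (0 : ℝ))), y ∉ Icc c' d' → g y = 0) {x : ℝ} (hx : 0 < x)
    (hL : Tendsto (fun r => r⁻¹ * ∫ y in Metric.closedBall x r, ‖g y - g x‖) (𝓝[>] 0) (𝓝 0)) :
    Tendsto (fun t => besselDuhamel μ f g t x) (𝓝[>] 0) (𝓝 (g x)) := by
  have h1 := tendsto_integral_besselHeatKernel_smul_of_memLp_top hμ hg hc' hg0 hx hL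
  have h2 : Tendsto (fun t => duhamelInt (besselHeatKernel μ) c d F 1 t x) (𝓝[>] 0) (𝓝 0) := by
    -- Over the fixed interval `(0,1]` the Duhamel integral is differentiable in `t` across `t = 0`,
    -- where it vanishes.
    have hc := (h.hasDerivAt_duhamelInt_time hμ one_pos 0 hx).continuousAt.tendsto
    have h0 : duhamelInt (besselHeatKernel μ) c d F 1 0 x = 0 := by
      rw [duhamelInt_eq_setIntegral _ c d h.eq_zero_of_nonpos zero_le_one]
      simp
    rw [h0] at hc
    exact hc.mono_left nhdsWithin_le_nhds
  have h3 := h2.add h1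
  rw [zero_add] at h3
  refine h3.congr' ?_
  filter_upwards [Ioo_mem_nhdsGT one_pos] with t ht
  rw [h.besselDuhamel_eq hf hc' hg0 ht.1 ht.2.le x, setIntegral_Ioi_smul_eq _ hc' hg0]

lemma IsBesselSource.isClassicalBesselSolution (h : IsBesselSource c d B F Fs F₁ F₂)
    (hμ : -1 < μ) (hf : ∀ p ∈ quadrant, f p = F p) (hg : MemLp g ⊤ (volume.restrict (Ioi 0)))
    (hc' : 0 < c')
    (hg0 : ∀ᵐ y ∂(volume.restrict (Ioi (0 : ℝ))), y ∉ Icc c' d' → g y = 0) :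
    IsClassicalBesselSolution μ f g (besselDuhamel μ f g) := by
  have hgi : IntegrableOn g (Icc c' d') := integrableOn_Icc_of_memLp_top hg hc'
  have hK := continuousKernel_besselHeatKernel hμ
  have hKt := continuousKernel_besselHeatKernelDt hμ
  have hKx := continuousKernel_besselHeatKernelDx hμ
  have hKxx := continuousKernel_besselHeatKernelDxx hμ
  have hdt := fun (S t x : ℝ) (ht : 0 < t) (hx : 0 < x) (htS : t < S) =>
    (h.hasDerivAt_besselDuhamel_time hμ hf hg hc' hg0 ht htS hx).deriv
  have hdx := fun (S t x : ℝ) (ht : 0 < t) (hx : 0 < x) (htS : t < S) =>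
    (h.hasDerivAt_besselDuhamel_space hμ hf hg hc' hg0 ht htS.le hx).deriv
  have hdxx := fun (S t x : ℝ) (ht : 0 < t) (hx : 0 < x) (htS : t < S) =>
    (h.hasDerivAt_deriv_besselDuhamel hμ hf hg hc' hg0 ht htS.le hx).deriv
  constructor
  · exact fun t ht x hx =>
      (h.hasDerivAt_besselDuhamel_time hμ hf hg hc' hg0 ht (lt_add_one t) hx).differentiableAt
  · exact fun t ht x hx =>
      (h.hasDerivAt_besselDuhamel_space hμ hf hg hc' hg0 ht le_rfl hx).differentiableAt
  · exact fun t ht x hx =>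
      (h.hasDerivAt_deriv_besselDuhamel hμ hf hg hc' hg0 ht le_rfl hx).differentiableAt
  · exact continuousOn_quadrant_of_eq (fun S t ht x hx htS =>
      (h.timeBounded hμ (ht.trans htS)).continuousAt_duhamelInt_add hK h.pos h.continuous hK hc' hgi
        ht hx) fun S t ht x hx htS => h.besselDuhamel_eq hf hc' hg0 ht htS.le x
  · exact continuousOn_quadrant_of_eq (fun S t ht x hx htS =>
      (timeBounded_besselHeatKernel hμ h.pos h.le (ht.trans htS)
        h.bound_time).continuousAt_duhamelInt_add hK h.pos h.continuous_time hKt hc' hgi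
        ht hx) fun S t ht x hx htS => hdt S t x ht hx htS
  · exact continuousOn_quadrant_of_eq (fun S t ht x hx htS =>
      (h.timeBounded_Dx hμ (ht.trans htS)).continuousAt_duhamelInt_add hKx h.pos h.continuous hKx
        hc' hgi ht hx) fun S t ht x hx htS => hdx S t x ht hx htS
  · refine continuousOn_quadrant_of_eq (fun S t ht x hx htS =>
      (h.timeBounded_Dxx hμ (ht.trans htS)).continuousAt_duhamelInt_add hKxx h.pos h.continuous hKxx
        hc' hgi ht hx) fun S t ht x hx htS => ?_
    rw [iteratedDeriv_succ, iteratedDeriv_one]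
    exact hdxx S t x ht hx htS
  · intro t ht x hx
    have htS := lt_add_one t
    -- Both terms of `u` satisfy `Dxx = Dt - potential`; the only excess in the time derivative is
    -- the boundary term `F(t,x)`.
    rw [besselOp, iteratedDeriv_succ, iteratedDeriv_one, hdxx _ t x ht hx htS,
      hdt _ t x ht hx htS, h.besselDuhamel_eq hf hc' hg0 ht htS.le x,
      h.duhamelInt_time_eq hμ ht htS.le hx, h.duhamelInt_Dxx hμ (ht.trans htS) t hx,
      setIntegral_besselHeatKernelDxx_smul hμ hc' hgi ht hx, hf (t, x) ⟨ht, hx⟩, smul_add]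
    ring
  · filter_upwards [ae_tendsto_average_norm_sub_Ioi hg, ae_restrict_mem measurableSet_Ioi]
      with x hL hx
    exact h.tendsto_besselDuhamel hμ hf hg hc' hg0 hx hL
  · exact fun hgc x hx => h.tendsto_besselDuhamel hμ hf hg hc' hg0 hx
      (tendsto_average_norm_sub_of_continuousAt (hgc.continuousAt (Ioi_mem_nhds hx)))

end Solution

theorem theorem1p4 (μ : ℝ) (hμ : -1 < μ)
    (f : ℝ × ℝ → ℂ) (hf : MemLp f ⊤ (volume.restrict quadrant))
    (hfc : HasCompactSupportIn f quadrant)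
    (g : ℝ → ℂ) (hg : MemLp g ⊤ (volume.restrict (Ioi 0)))
    (hgc : HasCompactSupportIn g (Ioi 0)) :
    (∀ t > 0, ∀ x > 0,
      IntegrableOn (fun p : ℝ × ℝ => besselHeatKernel μ p.1 x p.2 • f (t - p.1, p.2))
        (Ioo 0 t ×ˢ Ioi 0) ∧
      IntegrableOn (fun y => besselHeatKernel μ t x y • g y) (Ioi 0)) ∧
    (ContDiffOn ℝ 2 f quadrant →
      IsClassicalBesselSolution μ f g (besselDuhamel μ f g) ∧
      ∀ t > 0, ∀ x > 0,
        (IntegrableOn (fun y => besselHeatKernelDt μ t x y • g y) (Ioi 0) ∧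
          ∃ L : ℂ, HasTruncatedLimit (besselHeatKernelDt μ) f t x L ∧
            deriv (fun s => besselDuhamel μ f g s x) t =
              L + f (t, x) + ∫ y in Ioi (0 : ℝ), besselHeatKernelDt μ t x y • g y) ∧
        (IntegrableOn (fun y => besselHeatKernelDxx μ t x y • g y) (Ioi 0) ∧
          ∃ L : ℂ, HasTruncatedLimit (besselHeatKernelDxx μ) f t x L ∧
            iteratedDeriv 2 (besselDuhamel μ f g t) x =
              L + ∫ y in Ioi (0 : ℝ), besselHeatKernelDxx μ t x y • g y)) := by
  obtain ⟨c', d', hc', -, hg0⟩ := hgc.exists_ae_eq_zero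
  have hK := continuousKernel_besselHeatKernel hμ
  have hKt := continuousKernel_besselHeatKernelDt hμ
  have hKxx := continuousKernel_besselHeatKernelDxx hμ
  refine ⟨fun t ht x hx => ⟨integrableOn_besselHeatKernel_smul_source hμ hf hfc ht hx,
    hK.integrableOn_smul hg hc' hg0 ht hx⟩, fun hf2 => ?_⟩
  obtain ⟨c, d, B, F, Fs, F₁, F₂, h, hfF⟩ := exists_isBesselSource hfc hf2
  refine ⟨h.isClassicalBesselSolution hμ hfF hg hc' hg0, fun t ht x hx => ?_⟩
  have hS : 0 < t + 1 := ht.trans (lt_add_one t)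
  have htS := lt_add_one t
  refine ⟨⟨hKt.integrableOn_smul hg hc' hg0 ht hx, _,
    h.hasTruncatedLimit hfF hKt (h.timeBounded_Dt hμ hS) ht htS.le hx, ?_⟩,
    ⟨hKxx.integrableOn_smul hg hc' hg0 ht hx, _,
    h.hasTruncatedLimit hfF hKxx (h.timeBounded_Dxx hμ hS) ht htS.le hx, ?_⟩⟩
  · rw [(h.hasDerivAt_besselDuhamel_time hμ hfF hg hc' hg0 ht htS hx).deriv,
      h.duhamelInt_time_eq hμ ht htS.le hx, setIntegral_Ioi_smul_eq _ hc' hg0,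
      hfF (t, x) ⟨ht, hx⟩]
  · rw [iteratedDeriv_succ, iteratedDeriv_one,
      (h.hasDerivAt_deriv_besselDuhamel hμ hfF hg hc' hg0 ht htS.le hx).deriv,
      setIntegral_Ioi_smul_eq _ hc' hg0]
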